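/- Let $k$ be a field and let $M$ be a (Hausdorff, second countable, topological) manifold of dimension $n\ge 0$. Let $\mathsf D(k_M)$ be the (unbounded) derived category of sheaves of $k$-vector spaces on $M$, let $k_M$ be the constant sheaf with stalk $k$, viewed as an object of $\mathsf D(k_M)$ in degree $0$, and let $\mathsf D_{\mathrm{lc}}(k_M)\subset \mathsf D(k_M)$ be the full subcategory of those $G$ such that $H^iG$ is a locally constant sheaf for every $i\in\mathbb Z$ (stalks may be infinite-dimensional). For a family $\mathcal F$ of objects of $\mathsf D(k_M)$, let $\mathcal F^{(0)}$ be the family of all objects isomorphic to a finite direct sum $\bigoplus_{i=1}^m F_i[d_i]$ with $F_i\in\mathcal F$ and $d_i\in\mathbb Z$, and define inductively $\mathcal F^{(j+1)}$ as the family of all $F$ for which there is a distinguished triangle $F_1\to F_0\to F\xrightarrow{+1}$ with $F_1\in\mathcal F^{(j)}$ and $F_0\in\mathcal F^{(0)}$. Let $L\in\mathsf D_{\mathrm{lc}}(k_M)$ be such that $H^iL\simeq 0$ for all $i<0$ and $H^0L\simeq k_M$, and set $$\mathcal F=\{F\in \mathsf D(k_M)\;;\; F\simeq L\otimes G\ \text{for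 some } G\in\mathsf D_{\mathrm{lc}}(k_M)\}.$$ Then there exists $F\in\mathcal F^{(\lceil (n-1)/2\rceil)}$ such that $k_M$ is a direct summand of $F$ in $\mathsf D(k_M)$. -/

import Mathlib

open CategoryTheory CategoryTheory.Limits CategoryTheory.Pretriangulated TopologicalSpace

universe w u

noncomputable section

namespace ConeIteration

/-! ### Iterated cones in a triangulated category -/

section Triangulated

variable {T : Type*} [Category* T] [HasZeroObject T] [HasShift T ℤ] [Preadditive T]
  [∀ n : ℤ, (shiftFunctor T n).Additive] [Pretriangulated T]

/-- The family `𝓕⁽⁰⁾` of all objects isomorphic to a finite direct sum `⨁ Eᵢ[dᵢ]` with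
`Eᵢ ∈ 𝓕` and `dᵢ ∈ ℤ`. -/
def FiniteSumsOfShifts (𝓕 : ObjectProperty T) : ObjectProperty T := fun F =>
  ∃ (m : ℕ) (E : Fin m → T) (d : Fin m → ℤ),
    (∀ i, 𝓕 (E i)) ∧ Nonempty (F ≅ ⨁ fun i => (E i)⟦d i⟧)

/-- The families `𝓕⁽ᵏ⁾`: an object `F` is in `𝓕⁽ᵏ⁺¹⁾` if there is a distinguished triangle
`F₁ → F₀ → F → F₁[1]` with `F₁ ∈ 𝓕⁽ᵏ⁾` and `F₀ ∈ 𝓕⁽⁰⁾`. -/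
def IteratedCones (𝓕 : ObjectProperty T) : ℕ → ObjectProperty T
  | 0 => FiniteSumsOfShifts 𝓕
  | k + 1 => fun F =>
      ∃ (F₁ F₀ : T) (f : F₁ ⟶ F₀) (g : F₀ ⟶ F) (h : F ⟶ F₁⟦(1 : ℤ)⟧),
        IteratedCones 𝓕 k F₁ ∧ FiniteSumsOfShifts 𝓕 F₀ ∧
          Triangle.mk f g h ∈ distTriang T

/-- `A` is a direct summand of `F`. -/
def IsDirectSummand (A F : T) : Prop := ∃ B : T, Nonempty (F ≅ A ⊞ B)

end Triangulated

/-! ### Sheaves of vector spaces and their tensor product -/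

section Sheaves

variable (k : Type u) [Field k] (X : TopCat.{u})

/-- The category of sheaves of `k`-vector spaces on the topological space `X`. -/
abbrev Sh : Type (u + 1) :=
  CategoryTheory.Sheaf (Opens.grothendieckTopology X) (ModuleCat.{u} k)

/-- The tensor product over `k` of sheaves: the sheafification of the tensor product of
presheaves. -/
instance instMonoidalSh : MonoidalCategory (Sh k X) :=
  CategoryTheory.Sheaf.monoidalCategory (Opens.grothendieckTopology X) (ModuleCat.{u} k)

/-- The sheafification functor. -/
abbrev sheafification : ((Opens X)ᵒᵖ ⥤ ModuleCat.{u} k) ⥤ Sh k X :=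
  presheafToSheaf (Opens.grothendieckTopology X) (ModuleCat.{u} k)

/-- A sheaf is the sheafification of its underlying presheaf. -/
def sheafificationIso :
    sheafToPresheaf (Opens.grothendieckTopology X) (ModuleCat.{u} k) ⋙ sheafification k X ≅
      𝟭 (Sh k X) :=
  asIso (sheafificationAdjunction (Opens.grothendieckTopology X) (ModuleCat.{u} k)).counit

instance instMonoidalPreadditivePresheaf :
    MonoidalPreadditive ((Opens X)ᵒᵖ ⥤ ModuleCat.{u} k) where
  whiskerLeft_zero := by intros; ext : 2; exact MonoidalPreadditive.whiskerLeft_zero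
  zero_whiskerRight := by intros; ext : 2; exact MonoidalPreadditive.zero_whiskerRight
  whiskerLeft_add := by intros; ext : 2; exact MonoidalPreadditive.whiskerLeft_add _ _
  add_whiskerRight := by intros; ext : 2; exact MonoidalPreadditive.add_whiskerRight _ _

theorem tensorLeft_additive (F : Sh k X) : (MonoidalCategory.tensorLeft F).Additive :=
  Functor.additive_of_iso
    (Functor.isoWhiskerLeft
        (sheafToPresheaf (Opens.grothendieckTopology X) (ModuleCat.{u} k))
        (Functor.Monoidal.commTensorLeft (sheafification k X) F.obj).symm ≪≫
      (Functor.associator _ _ _).symm ≪≫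
      Functor.isoWhiskerRight (sheafificationIso k X) _ ≪≫ Functor.leftUnitor _ ≪≫
      (MonoidalCategory.tensoringLeft (Sh k X)).mapIso ((sheafificationIso k X).app F))

theorem tensorRight_additive (F : Sh k X) : (MonoidalCategory.tensorRight F).Additive :=
  Functor.additive_of_iso
    (Functor.isoWhiskerLeft
        (sheafToPresheaf (Opens.grothendieckTopology X) (ModuleCat.{u} k))
        (Functor.Monoidal.commTensorRight (sheafification k X) F.obj).symm ≪≫
      (Functor.associator _ _ _).symm ≪≫
      Functor.isoWhiskerRight (sheafificationIso k X) _ ≪≫ Functor.leftUnitor _ ≪≫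
      (MonoidalCategory.tensoringRight (Sh k X)).mapIso ((sheafificationIso k X).app F))

instance instMonoidalPreadditiveSh : MonoidalPreadditive (Sh k X) where
  whiskerLeft_zero {F _ _} := by
    have := tensorLeft_additive k X F
    exact (MonoidalCategory.tensorLeft F).map_zero _ _
  zero_whiskerRight {F _ _} := by
    have := tensorRight_additive k X F
    exact (MonoidalCategory.tensorRight F).map_zero _ _
  whiskerLeft_add {F _ _} _ _ := by
    have := tensorLeft_additive k X F
    exact (MonoidalCategory.tensorLeft F).map_add
  add_whiskerRight {F _ _} _ _ := by
    have := tensorRight_additive k X F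
    exact (MonoidalCategory.tensorRight F).map_add

theorem hasColimitsOfSize_zero : HasColimitsOfSize.{0, 0} (Sh k X) :=
  have h : HasColimitsOfSize.{0, 0} (ModuleCat.{u} k) :=
    hasColimitsOfSizeShrink.{0, 0, u, u} (ModuleCat.{u} k)
  ⟨fun _ _ => have := h.has_colimits_of_shape; Sheaf.instHasColimitsOfShape⟩

instance instHasTensor (K₁ K₂ : CochainComplex (Sh k X) ℤ) :
    HomologicalComplex.HasTensor K₁ K₂ := fun _ =>
  ((hasColimitsOfSize_zero k X).has_colimits_of_shape _).has_colimit _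

/-- The constant sheaf `k_X`. -/
def constSheaf : Sh k X :=
  (constantSheaf (Opens.grothendieckTopology X) (ModuleCat.{u} k)).obj (ModuleCat.of k k)

variable {k X}

/-- `F` is locally constant: each point has an open neighbourhood `U` such that `F|_U` is
isomorphic to the constant sheaf on `U` of some `k`-vector space, of any dimension. -/
def IsLocallyConstantSheaf (F : Sh k X) : Prop :=
  ∀ x : X, ∃ U : Opens X, x ∈ U ∧
    CategoryTheory.Sheaf.IsConstant (Opens.grothendieckTopology U) (U.sheafRestrict.obj F)

end Sheaves

/-! ### The derived category `D(k_X)` -/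

section Derived

variable (k : Type u) [Field k] (X : TopCat.{u}) [HasDerivedCategory.{w} (Sh k X)]

/-- The constant sheaf `k_X` as an object of `D(k_X)`, placed in degree `0`. -/
def constObj : DerivedCategory (Sh k X) :=
  (DerivedCategory.singleFunctor (Sh k X) 0).obj (constSheaf k X)

variable {k X}

/-- `D_lc(k_X)`: the objects of `D(k_X)` all of whose cohomology sheaves are locally constant. -/
def Dlc : ObjectProperty (DerivedCategory (Sh k X)) := fun G =>
  ∀ i : ℤ, IsLocallyConstantSheaf ((DerivedCategory.homologyFunctor (Sh k X) i).obj G)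

/-- `F ≃ L ⊗ G` in `D(k_X)`. As `k` is a field, the tensor product of sheaves of `k`-vector
spaces is exact and every complex of such sheaves is K-flat; so the derived tensor product of
`L` and `G` is the total tensor product complex of any complexes representing `L` and `G`. -/
def IsTensor (L G F : DerivedCategory (Sh k X)) : Prop :=
  ∃ K₁ K₂ : CochainComplex (Sh k X) ℤ,
    Nonempty (DerivedCategory.Q.obj K₁ ≅ L) ∧ Nonempty (DerivedCategory.Q.obj K₂ ≅ G) ∧
      Nonempty (F ≅ DerivedCategory.Q.obj (HomologicalComplex.tensorObj K₁ K₂))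

/-- The family of all `F` with `F ≃ L ⊗ G` for some `G ∈ D_lc(k_X)`. -/
def tensorFamily (L : DerivedCategory (Sh k X)) : ObjectProperty (DerivedCategory (Sh k X)) :=
  fun F => ∃ G, Dlc G ∧ IsTensor L G F

end Derived

end ConeIteration

end

/-! Represent `L` by a complex `K` in degrees `≥ 0`. Since `H⁰K ≃ k_M`, there is a triangle `k_M → K
→ C → k_M[1]` with the cohomology of `C` in degrees `≥ 1` and locally constant. Tensoring it with
`P_j = C^{⊗j}` gives triangles `P_j → K ⊗ P_j → P_{j+1} → P_j[1]`
(`exists_distinguished_tensorPower`) whose middle terms lie in the family. By the octahedral axiom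
the cone of the composite `u : P_{j+1}[-j-1] → P_0 = k_M` is a `j`-fold iterated cone
(`exists_iteratedCone`). The Künneth formula `exists_isBilimit_kunneth` shows that each `P_j` has
locally constant cohomology, in degrees `≥ j`; so the source of `u` lives in degrees `≥ 2(j+1)`. As
soon as `2(j+1) > n`, `u` vanishes because `k_M` has injective dimension at most `n`
(`hom_constObj_eq_zero`), and then the cone splits as `k_M ⊕ P_{j+1}[-j]`.

For the injective dimension, truncate an injective resolution `I` of `k_M` at its `n`-cocycles `Zⁿ`.
Over a field flabby sheaves are injective (`Flabby.injective`) and flabbiness is local, so it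
suffices to extend sections of `Zⁿ` inside a chart (`flabby_cycles`). A cocycle on an open `W` in a
chart extends if it is `dy` there, because `y` extends. For `n ≥ 1` this is `Hⁿ(W; k) = 0`, i.e.
`exists_d_eq`.

That vanishing is proved by exhausting `W` by finite unions of convex compact sets. `Hᵖ` of a
compact subset of `ℝⁿ` vanishes for `p ≥ n`, `p ≥ 1`, by slicing along coordinates
(`van_of_card_le`). The `lim¹` obstruction in degree `n - 1` disappears by Mittag-Leffler, since
finite unions of convex compact sets have finite-dimensional cohomology (`finH_biUnion_of_convex`).
-/

/-! ### Cohomology near compact sets and Mayer–Vietoris -/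

/-- A complex of `k`-vector spaces together with, for each open subset `U`, a subcomplex of elements
"vanishing on `U`". The global sections of a complex of flabby sheaves give an example. -/
structure SupportedComplex (k : Type*) [Field k] (X : Type*) [TopologicalSpace X] where
  /-- The terms of the complex. -/
  A : ℤ → Type u
  [addCommGroup : ∀ p, AddCommGroup (A p)]
  [module : ∀ p, Module k (A p)]
  /-- The differentials. -/
  d : ∀ p q, A p →ₗ[k] A q
  d_d : ∀ p q r x, d q r (d p q x) = 0
  /-- The elements vanishing on an open subset. -/
  N : ∀ p, Opens X → Submodule k (A p)
  d_mem : ∀ {p U x} (q), x ∈ N p U → d p q x ∈ N q U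
  anti : ∀ {p U V}, U ≤ V → N p V ≤ N p U
  mem_sSup : ∀ {p} (𝒰 : Set (Opens X)) {x}, (∀ U ∈ 𝒰, x ∈ N p U) → x ∈ N p (sSup 𝒰)
  -- `inf_le` and `glue` encode flabbiness: the first gives surjectivity in Mayer–Vietoris, the
  -- second lets sections that agree on growing open sets be assembled into a global one.
  inf_le : ∀ {p U V}, N p (U ⊓ V) ≤ N p U ⊔ N p V
  glue : ∀ {p} (U : ℕ → Opens X), Monotone U → ∀ s : ℕ → A p,
    (∀ j, s (j + 1) - s j ∈ N p (U j)) → ∃ t, ∀ j, t - s j ∈ N p (U j)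

namespace SupportedComplex

attribute [instance] SupportedComplex.addCommGroup SupportedComplex.module

variable {k : Type*} [Field k] {X : Type*} [TopologicalSpace X] (S : SupportedComplex.{u} k X)

lemma mem_sup {p : ℤ} {U V : Opens X} {x : S.A p} (hU : x ∈ S.N p U) (hV : x ∈ S.N p V) :
    x ∈ S.N p (U ⊔ V) := by
  rw [← sSup_pair]
  exact S.mem_sSup _ (by rintro _ (rfl | rfl) <;> assumption)

lemma mem_bot {p : ℤ} (x : S.A p) : x ∈ S.N p ⊥ := by
  rw [← sSup_empty]
  exact S.mem_sSup _ (by simp)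

/-- The elements vanishing in a neighbourhood of the set `K`. -/
def Ng (p : ℤ) (K : Set X) : Submodule k (S.A p) where
  carrier := {s | ∃ U : Opens X, K ⊆ U ∧ s ∈ S.N p U}
  add_mem' := by
    rintro a b ⟨U, hU, ha⟩ ⟨V, hV, hb⟩
    exact ⟨U ⊓ V, Set.subset_inter hU hV,
      add_mem (S.anti inf_le_left ha) (S.anti inf_le_right hb)⟩
  zero_mem' := ⟨⊤, by simp, zero_mem _⟩
  smul_mem' := by
    rintro c a ⟨U, hU, ha⟩
    exact ⟨U, hU, Submodule.smul_mem _ _ ha⟩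

/-- Cocycles near `K`. -/
def Zg (p q : ℤ) (K : Set X) : Submodule k (S.A p) := (S.Ng q K).comap (S.d p q)

/-- Coboundaries near `K`. -/
def Bg (o p : ℤ) (K : Set X) : Submodule k (S.A p) := S.Ng p K ⊔ LinearMap.range (S.d o p)

variable {S}

lemma mem_Zg {p q : ℤ} {K : Set X} {s : S.A p} : s ∈ S.Zg p q K ↔ S.d p q s ∈ S.Ng q K := Iff.rfl

lemma mem_Bg {o p : ℤ} {K : Set X} {s : S.A p} :
    s ∈ S.Bg o p K ↔ ∃ y, s - S.d o p y ∈ S.Ng p K := by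
  unfold Bg
  rw [Submodule.mem_sup]
  constructor
  · rintro ⟨a, ha, _, ⟨y, rfl⟩, rfl⟩
    exact ⟨y, by simpa using ha⟩
  · rintro ⟨y, hy⟩
    exact ⟨_, hy, _, ⟨y, rfl⟩, by simp⟩

lemma Ng_anti {p : ℤ} {K K' : Set X} (h : K ⊆ K') : S.Ng p K' ≤ S.Ng p K :=
  fun _ ⟨U, hU, hs⟩ => ⟨U, h.trans hU, hs⟩

lemma Zg_anti {p q : ℤ} {K K' : Set X} (h : K ⊆ K') : S.Zg p q K' ≤ S.Zg p q K :=
  Submodule.comap_mono (Ng_anti h)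

lemma Bg_anti {p q : ℤ} {K K' : Set X} (h : K ⊆ K') : S.Bg p q K' ≤ S.Bg p q K :=
  sup_le_sup_right (Ng_anti h) _

lemma d_mem_Ng {p : ℤ} {K : Set X} {s : S.A p} (q : ℤ) (h : s ∈ S.Ng p K) :
    S.d p q s ∈ S.Ng q K := by
  obtain ⟨U, hU, hs⟩ := h
  exact ⟨U, hU, S.d_mem q hs⟩

lemma mem_Ng_empty {p : ℤ} (s : S.A p) : s ∈ S.Ng p ∅ := ⟨⊥, by simp, S.mem_bot s⟩

lemma mem_Ng_union {p : ℤ} {K₁ K₂ : Set X} {s : S.A p} (h₁ : s ∈ S.Ng p K₁)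
    (h₂ : s ∈ S.Ng p K₂) : s ∈ S.Ng p (K₁ ∪ K₂) := by
  obtain ⟨U, hU, hs⟩ := h₁
  obtain ⟨V, hV, hs'⟩ := h₂
  exact ⟨U ⊔ V, Set.union_subset_union hU hV, S.mem_sup hs hs'⟩

/-- If `s` vanishes on `W ⊇ K₁ ∩ K₂`, the compact sets `K₁ \ W` and `K₂ \ W` are disjoint, hence
separated by open sets. Adding `W` to each gives neighbourhoods of `K₁` and `K₂` meeting only inside
`W`, to which the axiom `inf_le` applies. -/
lemma Ng_inter_le [T2Space X] {p : ℤ} {K₁ K₂ : Set X} (h₁ : IsCompact K₁) (h₂ : IsCompact K₂) :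
    S.Ng p (K₁ ∩ K₂) ≤ S.Ng p K₁ ⊔ S.Ng p K₂ := by
  rintro s ⟨W, hW, hs⟩
  obtain ⟨G₁, G₂, hG₁, hG₂, hK₁, hK₂, hd⟩ := SeparatedNhds.of_isCompact_isCompact
    (h₁.diff W.isOpen) (h₂.diff W.isOpen) (by
      rw [Set.disjoint_left]
      rintro x ⟨hx₁, hx⟩ ⟨hx₂, -⟩
      exact hx (hW ⟨hx₁, hx₂⟩))
  let V₁ : Opens X := ⟨G₁, hG₁⟩ ⊔ W
  let V₂ : Opens X := ⟨G₂, hG₂⟩ ⊔ W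
  have hV : V₁ ⊓ V₂ ≤ W := by
    rintro x ⟨hx₁ | hx₁, hx₂ | hx₂⟩
    · exact (Set.disjoint_left.1 hd hx₁ hx₂).elim
    all_goals assumption
  obtain ⟨a, ha, b, hb, rfl⟩ := Submodule.mem_sup.1 (S.inf_le (S.anti hV hs))
  refine Submodule.mem_sup.2 ⟨a, ⟨V₁, ?_, ha⟩, b, ⟨V₂, ?_, hb⟩, rfl⟩
  · intro x hx
    by_cases h : x ∈ W
    · exact Or.inr h
    · exact Or.inl (hK₁ ⟨hx, h⟩)
  · intro x hx
    by_cases h : x ∈ W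
    · exact Or.inr h
    · exact Or.inl (hK₂ ⟨hx, h⟩)

variable (S) in
/-- The cohomology near `K` vanishes in degree `p` (where `o`, `p`, `q` are consecutive). -/
def Van (o p q : ℤ) (K : Set X) : Prop := S.Zg p q K ≤ S.Bg o p K

variable (S) in
/-- Every cocycle near `K` extends to a global cocycle. -/
def Extends (p q : ℤ) (K : Set X) : Prop := S.Zg p q K ≤ LinearMap.ker (S.d p q) ⊔ S.Ng p K

lemma Van.extends {o p q : ℤ} {K : Set X} (h : S.Van o p q K) : S.Extends p q K := by
  intro s hs
  obtain ⟨y, hy⟩ := mem_Bg.1 (h hs)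
  exact Submodule.mem_sup.2 ⟨S.d o p y, by simp [S.d_d], _, hy, by simp⟩

lemma van_empty (o p q : ℤ) : S.Van o p q ∅ := fun _ _ => mem_Bg.2 ⟨0, mem_Ng_empty _⟩

/-- Mayer–Vietoris: two local primitives differ by a cocycle near `K₁ ∩ K₂`. Once that cocycle is
extended globally, it can be used to correct one primitive, and the remaining discrepancy is split
into parts vanishing near `K₁` and near `K₂`. -/
lemma mem_Bg_union [T2Space X] {o p : ℤ} {K₁ K₂ : Set X} (h₁ : IsCompact K₁) (h₂ : IsCompact K₂)
    (h : S.Extends o p (K₁ ∩ K₂)) {s : S.A p} (hs₁ : s ∈ S.Bg o p K₁) (hs₂ : s ∈ S.Bg o p K₂) :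
    s ∈ S.Bg o p (K₁ ∪ K₂) := by
  obtain ⟨y₁, hy₁⟩ := mem_Bg.1 hs₁
  obtain ⟨y₂, hy₂⟩ := mem_Bg.1 hs₂
  have hz : y₁ - y₂ ∈ S.Zg o p (K₁ ∩ K₂) := by
    rw [mem_Zg]
    have : S.d o p (y₁ - y₂) = (s - S.d o p y₂) - (s - S.d o p y₁) := by
      rw [map_sub]; abel
    rw [this]
    exact sub_mem (Ng_anti Set.inter_subset_right hy₂) (Ng_anti Set.inter_subset_left hy₁)
  obtain ⟨w, hw, v, hv, hwv⟩ := Submodule.mem_sup.1 (h hz)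
  obtain ⟨v₁, hv₁, v₂, hv₂, rfl⟩ := Submodule.mem_sup.1 (Ng_inter_le h₁ h₂ hv)
  rw [LinearMap.mem_ker] at hw
  refine mem_Bg.2 ⟨y₁ - v₁, mem_Ng_union ?_ ?_⟩
  · have : s - S.d o p (y₁ - v₁) = (s - S.d o p y₁) + S.d o p v₁ := by
      rw [map_sub]; abel
    rw [this]
    exact add_mem hy₁ (d_mem_Ng _ hv₁)
  · have h1 : y₁ - v₁ = y₂ + w + v₂ := by
      rw [sub_eq_iff_eq_add.1 hwv.symm]; abel
    have : s - S.d o p (y₁ - v₁) = (s - S.d o p y₂) - S.d o p v₂ := by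
      rw [h1, map_add, map_add, hw]; abel
    rw [this]
    exact sub_mem hy₂ (d_mem_Ng _ hv₂)

/-- A tube lemma: if `s` vanishes on `V`, the compact image `f '' (K \ V)` misses `t`, and its
complement is the required neighbourhood. -/
lemma exists_slab [T2Space X] {p : ℤ} {K : Set X} (hK : IsCompact K) {f : X → ℝ}
    (hf : Continuous f) (t : ℝ) {s : S.A p} (hs : s ∈ S.Ng p (K ∩ f ⁻¹' {t})) :
    ∃ U : Set ℝ, IsOpen U ∧ t ∈ U ∧ ∀ C, C ⊆ U → s ∈ S.Ng p (K ∩ f ⁻¹' C) := by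
  obtain ⟨V, hV, hs⟩ := hs
  have hc : IsClosed (f '' (K \ V)) := ((hK.diff V.isOpen).image hf).isClosed
  refine ⟨(f '' (K \ V))ᶜ, hc.isOpen_compl, ?_, fun C hC => ⟨V, ?_, hs⟩⟩
  · rintro ⟨x, ⟨hx, hxV⟩, rfl⟩
    exact hxV (hV ⟨hx, rfl⟩)
  · rintro x ⟨hx, hxC⟩
    by_contra hxV
    exact hC hxC ⟨x, ⟨hx, hxV⟩, rfl⟩

/-- If the cohomology of all slices of `K` vanishes in degree `p` and the cocycles of degree `p - 1`
near the slices extend, then the cohomology of `K` vanishes in degree `p`. -/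
lemma van_of_slices [T2Space X] {o p q : ℤ} {K : Set X} (hK : IsCompact K) {f : X → ℝ}
    (hf : Continuous f) (h₁ : ∀ t, S.Van o p q (K ∩ f ⁻¹' {t}))
    (h₂ : ∀ t, S.Extends o p (K ∩ f ⁻¹' {t})) : S.Van o p q K := by
  intro s hs
  have hloc : ∀ t : ℝ, ∃ U : Set ℝ, IsOpen U ∧ t ∈ U ∧
      ∀ C, C ⊆ U → s ∈ S.Bg o p (K ∩ f ⁻¹' C) := by
    intro t
    obtain ⟨y, hy⟩ := mem_Bg.1 (h₁ t (Zg_anti Set.inter_subset_left hs))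
    obtain ⟨U, hU, htU, hC⟩ := exists_slab hK hf t hy
    exact ⟨U, hU, htU, fun C h => mem_Bg.2 ⟨y, hC C h⟩⟩
  choose U hU htU hUC using hloc
  obtain ⟨r, hr⟩ := (hK.image hf).isBounded.subset_closedBall 0
  rw [Real.closedBall_eq_Icc, zero_sub, zero_add] at hr
  obtain ⟨τ, hτ0, hτ, ⟨m, hm⟩, hτU⟩ := exists_monotone_Icc_subset_open_cover_Icc
    (neg_le_self (abs_nonneg r)) (c := fun t => Subtype.val ⁻¹' U t)
    (fun t => (hU t).preimage continuous_subtype_val)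
    (fun t _ => Set.mem_iUnion.2 ⟨t, htU t⟩)
  -- Sweep through the range of `f` one short interval at a time. Consecutive slabs meet in a single
  -- slice, so the extension hypothesis on slices is exactly what gluing needs.
  have key : ∀ j : ℕ, s ∈ S.Bg o p (K ∩ f ⁻¹' Set.Icc (-|r|) (τ j)) := by
    intro j
    induction j with
    | zero =>
      refine hUC (-|r|) _ ?_
      rw [hτ0, Set.Icc_self]
      simpa using htU _
    | succ j ih =>
      obtain ⟨i, hi⟩ := hτU j
      have hi' : Set.Icc (τ j : ℝ) (τ (j + 1)) ⊆ U i := fun x hx =>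
        hi (a := ⟨x, (τ j).2.1.trans hx.1, hx.2.trans (τ (j + 1)).2.2⟩) hx
      have hle : (τ j : ℝ) ≤ τ (j + 1) := hτ (Nat.le_succ j)
      rw [← Set.Icc_union_Icc_eq_Icc (τ j).2.1 hle, Set.preimage_union,
        Set.inter_union_distrib_left]
      refine mem_Bg_union (hK.inter_right (isClosed_Icc.preimage hf))
        (hK.inter_right (isClosed_Icc.preimage hf)) ?_ ih (hUC i _ hi')
      rw [← Set.inter_inter_distrib_left, ← Set.preimage_inter,
        Set.Icc_inter_Icc_eq_singleton (τ j).2.1 hle]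
      exact h₂ _
  have := key m
  rw [hm m le_rfl] at this
  have hsub : K ⊆ K ∩ f ⁻¹' Set.Icc (-|r|) |r| := fun x hx => ⟨hx, by
    have hx' := hr (Set.mem_image_of_mem f hx)
    exact ⟨(neg_le_neg (le_abs_self r)).trans hx'.1, hx'.2.trans (le_abs_self r)⟩⟩
  exact Bg_anti hsub this

lemma mem_Ng_of_forall {p : ℤ} {K : Set X} {s : S.A p} (h : ∀ x ∈ K, s ∈ S.Ng p {x}) :
    s ∈ S.Ng p K := by
  refine ⟨sSup {U | s ∈ S.N p U}, fun x hx => ?_, S.mem_sSup _ (fun U hU => hU)⟩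
  obtain ⟨U, hU, hs⟩ := h x hx
  exact Opens.mem_sSup.2 ⟨U, hs, hU rfl⟩

variable (S) in
/-- On the open subset `O`, the complex is a resolution of the constant sheaf generated by `e`. -/
structure IsConstResolution (O : Set X) (e : S.A 0) : Prop where
  d_e : ∀ q, S.d 0 q e = 0
  exact : ∀ {o p q : ℤ}, o + 1 = p → p + 1 = q → p ≠ 0 → ∀ x ∈ O, S.Van o p q {x}
  eq_zero : ∀ p < 0, ∀ s : S.A p, s = 0
  exact₀ : ∀ x ∈ O, ∀ s ∈ S.Zg 0 1 {x}, ∃ c : k, s - c • e ∈ S.Ng 0 {x}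
  ne : ∀ x ∈ O, e ∉ S.Ng 0 {x}

namespace IsConstResolution

variable {O : Set X} {e : S.A 0} (hS : S.IsConstResolution O e)

include hS

/-- The locus where `s` equals `c • e` locally is open for every `c`, and loci for different `c` are
disjoint over `O` because `e` has nonzero germs there. Connectedness of `K` leaves only one
constant. -/
lemma exists_const_of_isPreconnected {K : Set X} (hK : IsPreconnected K) (hKO : K ⊆ O)
    {s : S.A 0} (hs : s ∈ S.Zg 0 1 K) : ∃ c : k, s - c • e ∈ S.Ng 0 K := by
  rcases K.eq_empty_or_nonempty with rfl | ⟨x₀, hx₀⟩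
  · exact ⟨0, mem_Ng_empty _⟩
  have hloc : ∀ x ∈ K, ∃ c : k, s - c • e ∈ S.Ng 0 {x} := fun x hx =>
    hS.exact₀ x (hKO hx) s (Zg_anti (Set.singleton_subset_iff.2 hx) hs)
  have hopen : ∀ c : k, IsOpen {x | s - c • e ∈ S.Ng 0 {x}} := fun c => by
    rw [isOpen_iff_forall_mem_open]
    rintro x ⟨U, hU, hsU⟩
    exact ⟨U, fun y hy => ⟨U, Set.singleton_subset_iff.2 hy, hsU⟩, U.isOpen, hU rfl⟩
  obtain ⟨c, hc⟩ := hloc x₀ hx₀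
  refine ⟨c, mem_Ng_of_forall ?_⟩
  by_contra! hcon
  obtain ⟨x₁, hx₁, hx₁c⟩ := hcon
  obtain ⟨c₁, hc₁⟩ := hloc x₁ hx₁
  have hv : IsOpen (⋃ c' ∈ {c' : k | c' ≠ c}, {x | s - c' • e ∈ S.Ng 0 {x}}) :=
    isOpen_biUnion fun c' _ => hopen c'
  obtain ⟨x, hxK, hxu, hxv⟩ := hK _ _ (hopen c) hv (fun x hx => by
      obtain ⟨c', hc'⟩ := hloc x hx
      by_cases h : c' = c
      · subst h; exact Or.inl hc'
      · exact Or.inr (Set.mem_biUnion h hc')) ⟨x₀, hx₀, hc⟩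
    ⟨x₁, hx₁, Set.mem_biUnion (fun h => hx₁c (h ▸ hc₁)) hc₁⟩
  obtain ⟨c', hc', hxc'⟩ := Set.mem_iUnion₂.1 hxv
  have hce : (c' - c) • e ∈ S.Ng 0 {x} := by
    have : (c' - c) • e = (s - c • e) - (s - c' • e) := by rw [sub_smul]; abel
    rw [this]
    exact sub_mem hxu hxc'
  exact hS.ne x (hKO hxK) (((S.Ng 0 {x}).smul_mem_iff (sub_ne_zero.2 hc')).1 hce)

lemma extends_of_isPreconnected {K : Set X} (hK : IsPreconnected K) (hKO : K ⊆ O) :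
    S.Extends 0 1 K := fun s hs => by
  obtain ⟨c, hc⟩ := hS.exists_const_of_isPreconnected hK hKO hs
  exact Submodule.mem_sup.2 ⟨c • e, by simp [hS.d_e], _, hc, by simp⟩

lemma van_of_subsingleton {o p q : ℤ} (hop : o + 1 = p) (hpq : p + 1 = q) (hp : p ≠ 0)
    {K : Set X} (hK : K.Subsingleton) (hKO : K ⊆ O) : S.Van o p q K := by
  rcases hK.eq_empty_or_singleton with rfl | ⟨x, rfl⟩
  · exact van_empty _ _ _
  · exact hS.exact hop hpq hp x (hKO rfl)

end IsConstResolution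

/-! ### Finite-dimensionality of cohomology -/

variable (S) in
/-- The cohomology near `K` has finite dimension in degree `p`. -/
def FinH (o p q : ℤ) (K : Set X) : Prop :=
  ∃ T : Submodule k (S.A p), T.FG ∧ S.Zg p q K ≤ T ⊔ S.Bg o p K

lemma Van.finH {o p q : ℤ} {K : Set X} (h : S.Van o p q K) : S.FinH o p q K :=
  ⟨⊥, Submodule.fg_bot, by rw [bot_sup_eq]; exact h⟩

end SupportedComplex

lemma Submodule.exists_fg_le_sup_of_map {k V W : Type*} [Field k] [AddCommGroup V] [Module k V]
    [AddCommGroup W] [Module k W] (φ : V →ₗ[k] W) (Z : Submodule k V) {D : Submodule k W}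
    (hD : D.FG) (hDZ : D ≤ Z.map φ) :
    ∃ T ≤ Z, T.FG ∧ D ≤ T.map φ := by
  classical
  obtain ⟨F, rfl⟩ := hD
  obtain ⟨F', hF', rfl⟩ := Finset.subset_set_image_iff.1
    ((Submodule.subset_span (R := k)).trans hDZ : (F : Set W) ⊆ φ '' Z)
  refine ⟨span k F', span_le.2 hF', ⟨F', rfl⟩, ?_⟩
  rw [Submodule.map_span, Finset.coe_image]

lemma Submodule.FG.of_le_of_field {k V : Type*} [Field k] [AddCommGroup V] [Module k V]
    {S T : Submodule k V} (hT : T.FG) (h : S ≤ T) : S.FG := by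
  have : Module.Finite k T := Module.Finite.iff_fg.2 hT
  have := Submodule.finiteDimensional_of_le h
  exact Module.Finite.iff_fg.1 this

/-- The image of `Z` modulo `B` is finite-dimensional, and a finite generating set of it lifts to
`Z`. Having the representatives inside `Z` lets differences with them stay in `Z`. -/
lemma Submodule.exists_fg_le_sup {k V : Type*} [Field k] [AddCommGroup V] [Module k V]
    {Z T B : Submodule k V} (hT : T.FG) (h : Z ≤ T ⊔ B) :
    ∃ T' ≤ Z, T'.FG ∧ Z ≤ T' ⊔ B := by
  have h1 : Z.map B.mkQ ≤ T.map B.mkQ := by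
    refine (Submodule.map_mono h).trans ?_
    rw [Submodule.map_sup, Submodule.mkQ_map_self, sup_bot_eq]
  obtain ⟨T', hT', hfg, hle⟩ := exists_fg_le_sup_of_map B.mkQ Z
    ((hT.map _).of_le_of_field h1) le_rfl
  refine ⟨T', hT', hfg, ?_⟩
  rw [Submodule.map_le_iff_le_comap, Submodule.comap_map_mkQ, sup_comm] at hle
  exact hle

namespace SupportedComplex

variable {k : Type*} [Field k] {X : Type*} [TopologicalSpace X] {S : SupportedComplex.{u} k X}

/-- Mayer–Vietoris exactness: modulo finite dimension a class restricts to zero on both pieces, so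
it comes from `H^{p-1}(K₁ ∩ K₂)` through the connecting map, whose image is finite-dimensional. -/
lemma FinH.union [T2Space X] {l o p q : ℤ} {K₁ K₂ : Set X} (h₁ : IsCompact K₁)
    (h₂ : IsCompact K₂) (hf₁ : S.FinH o p q K₁) (hf₂ : S.FinH o p q K₂)
    (hf : S.FinH l o p (K₁ ∩ K₂)) : S.FinH o p q (K₁ ∪ K₂) := by
  obtain ⟨T₁, hT₁, hZ₁⟩ := hf₁
  obtain ⟨T₂, hT₂, hZ₂⟩ := hf₂
  obtain ⟨T₁₂, hT₁₂, hZ₁₂⟩ := hf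
  obtain ⟨T, hTZ, hT, hZ⟩ := Submodule.exists_fg_le_sup hT₁₂ hZ₁₂
  -- cocycles which are coboundaries near both pieces
  obtain ⟨T', hT', hZ'⟩ : ∃ T' : Submodule k (S.A p), T'.FG ∧
      S.Zg p q (K₁ ∪ K₂) ≤ T' ⊔ (S.Bg o p K₁ ⊓ S.Bg o p K₂) := by
    obtain ⟨T₁', hT₁'Z, hT₁', hle₁⟩ := Submodule.exists_fg_le_sup hT₁
      ((Zg_anti (S := S) Set.subset_union_left).trans hZ₁)
    have : S.Zg p q (K₁ ∪ K₂) ⊓ S.Bg o p K₁ ≤ T₂ ⊔ S.Bg o p K₂ :=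
      inf_le_left.trans ((Zg_anti Set.subset_union_right).trans hZ₂)
    obtain ⟨T₂', hT₂'Z, hT₂', hle₂⟩ := Submodule.exists_fg_le_sup hT₂ this
    refine ⟨T₁' ⊔ T₂', hT₁'.sup hT₂', fun s hs => ?_⟩
    obtain ⟨a, ha, b, hb, rfl⟩ := Submodule.mem_sup.1 (hle₁ hs)
    have hbZ : b ∈ S.Zg p q (K₁ ∪ K₂) := by
      simpa using sub_mem hs (hT₁'Z ha)
    obtain ⟨c, hc, e, he, rfl⟩ := Submodule.mem_sup.1 (hle₂ ⟨hbZ, hb⟩)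
    have he₁ : e ∈ S.Bg o p K₁ := by
      simpa using sub_mem hb (hT₂'Z hc).2
    rw [← add_assoc]
    exact Submodule.add_mem_sup (Submodule.add_mem_sup ha hc) ⟨he₁, he⟩
  -- the connecting homomorphism
  obtain ⟨T'', hT''N, hT'', hle⟩ : ∃ T'' ≤ S.Ng p K₁, T''.FG ∧
      T.map (S.d o p) ≤ T'' ⊔ S.Ng p K₂ := by
    have h0 : T.map (S.d o p) ≤ S.Ng p K₁ ⊔ S.Ng p K₂ := by
      rw [Submodule.map_le_iff_le_comap]
      exact hTZ.trans (Submodule.comap_mono (Ng_inter_le h₁ h₂))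
    have h1 : (T.map (S.d o p)).map (S.Ng p K₂).mkQ ≤ (S.Ng p K₁).map (S.Ng p K₂).mkQ := by
      refine (Submodule.map_mono h0).trans ?_
      rw [Submodule.map_sup, Submodule.mkQ_map_self, sup_bot_eq]
    obtain ⟨T'', hN, hfg, hle⟩ := Submodule.exists_fg_le_sup_of_map _ _ ((hT.map _).map _) h1
    refine ⟨T'', hN, hfg, ?_⟩
    rw [Submodule.map_le_iff_le_comap, Submodule.comap_map_mkQ, sup_comm] at hle
    exact hle
  refine ⟨T' ⊔ T'', hT'.sup hT'', hZ'.trans ?_⟩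
  rw [sup_assoc]
  refine sup_le_sup_left ?_ _
  rintro s ⟨hs₁, hs₂⟩
  obtain ⟨y₁, hy₁⟩ := mem_Bg.1 hs₁
  obtain ⟨y₂, hy₂⟩ := mem_Bg.1 hs₂
  have hz : y₁ - y₂ ∈ S.Zg o p (K₁ ∩ K₂) := by
    rw [mem_Zg]
    have : S.d o p (y₁ - y₂) = (s - S.d o p y₂) - (s - S.d o p y₁) := by
      rw [map_sub]; abel
    rw [this]
    exact sub_mem (Ng_anti Set.inter_subset_right hy₂) (Ng_anti Set.inter_subset_left hy₁)
  obtain ⟨w, hw, b, hb, hwb⟩ := Submodule.mem_sup.1 (hZ hz)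
  obtain ⟨x, hx⟩ := mem_Bg.1 hb
  obtain ⟨a₁, ha₁, a₂, ha₂, ha⟩ := Submodule.mem_sup.1 (Ng_inter_le h₁ h₂ hx)
  obtain ⟨τ, hτ, n₂, hn₂, hτn⟩ := Submodule.mem_sup.1 (hle (Submodule.mem_map_of_mem hw))
  have hd : S.d o p y₁ - S.d o p y₂ = τ + n₂ + S.d o p a₁ + S.d o p a₂ := by
    have : b = a₁ + a₂ + S.d l o x := by rw [ha]; abel
    rw [← map_sub, ← hwb, this, map_add, map_add, map_add, S.d_d, ← hτn]
    abel
  -- `τ` represents the connecting image of `w`. It vanishes near `K₁`, and near `K₂` it accounts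
  -- for the difference between `d y₁` and `d y₂`, so `y₁ - a₁` is a primitive of `s + τ` near both
  -- sets.
  refine Submodule.mem_sup.2 ⟨-τ, neg_mem hτ, s + τ, mem_Bg.2 ⟨y₁ - a₁, mem_Ng_union ?_ ?_⟩,
    by simp⟩
  · have : s + τ - S.d o p (y₁ - a₁) = (s - S.d o p y₁) + τ + S.d o p a₁ := by
      rw [map_sub]; abel
    rw [this]
    exact add_mem (add_mem hy₁ (hT''N hτ)) (d_mem_Ng _ ha₁)
  · have : s + τ - S.d o p (y₁ - a₁) = (s - S.d o p y₂) - n₂ - S.d o p a₂ := by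
      rw [map_sub, sub_eq_iff_eq_add.1 hd]; abel
    rw [this]
    exact sub_mem (sub_mem hy₂ hn₂) (d_mem_Ng _ ha₂)

end SupportedComplex

/-! ### Cohomology of compact and open subsets of `ℝⁿ` -/

namespace SupportedComplex.IsConstResolution

variable {k : Type*} [Field k] {ι : Type*} [Finite ι] {S : SupportedComplex.{u} k (ι → ℝ)}
  {O : Set (ι → ℝ)} {e : S.A 0} (hS : S.IsConstResolution O e)

include hS

-- `T` collects the coordinates that may vary on `K`, so its cardinality bounds the dimension.
-- Slicing along `i` lowers both this bound and, for the extension condition, the degree by one.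
omit [Finite ι] in
lemma van_of_card_le (T : Finset ι) {o p q : ℤ} (hop : o + 1 = p) (hpq : p + 1 = q) (hp : 1 ≤ p)
    (hT : T.card ≤ p) {K : Set (ι → ℝ)} (hK : IsCompact K) (hKO : K ⊆ O)
    (hKT : ∀ x ∈ K, ∀ y ∈ K, ∀ i ∉ T, x i = y i) : S.Van o p q K := by
  classical
  induction T using Finset.induction_on generalizing o p q K with
  | empty =>
    exact hS.van_of_subsingleton hop hpq (by lia)
      (fun x hx y hy => funext fun i => hKT x hx y hy i (by simp)) hKO
  | insert i T hi ih =>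
    rw [Finset.card_insert_of_notMem hi] at hT
    push_cast at hT
    have hc : Continuous (fun x : ι → ℝ => x i) := continuous_apply i
    have hslice : ∀ t, IsCompact (K ∩ (fun x : ι → ℝ => x i) ⁻¹' {t}) := fun t =>
      hK.inter_right (isClosed_singleton.preimage hc)
    have hconst : ∀ t, ∀ x ∈ K ∩ (fun x : ι → ℝ => x i) ⁻¹' {t},
        ∀ y ∈ K ∩ (fun x : ι → ℝ => x i) ⁻¹' {t}, ∀ j ∉ T, x j = y j := by
      intro t x hx y hy j hj
      by_cases hji : j = i
      · subst hji; exact hx.2.trans hy.2.symm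
      · exact hKT x hx.1 y hy.1 j (by simp [hji, hj])
    refine van_of_slices hK hc (fun t => ih hop hpq hp (by lia) (hslice t)
      (Set.inter_subset_left.trans hKO) (hconst t)) (fun t => ?_)
    -- Degree `0` is special, since `H⁰` does not vanish. Here the bound forces `T = ∅`, so the
    -- slice has at most one point and its locally constant sections extend as multiples of `e`.
    by_cases ho : o = 0
    · obtain rfl : T = ∅ := Finset.card_eq_zero.1 (by lia)
      subst ho
      obtain rfl : p = 1 := by lia
      exact hS.extends_of_isPreconnected (Set.Subsingleton.isPreconnected fun x hx y hy =>
        funext fun j => hconst t x hx y hy j (by simp)) (Set.inter_subset_left.trans hKO)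
    · exact (ih (o := o - 1) (by lia) hop (by lia) (by lia) (hslice t)
        (Set.inter_subset_left.trans hKO) (hconst t)).extends

-- The same slicing induction without a bound on the degree: slices of a convex set are convex,
-- hence connected, so the degree `0` extension condition holds whatever the dimension.
omit [Finite ι] in
lemma van_of_convex_aux (T : Finset ι) {o p q : ℤ} (hop : o + 1 = p) (hpq : p + 1 = q)
    (hp : 1 ≤ p) {K : Set (ι → ℝ)} (hK : IsCompact K) (hK' : Convex ℝ K) (hKO : K ⊆ O)
    (hKT : ∀ x ∈ K, ∀ y ∈ K, ∀ i ∉ T, x i = y i) : S.Van o p q K := by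
  classical
  induction T using Finset.induction_on generalizing o p q K with
  | empty =>
    exact hS.van_of_subsingleton hop hpq (by lia)
      (fun x hx y hy => funext fun i => hKT x hx y hy i (by simp)) hKO
  | insert i T hi ih =>
    have hc : Continuous (fun x : ι → ℝ => x i) := continuous_apply i
    have hslice : ∀ t, IsCompact (K ∩ (fun x : ι → ℝ => x i) ⁻¹' {t}) := fun t =>
      hK.inter_right (isClosed_singleton.preimage hc)
    have hslice' : ∀ t, Convex ℝ (K ∩ (fun x : ι → ℝ => x i) ⁻¹' {t}) := fun t =>
      hK'.inter ((convex_singleton t).linear_preimage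
        (LinearMap.proj (R := ℝ) (φ := fun _ : ι => ℝ) i))
    have hconst : ∀ t, ∀ x ∈ K ∩ (fun x : ι → ℝ => x i) ⁻¹' {t},
        ∀ y ∈ K ∩ (fun x : ι → ℝ => x i) ⁻¹' {t}, ∀ j ∉ T, x j = y j := by
      intro t x hx y hy j hj
      by_cases hji : j = i
      · subst hji; exact hx.2.trans hy.2.symm
      · exact hKT x hx.1 y hy.1 j (by simp [hji, hj])
    refine van_of_slices hK hc (fun t => ih hop hpq hp (hslice t) (hslice' t)
      (Set.inter_subset_left.trans hKO) (hconst t)) (fun t => ?_)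
    by_cases ho : o = 0
    · subst ho
      obtain rfl : p = 1 := by lia
      exact hS.extends_of_isPreconnected (hslice' t).isPreconnected
        (Set.inter_subset_left.trans hKO)
    · exact (ih (o := o - 1) (by lia) hop (by lia) (hslice t) (hslice' t)
        (Set.inter_subset_left.trans hKO) (hconst t)).extends

lemma finH_of_convex {o p q : ℤ} (hop : o + 1 = p) (hpq : p + 1 = q)
    {K : Set (ι → ℝ)} (hK : IsCompact K) (hK' : Convex ℝ K) (hKO : K ⊆ O) : S.FinH o p q K := by
  have := Fintype.ofFinite ι
  rcases lt_trichotomy p 0 with hp | rfl | hp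
  · have : S.Van o p q K := fun s _ => by
      rw [hS.eq_zero p hp s]
      exact zero_mem _
    exact this.finH
  · obtain rfl : q = 1 := by lia
    refine ⟨Submodule.span k {e}, Submodule.fg_span_singleton e, fun s hs => ?_⟩
    obtain ⟨c, hc⟩ := hS.exists_const_of_isPreconnected hK'.isPreconnected hKO hs
    exact Submodule.mem_sup.2 ⟨c • e, Submodule.smul_mem _ _ (Submodule.mem_span_singleton_self e),
      _, (le_sup_left : _ ≤ S.Bg o 0 K) hc, by simp⟩
  · exact (hS.van_of_convex_aux Finset.univ hop hpq (by lia) hK hK' hKO (by simp)).finH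

/-- Add one convex set at a time. Its intersection with the previous union is again a union of that
many convex sets, which is why the induction generalizes over the family and the degree. -/
lemma finH_biUnion_of_convex {κ : Type*} (F : Finset κ) (c : κ → Set (ι → ℝ))
    (hc : ∀ i, IsCompact (c i)) (hc' : ∀ i, Convex ℝ (c i)) (hcO : ∀ i, c i ⊆ O)
    {o p q : ℤ} (hop : o + 1 = p) (hpq : p + 1 = q) : S.FinH o p q (⋃ i ∈ F, c i) := by
  classical
  induction F using Finset.induction_on generalizing c o p q with
  | empty => simpa using (van_empty o p q).finH
  | insert i F hi ih =>
    rw [Finset.set_biUnion_insert]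
    refine FinH.union (l := o - 1) (hc i) (F.isCompact_biUnion fun j _ => hc j)
      (hS.finH_of_convex hop hpq (hc i) (hc' i) (hcO i)) (ih c hc hc' hcO hop hpq) ?_
    rw [Set.inter_iUnion₂]
    exact ih (fun j => c i ∩ c j) (fun j => (hc i).inter (hc j)) (fun j => (hc' i).inter (hc' j))
      (fun j => Set.inter_subset_left.trans (hcO i)) (by lia) hop

-- The images of `Hᵖ(K m)` in the finite-dimensional `Hᵖ(K j)` decrease with `m`, so an image of
-- minimal dimension is already the stable one.
omit hS [Finite ι] in
lemma exists_stable {o p q : ℤ} (K : ℕ → Set (ι → ℝ)) (hK : Monotone K) (j : ℕ)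
    (hfin : S.FinH o p q (K j)) :
    ∃ m, j < m ∧ ∀ m', m ≤ m' → S.Zg p q (K m) ≤ S.Zg p q (K m') ⊔ S.Bg o p (K j) := by
  obtain ⟨T, hT, hZ⟩ := hfin
  let π := (S.Bg o p (K j)).mkQ
  have hle : ∀ m, j ≤ m → (S.Zg p q (K m)).map π ≤ T.map π := fun m hm => by
    refine (Submodule.map_mono ((Zg_anti (hK hm)).trans hZ)).trans ?_
    rw [Submodule.map_sup, Submodule.mkQ_map_self, sup_bot_eq]
  let r : ℕ → ℕ := fun m => Module.finrank k ((S.Zg p q (K (j + 1 + m))).map π)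
  obtain ⟨m, hm⟩ : ∃ m, ∀ m', r m ≤ r m' :=
    ⟨_, fun m' => Function.argmin_le r m'⟩
  refine ⟨j + 1 + m, by lia, fun m' hm' => ?_⟩
  have hfd : FiniteDimensional k ((S.Zg p q (K (j + 1 + m))).map π) :=
    Module.Finite.iff_fg.2 ((hT.map π).of_le_of_field (hle _ (by lia)))
  have heq : (S.Zg p q (K m')).map π = (S.Zg p q (K (j + 1 + m))).map π := by
    refine Submodule.eq_of_le_of_finrank_le (Submodule.map_mono (Zg_anti (hK hm'))) ?_
    have := hm (m' - (j + 1))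
    simp only [r] at this
    rwa [show j + 1 + (m' - (j + 1)) = m' by lia] at this
  have h1 : S.Zg p q (K (j + 1 + m)) ≤ ((S.Zg p q (K m')).map π).comap π := by
    rw [heq]; exact Submodule.le_comap_map _ _
  rwa [Submodule.comap_map_mkQ, sup_comm] at h1

omit hS [Finite ι] in
lemma exists_strictMono_of_forall_exists_lt (P : ℕ → ℕ → Prop) (h : ∀ j, ∃ m, j < m ∧ P j m) :
    ∃ ψ : ℕ → ℕ, StrictMono ψ ∧ ∀ j, P (ψ j) (ψ (j + 1)) := by
  choose φ hφ hP using h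
  refine ⟨fun j => φ^[j] 0, strictMono_nat_of_lt_succ fun j => ?_, fun j => ?_⟩
  · rw [Function.iterate_succ_apply']; exact hφ _
  · beta_reduce; rw [Function.iterate_succ_apply']; exact hP _

omit hS [Finite ι] in
/-- A cocycle on a union of compact sets which is a coboundary near each of them is a coboundary
if the cohomology in the preceding degree has the Mittag-Leffler property. -/
lemma exists_of_mittagLeffler {o p q : ℤ} (K : ℕ → Set (ι → ℝ)) (hK : Monotone K)
    (hst : ∀ j, S.Zg o p (K (j + 1)) ≤ S.Zg o p (K (j + 2)) ⊔ S.Bg q o (K j))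
    {s : S.A p} (hs : ∀ j, s ∈ S.Bg o p (K j)) :
    ∃ y, ∀ j, s - S.d o p y ∈ S.N p ⟨interior (K j), isOpen_interior⟩ := by
  -- A primitive near `K (j + 1)` is replaced by one near `K (j + 2)` differing from it by something
  -- that vanishes near `K j`. One index is lost, as stability compares images in the cohomology of
  -- the smaller set.
  have hnext : ∀ (j : ℕ) (y : {y // s - S.d o p y ∈ S.Ng p (K (j + 1))}),
      ∃ y' : {y // s - S.d o p y ∈ S.Ng p (K (j + 2))}, y'.1 - y.1 ∈ S.Ng o (K j) := by
    rintro j ⟨y, hy⟩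
    obtain ⟨y', hy'⟩ := mem_Bg.1 (hs (j + 2))
    have hz : y' - y ∈ S.Zg o p (K (j + 1)) := by
      have : S.d o p (y' - y) = (s - S.d o p y) - (s - S.d o p y') := by rw [map_sub]; abel
      rw [mem_Zg, this]
      exact sub_mem hy (Ng_anti (hK (Nat.le_succ _)) hy')
    obtain ⟨w, hw, b, hb, hwb⟩ := Submodule.mem_sup.1 (hst j hz)
    obtain ⟨x, hx⟩ := mem_Bg.1 hb
    refine ⟨⟨y' - w - S.d q o x, ?_⟩, ?_⟩
    · have : s - S.d o p (y' - w - S.d q o x) = (s - S.d o p y') + S.d o p w := by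
        rw [map_sub, map_sub, S.d_d]; abel
      rw [this]
      exact add_mem hy' hw
    · have : y' - w - S.d q o x - y = b - S.d q o x := by
        rw [← sub_eq_iff_eq_add'.2 hwb.symm]; abel
      rw [this]
      exact hx
  choose next hnext using hnext
  obtain ⟨y₀, hy₀⟩ := mem_Bg.1 (hs 1)
  let seq : ∀ j : ℕ, {y // s - S.d o p y ∈ S.Ng p (K (j + 1))} :=
    fun j => Nat.rec ⟨y₀, hy₀⟩ (fun j y => next j y) j
  have hN : ∀ {i : ℤ} (j : ℕ) {x : S.A i}, x ∈ S.Ng i (K j) →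
      x ∈ S.N i ⟨interior (K j), isOpen_interior⟩ := by
    rintro i j x ⟨U, hU, hx⟩
    exact S.anti (interior_subset.trans hU) hx
  obtain ⟨t, ht⟩ := S.glue (fun j => ⟨interior (K j), isOpen_interior⟩)
    (fun i j hij => interior_mono (hK hij)) (fun j => (seq j).1)
    (fun j => hN j (hnext j (seq j)))
  refine ⟨t, fun j => ?_⟩
  have : s - S.d o p t = (s - S.d o p (seq j).1) - S.d o p (t - (seq j).1) := by
    rw [map_sub]; abel
  rw [this]
  exact sub_mem (hN j (Ng_anti (hK (Nat.le_succ j)) (seq j).2)) (S.d_mem p (ht j))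

omit hS in
lemma exists_convex_compact_cover (U : Opens (ι → ℝ)) :
    ∃ c : ℕ → Set (ι → ℝ), (∀ i, IsCompact (c i)) ∧ (∀ i, Convex ℝ (c i)) ∧ (∀ i, c i ⊆ U) ∧
      (U : Set (ι → ℝ)) ⊆ ⋃ i, interior (c i) := by
  have := Fintype.ofFinite ι
  have h : ∀ x : U, ∃ ε > 0, Metric.closedBall x.1 ε ⊆ (U : Set (ι → ℝ)) := fun x =>
    Metric.nhds_basis_closedBall.mem_iff.1 (U.isOpen.mem_nhds x.2)
  choose ε hε hεU using h
  obtain ⟨T, hT, hTU⟩ := TopologicalSpace.isOpen_iUnion_countable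
    (fun x : U => Metric.ball x.1 (ε x)) (fun x => Metric.isOpen_ball)
  rcases T.eq_empty_or_nonempty with rfl | hne
  · refine ⟨fun _ => ∅, by simp, fun _ => convex_empty, by simp, fun x hx => ?_⟩
    have : x ∈ ⋃ x : U, Metric.ball x.1 (ε x) :=
      Set.mem_iUnion.2 ⟨⟨x, hx⟩, Metric.mem_ball_self (hε _)⟩
    rw [← hTU] at this
    simp at this
  · obtain ⟨f, rfl⟩ := hT.exists_eq_range hne
    refine ⟨fun i => Metric.closedBall (f i).1 (ε (f i)), fun i => isCompact_closedBall _ _,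
      fun i => convex_closedBall _ _, fun i => hεU _, fun x hx => ?_⟩
    have : x ∈ ⋃ x : U, Metric.ball x.1 (ε x) :=
      Set.mem_iUnion.2 ⟨⟨x, hx⟩, Metric.mem_ball_self (hε _)⟩
    rw [← hTU] at this
    simp only [Set.mem_range, Set.iUnion_exists, Set.iUnion_iUnion_eq', Set.mem_iUnion] at this
    obtain ⟨i, hi⟩ := this
    exact Set.mem_iUnion.2 ⟨i, Metric.ball_subset_interior_closedBall hi⟩

/-- The constant sheaf on an open subset of `ℝⁿ`, with `n ≥ 1`, has no cohomology in degree `n`. -/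
theorem exists_d_eq {o p q : ℤ} (hop : o + 1 = p) (hpq : p + 1 = q) (hp : 1 ≤ p)
    (hι : Nat.card ι ≤ p) {U : Opens (ι → ℝ)} (hU : (U : Set (ι → ℝ)) ⊆ O) {s : S.A p}
    (hs : S.d p q s ∈ S.N q U) : ∃ y, s - S.d o p y ∈ S.N p U := by
  have := Fintype.ofFinite ι
  obtain ⟨c, hc, hc', hcU, hUc⟩ := exists_convex_compact_cover U
  let K : ℕ → Set (ι → ℝ) := fun j => ⋃ i ∈ Finset.range j, c i
  have hK : Monotone K := fun i j hij =>
    Set.biUnion_subset_biUnion_left (Finset.range_subset_range.2 hij)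
  have hKU : ∀ j, K j ⊆ U := fun j => Set.iUnion₂_subset fun i _ => hcU i
  have hKc : ∀ j, IsCompact (K j) := fun j => (Finset.range j).isCompact_biUnion fun i _ => hc i
  -- Finiteness is needed in degree `o = p - 1`, where choices of primitives differ; in degree `p`
  -- each `K j` has no cohomology at all.
  have hfin : ∀ j, S.FinH (o - 1) o p (K j) := fun j =>
    hS.finH_biUnion_of_convex _ c hc hc' (fun i => (hcU i).trans hU) (by lia) hop
  obtain ⟨ψ, hψ, hst⟩ := exists_strictMono_of_forall_exists_lt _
    (fun j => exists_stable K hK j (hfin j))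
  obtain ⟨y, hy⟩ := exists_of_mittagLeffler (K ∘ ψ) (hK.comp hψ.monotone)
    (fun j => hst j _ (hψ.monotone (Nat.le_succ _))) (s := s) (fun j =>
      hS.van_of_card_le Finset.univ hop hpq hp (by simpa using hι) (hKc _) ((hKU _).trans hU)
        (by simp) ⟨U, hKU _, hs⟩)
  refine ⟨y, ?_⟩
  have h1 := S.mem_sSup (Set.range fun j => (⟨interior ((K ∘ ψ) j), isOpen_interior⟩ : Opens _))
    (x := s - S.d o p y) (by rintro _ ⟨j, rfl⟩; exact hy j)
  refine S.anti (fun x hx => ?_) h1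
  obtain ⟨i, hi⟩ := Set.mem_iUnion.1 (hUc hx)
  -- `K j` is the union of the `c i` with `i < j`, so `c i` first appears in `K (i + 1)`, and `i + 1
  -- ≤ ψ (i + 1)`.
  refine Opens.mem_sSup.2 ⟨_, ⟨i + 1, rfl⟩, ?_⟩
  refine interior_mono ?_ hi
  exact Set.subset_biUnion_of_mem (u := c)
    (Finset.mem_range.2 (lt_of_lt_of_le (Nat.lt_succ_self i) (hψ.id_le _)))

end SupportedComplex.IsConstResolution

/-! ### Sections of sheaves; injective sheaves are flabby -/

noncomputable section

namespace ConeIteration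

open Opposite

section Sections

variable {k : Type u} [Field k] {X : TopCat.{u}}

/-- The sections of a sheaf over an open subset. -/
abbrev sec (F : Sh k X) (U : Opens X) : Type u := F.obj.obj (op U)

/-- The restriction of sections. -/
def res (F : Sh k X) {U V : Opens X} (h : V ≤ U) : sec F U →ₗ[k] sec F V :=
  (F.obj.map (homOfLE h).op).hom

/-- The action of a morphism on sections. -/
def sapp {F G : Sh k X} (f : F ⟶ G) (U : Opens X) : sec F U →ₗ[k] sec G U :=
  (f.hom.app (op U)).hom

lemma res_res (F : Sh k X) {U V W : Opens X} (h : V ≤ U) (h' : W ≤ V) (s : sec F U) :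
    res F h' (res F h s) = res F (h'.trans h) s := by
  have : F.obj.map (homOfLE h).op ≫ F.obj.map (homOfLE h').op =
      F.obj.map (homOfLE (h'.trans h)).op := by
    rw [← Functor.map_comp, ← op_comp, homOfLE_comp]
  exact congr($(this).hom s)

lemma res_self (F : Sh k X) {U : Opens X} (h : U ≤ U) (s : sec F U) : res F h s = s := by
  have : F.obj.map (homOfLE h).op = 𝟙 _ := F.obj.map_id _
  exact congr($(this).hom s)

lemma sapp_res {F G : Sh k X} (f : F ⟶ G) {U V : Opens X} (h : V ≤ U) (s : sec F U) :
    sapp f V (res F h s) = res G h (sapp f U s) :=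
  congr($(f.hom.naturality (homOfLE h).op).hom s)

lemma sapp_comp {F G H : Sh k X} (f : F ⟶ G) (g : G ⟶ H) (U : Opens X) (s : sec F U) :
    sapp (f ≫ g) U s = sapp g U (sapp f U s) := rfl

lemma sapp_id {F : Sh k X} (U : Opens X) (s : sec F U) : sapp (𝟙 F) U s = s := rfl

lemma sapp_zero {F G : Sh k X} (U : Opens X) (s : sec F U) :
    sapp (0 : F ⟶ G) U s = 0 := rfl

lemma sh_hom_ext {F G : Sh k X} {f g : F ⟶ G} (h : ∀ U s, sapp f U s = sapp g U s) : f = g := by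
  apply Sheaf.hom_ext
  ext U s
  exact h U.unop s

/-- A morphism of sheaves from a compatible family of linear maps. -/
def homOfLinear {F G : Sh k X} (φ : ∀ U, sec F U →ₗ[k] sec G U)
    (hφ : ∀ {U V : Opens X} (h : V ≤ U) (s : sec F U), φ V (res F h s) = res G h (φ U s)) :
    F ⟶ G :=
  ⟨{ app := fun U => ModuleCat.ofHom (φ U.unop)
     naturality := fun U V i => by
      ext s
      exact hφ (leOfHom i.unop) s }⟩

lemma sec_ext (F : Sh k X) {U : Opens X} {s t : sec F U}
    (h : ∀ x ∈ U, ∃ V : Opens X, ∃ hV : V ≤ U, x ∈ V ∧ res F hV s = res F hV t) : s = t := by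
  choose! V hV hx hst using h
  refine TopCat.Sheaf.eq_of_locally_eq' (C := ModuleCat.{u} k) (X := X) F
    (fun x : U => V x.1) U (fun x => homOfLE (hV x.1 x.2)) ?_ s t
    (fun x => hst x.1 x.2)
  intro x hxU
  exact Opens.mem_iSup.2 ⟨⟨x, hxU⟩, hx x hxU⟩

lemma exists_glue (F : Sh k X) {ι : Type*} (U : ι → Opens X) (V : Opens X) (hU : ∀ i, U i ≤ V)
    (hV : V ≤ iSup U) (s : ∀ i, sec F (U i))
    (hs : ∀ i j, res F (inf_le_left : U i ⊓ U j ≤ _) (s i) = res F inf_le_right (s j)) :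
    ∃ t : sec F V, ∀ i, res F (hU i) t = s i := by
  obtain ⟨t, ht, -⟩ := TopCat.Sheaf.existsUnique_gluing' (C := ModuleCat.{u} k) (X := X) F U V
    (fun i => homOfLE (hU i)) hV s hs
  exact ⟨t, ht⟩

lemma exists_glue₂ (F : Sh k X) {U V : Opens X} (s : sec F U) (t : sec F V)
    (hst : res F (inf_le_left : U ⊓ V ≤ _) s = res F inf_le_right t) :
    ∃ r : sec F (U ⊔ V), res F le_sup_left r = s ∧ res F le_sup_right r = t := by
  obtain ⟨r, hr⟩ := exists_glue F (fun b : Bool => if b then U else V) (U ⊔ V)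
    (by rintro (_ | _) <;> simp) (by rw [iSup_bool_eq]; simp)
    (fun b => match b with
      | true => s
      | false => t) (by
      rintro (_ | _) (_ | _)
      · rfl
      · have := congr(res F (le_of_eq (inf_comm V U)) $hst)
        rw [res_res, res_res] at this
        exact this.symm
      · exact hst
      · rfl)
  exact ⟨r, hr true, hr false⟩

/-- Every section over an open subset extends to a global section. -/
def Flabby (F : Sh k X) : Prop := ∀ (U : Opens X) (s : sec F U), ∃ t : sec F ⊤, res F le_top t = s

end Sections

section Injective

variable {k : Type u} [Field k] {X : TopCat.{u}}

/-- The free presheaf of `k`-modules on an open subset. -/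
abbrev freePresheaf (k : Type u) [Field k] {X : TopCat.{u}} (U : Opens X) :
    (Opens X)ᵒᵖ ⥤ ModuleCat.{u} k :=
  yoneda.obj U ⋙ ModuleCat.free k

lemma mono_freePresheaf_map {U V : Opens X} (i : U ⟶ V) :
    Mono (Functor.whiskerRight (yoneda.map i) (ModuleCat.free k)) := by
  have : ∀ W, Mono ((Functor.whiskerRight (yoneda.map i) (ModuleCat.free k)).app W) := fun W => by
    rw [ModuleCat.mono_iff_injective]
    have : Subsingleton ((yoneda.obj U).obj W) := inferInstanceAs (Subsingleton (W.unop ⟶ U))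
    exact Finsupp.mapDomain_injective fun f g _ => Subsingleton.elim f g
  exact NatTrans.mono_of_mono_app _

/-- The morphism from the free presheaf on `U` given by a section over `U`. -/
def freePresheafDesc (F : Sh k X) {U : Opens X} (s : sec F U) : freePresheaf k U ⟶ F.obj where
  app W := ModuleCat.freeDesc (↾fun f => F.obj.map f.op s)
  naturality W W' i := by
    apply ModuleCat.free_hom_ext
    intro f
    dsimp
    rw [ModuleCat.free_map_apply]
    erw [ModuleCat.freeDesc_apply, ModuleCat.freeDesc_apply]
    simp

/-- A section over `U` is a morphism to `F` from the sheafified free presheaf on `U`. This sheaf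
embeds in the one attached to `⊤`, sheafification being exact, so injectivity extends the morphism.
-/
lemma Flabby.of_injective (F : Sh k X) [Injective F] : Flabby F := by
  intro U s
  let adj := sheafificationAdjunction (Opens.grothendieckTopology X) (ModuleCat.{u} k)
  let i : U ⟶ ⊤ := homOfLE le_top
  let ι := Functor.whiskerRight (yoneda.map i) (ModuleCat.free k)
  have : Mono ι := mono_freePresheaf_map i
  let β := (adj.homEquiv _ F).symm (freePresheafDesc F s)
  let γ := Injective.factorThru β ((sheafification k X).map ι)
  have hγ : (sheafification k X).map ι ≫ γ = β := Injective.comp_factorThru _ _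
  have hγ' : ι ≫ adj.homEquiv _ F γ = freePresheafDesc F s := by
    rw [← adj.homEquiv_naturality_left, hγ, Equiv.apply_symm_apply]
  refine ⟨(adj.homEquiv _ F γ).app (op ⊤) (ModuleCat.freeMk (𝟙 (⊤ : Opens X))), ?_⟩
  have h1 := congr($(hγ').app (op U) (ModuleCat.freeMk (𝟙 U)))
  have h2 := congr($((adj.homEquiv _ F γ).naturality i.op) (ModuleCat.freeMk (𝟙 (⊤ : Opens X))))
  have h3 : (freePresheafDesc F s).app (op U) (ModuleCat.freeMk (𝟙 U)) = s := by
    dsimp [freePresheafDesc]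
    erw [ModuleCat.freeDesc_apply]
    simp
  have h4 : ι.app (op U) (ModuleCat.freeMk (𝟙 U)) = (freePresheaf k (⊤ : Opens X)).map i.op
      (ModuleCat.freeMk (𝟙 (⊤ : Opens X))) := by
    dsimp [ι]
    erw [ModuleCat.free_map_apply, ModuleCat.free_map_apply]
    simp
  refine Eq.trans ?_ (h1.trans h3)
  refine Eq.trans h2.symm ?_
  exact congr((adj.homEquiv _ F γ).app (op U) $(h4.symm))

end Injective

end ConeIteration

end

/-! ### Flabby sheaves of vector spaces are injective; flabbiness is local -/

noncomputable section

namespace ConeIteration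

open Opposite

section

variable {k : Type u} [Field k] {X : TopCat.{u}}

/-- A family of graphs of partially defined morphisms from `B` to `F`. -/
structure IsPartialGraph {B F : Sh k X} (G : ∀ U : Opens X, Submodule k (sec B U × sec F U)) :
    Prop where
  res_mem : ∀ {U V : Opens X} (h : V ≤ U) {b j}, (b, j) ∈ G U → (res B h b, res F h j) ∈ G V
  eq_zero : ∀ {U : Opens X} {j}, ((0 : sec B U), j) ∈ G U → j = 0

namespace IsPartialGraph

variable {B F : Sh k X} {G : ∀ U : Opens X, Submodule k (sec B U × sec F U)}

lemma eq (hG : IsPartialGraph G) {U : Opens X} {b j j'} (h : (b, j) ∈ G U) (h' : (b, j') ∈ G U) :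
    j = j' :=
  sub_eq_zero.1 (hG.eq_zero (by simpa using sub_mem h h'))

lemma sSup_of_isChain (c : Set (∀ U : Opens X, Submodule k (sec B U × sec F U)))
    (hc : ∀ G ∈ c, IsPartialGraph G) (hchain : IsChain (· ≤ ·) c) (hne : c.Nonempty) :
    IsPartialGraph (sSup c) := by
  have hmem : ∀ (U : Opens X) p, p ∈ (sSup c) U ↔ ∃ G ∈ c, p ∈ G U := by
    intro U p
    have hne' : Nonempty c := hne.to_subtype
    rw [sSup_apply, Submodule.mem_iSup_of_directed]
    · simp
    · rintro ⟨G, hG⟩ ⟨G', hG'⟩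
      rcases hchain.total hG hG' with h | h
      · exact ⟨⟨G', hG'⟩, h U, le_rfl⟩
      · exact ⟨⟨G, hG⟩, le_rfl, h U⟩
  constructor
  · intro U V h b j hbj
    obtain ⟨G, hG, hbj⟩ := (hmem _ _).1 hbj
    exact (hmem _ _).2 ⟨G, hG, (hc G hG).res_mem h hbj⟩
  · intro U j hj
    obtain ⟨G, hG, hj⟩ := (hmem _ _).1 hj
    exact (hc G hG).eq_zero hj

open Classical in
/-- Adjoin a section to a partial graph. -/
def adjoin (G : ∀ U : Opens X, Submodule k (sec B U × sec F U)) {U : Opens X} (b : sec B U)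
    (j : sec F U) (V : Opens X) : Submodule k (sec B V × sec F V) :=
  if h : V ≤ U then G V ⊔ Submodule.span k {(res B h b, res F h j)} else G V

lemma mem_adjoin_of_le {U V : Opens X} (h : V ≤ U) (b : sec B U) (j : sec F U) {p} :
    p ∈ adjoin G b j V ↔ ∃ g ∈ G V, ∃ c : k, g + c • (res B h b, res F h j) = p := by
  rw [adjoin, dif_pos h, Submodule.mem_sup]
  simp [Submodule.mem_span_singleton]

lemma le_adjoin {U : Opens X} (b : sec B U) (j : sec F U) : G ≤ adjoin G b j := by
  intro V
  unfold adjoin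
  split_ifs
  · exact le_sup_left
  · exact le_rfl

/-- Here the field matters: a relation `g + c • b = 0` with `c ≠ 0` puts `b` itself in the old
domain, where `hbj` fixes its value. No condition from annihilators remains. -/
lemma isPartialGraph_adjoin (hG : IsPartialGraph G) {U : Opens X} (b : sec B U) (j : sec F U)
    (hbj : ∀ (V : Opens X) (h : V ≤ U) j', (res B h b, j') ∈ G V → j' = res F h j) :
    IsPartialGraph (adjoin G b j) where
  res_mem := by
    intro V W h b' j' hb
    by_cases hV : V ≤ U
    · obtain ⟨⟨g₁, g₂⟩, hg, c, hc⟩ := (mem_adjoin_of_le hV b j).1 hb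
      refine (mem_adjoin_of_le (h.trans hV) b j).2 ⟨_, hG.res_mem h hg, c, ?_⟩
      simp only [Prod.smul_mk, Prod.mk_add_mk, Prod.mk.injEq] at hc
      rw [← hc.1, ← hc.2]
      simp [res_res]
    · rw [adjoin, dif_neg hV] at hb
      exact le_adjoin b j W (hG.res_mem h hb)
  eq_zero := by
    intro V f hf
    by_cases hV : V ≤ U
    · obtain ⟨⟨g₁, g₂⟩, hg, c, hc⟩ := (mem_adjoin_of_le hV b j).1 hf
      simp only [Prod.smul_mk, Prod.mk_add_mk, Prod.mk.injEq] at hc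
      obtain ⟨h1, rfl⟩ := hc
      by_cases hc0 : c = 0
      · subst hc0
        simp only [zero_smul, add_zero] at h1 ⊢
        subst h1
        exact hG.eq_zero hg
      · have h2 := (G V).smul_mem (-c⁻¹) hg
        rw [eq_neg_of_add_eq_zero_left h1] at h2
        simp only [Prod.smul_mk, smul_neg, neg_smul, neg_neg, smul_smul, inv_mul_cancel₀ hc0,
          one_smul, Prod.neg_mk] at h2
        have h3 := hbj V hV _ h2
        rw [← h3]
        simp [smul_smul, mul_inv_cancel₀ hc0]
    · rw [adjoin, dif_neg hV] at hf
      exact hG.eq_zero hf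

/-- A maximal partial graph with values in a flabby sheaf is everywhere defined. -/
lemma exists_mem_of_maximal (hF : Flabby F) (hG : IsPartialGraph G)
    (hmax : ∀ G', IsPartialGraph G' → G ≤ G' → G' ≤ G) {U : Opens X} (b : sec B U) :
    ∃ j, (b, j) ∈ G U := by
  -- The values already forced on restrictions of `b` agree on overlaps, so they glue over the union
  -- `W`. Flabbiness extends the result to a candidate value over `U`, and maximality shows that it
  -- was already in `G`.
  let I := {V : Opens X // ∃ h : V ≤ U, ∃ j, (res B h b, j) ∈ G V}
  choose hIU jI hjI using fun V : I => V.2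
  let W : Opens X := ⨆ V : I, V.1
  have hWU : W ≤ U := iSup_le hIU
  obtain ⟨jW, hjW⟩ := exists_glue F (fun V : I => V.1) W (fun V => le_iSup _ V) le_rfl jI
    (fun V V' => by
      have h1 := hG.res_mem (inf_le_left : V.1 ⊓ V'.1 ≤ _) (hjI V)
      have h2 := hG.res_mem (inf_le_right : V.1 ⊓ V'.1 ≤ _) (hjI V')
      rw [res_res] at h1 h2
      exact hG.eq h1 h2)
  obtain ⟨t, ht⟩ := hF W jW
  let j := res F (le_top : U ≤ ⊤) t
  have hadj : IsPartialGraph (adjoin G b j) := isPartialGraph_adjoin hG b j fun V h j' hj' => by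
    let V' : I := ⟨V, h, j', hj'⟩
    have h1 : j' = jI V' := hG.eq hj' (hjI V')
    rw [h1, ← hjW V', ← ht, res_res, res_res]
  refine ⟨j, hmax _ hadj (le_adjoin b j) U ((mem_adjoin_of_le le_rfl b j).2 ⟨0, zero_mem _, 1, ?_⟩)⟩
  simp [res_self]

/-- The morphism with a given everywhere defined graph. -/
lemma exists_hom (hG : IsPartialGraph G) (h : ∀ U b, ∃ j, (b, j) ∈ G U) :
    ∃ f : B ⟶ F, ∀ U b, (b, sapp f U b) ∈ G U := by
  choose φ hφ using h
  let f : B ⟶ F := homOfLinear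
    (fun U => { toFun := φ U
                map_add' := fun b b' => hG.eq (hφ U _) (add_mem (hφ U b) (hφ U b'))
                map_smul' := fun c b => hG.eq (hφ U _) ((G U).smul_mem c (hφ U b)) })
    (fun {U V} h s => hG.eq (hφ V _) (hG.res_mem h (hφ U s)))
  exact ⟨f, fun U b => hφ U b⟩

end IsPartialGraph

lemma sapp_injective {A B : Sh k X} (i : A ⟶ B) [Mono i] (U : Opens X) :
    Function.Injective (sapp i U) := by
  have : Mono (((sheafToPresheaf _ _).map i).app (op U)) := inferInstance
  exact (ModuleCat.mono_iff_injective _).1 this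

/-- Flabby sheaves of vector spaces over a field are injective. -/
theorem Flabby.injective {F : Sh k X} (hF : Flabby F) : Injective F where
  factors {A B} φ i _ := by
    let G₀ : ∀ U : Opens X, Submodule k (sec B U × sec F U) := fun U =>
      LinearMap.range ((sapp i U).prod (sapp φ U))
    have hG₀ : IsPartialGraph G₀ := by
      constructor
      · rintro U V h _ _ ⟨a, ha⟩
        simp only [LinearMap.prod_apply, Function.prod_apply, Prod.mk.injEq] at ha
        exact ⟨res A h a, by simp [sapp_res, ha.1, ha.2]⟩
      · rintro U j ⟨a, ha⟩
        simp only [LinearMap.prod_apply, Function.prod_apply, Prod.mk.injEq] at ha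
        rw [← ha.2, sapp_injective i U (a₁ := a) (a₂ := 0) (by rw [ha.1, map_zero]), map_zero]
    obtain ⟨G, hG₀G, hG⟩ := zorn_le_nonempty₀ {G | IsPartialGraph (B := B) (F := F) G}
      (fun c hc hchain G hGc => ⟨sSup c, IsPartialGraph.sSup_of_isChain c (fun G h => hc h) hchain
        ⟨G, hGc⟩, fun G' h => le_sSup h⟩) G₀ hG₀
    obtain ⟨f, hf⟩ := hG.1.exists_hom
      (fun U b => hG.1.exists_mem_of_maximal hF (fun G' hG' hle => hG.2 hG' hle) b)
    refine ⟨f, sh_hom_ext fun U a => ?_⟩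
    exact hG.1.eq (hf U _) (hG₀G U ⟨a, rfl⟩)

/-- A sheaf is flabby if every point has a neighbourhood to which all sections extend. -/
theorem Flabby.of_local {F : Sh k X} (h : ∀ x : X, ∃ S : Opens X, x ∈ S ∧
    ∀ (W : Opens X) (hW : W ≤ S) (s : sec F W), ∃ t : sec F S, res F hW t = s) : Flabby F := by
  intro U s
  let r : (Σ V : Opens X, sec F V) → (Σ V : Opens X, sec F V) → Prop :=
    fun p q => ∃ h : p.1 ≤ q.1, res F h q.2 = p.2
  obtain ⟨⟨V, t⟩, hm, hmax⟩ : ∃ m : Σ V : Opens X, sec F V, r ⟨U, s⟩ m ∧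
      ∀ a, r m a → r a m := by
    obtain ⟨m, hm⟩ : ∃ m : {p // r ⟨U, s⟩ p}, ∀ a : {p // r ⟨U, s⟩ p}, r m.1 a.1 → r a.1 m.1 := by
      refine exists_maximal_of_chains_bounded
        (r := fun p q : {p // r ⟨U, s⟩ p} => r p.1 q.1) (fun c hc => ?_)
        (fun {p q q'} ⟨h, hr⟩ ⟨h', hr'⟩ => ⟨h.trans h', by rw [← hr, ← hr', res_res]⟩)
      by_cases hne : c.Nonempty
      · obtain ⟨p₀, hp₀⟩ := hne
        obtain ⟨t, ht⟩ := exists_glue F (fun p : c => p.1.1.1) (⨆ p : c, p.1.1.1)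
          (fun p => le_iSup (fun p : c => p.1.1.1) p) le_rfl (fun p => p.1.1.2) (fun p q => by
            by_cases hpq : p = q
            · subst hpq; rfl
            · rcases hc p.2 q.2 (fun h => hpq (Subtype.ext h)) with ⟨h, hr⟩ | ⟨h, hr⟩
              · rw [← hr, res_res]
              · rw [← hr, res_res])
        obtain ⟨h, hr⟩ := p₀.2
        refine ⟨⟨⟨_, t⟩, h.trans (le_iSup (fun p : c => p.1.1.1) ⟨p₀, hp₀⟩), ?_⟩,
          fun p hp => ⟨_, ht ⟨p, hp⟩⟩⟩
        rw [← hr, ← ht ⟨p₀, hp₀⟩, res_res]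
      · exact ⟨⟨⟨U, s⟩, le_rfl, res_self _ _ _⟩, fun p hp => (hne ⟨p, hp⟩).elim⟩
    exact ⟨m.1, m.2, fun a ha => hm ⟨a, by
        obtain ⟨⟨h, hr⟩, h', hr'⟩ := And.intro m.2 ha
        exact ⟨h.trans h', by rw [← hr, ← hr', res_res]⟩⟩ ha⟩
  obtain ⟨hUV, hts⟩ := hm
  have hV : V = ⊤ := by
    rw [eq_top_iff]
    intro x _
    obtain ⟨S, hxS, hS⟩ := h x
    -- Extend the part of `t` over `V ⊓ S` to `S` and glue with `t`; maximality then forces `S ≤ V`.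
    obtain ⟨t', ht'⟩ := hS (V ⊓ S) inf_le_right (res F inf_le_left t)
    obtain ⟨r', hr₁, hr₂⟩ := exists_glue₂ F t t' ht'.symm
    obtain ⟨hle, -⟩ := hmax ⟨V ⊔ S, r'⟩ ⟨le_sup_left, hr₁⟩
    exact hle (Or.inr hxS)
  subst hV
  exact ⟨t, hts⟩

end

section Exactness

variable {k : Type u} [Field k] {X : TopCat.{u}}

lemma exists_sapp_eq_of_epi {F G : Sh k X} (f : F ⟶ G) [Epi f] {U : Opens X} (s : sec G U)
    {x : X} (hx : x ∈ U) :
    ∃ V : Opens X, ∃ h : V ≤ U, x ∈ V ∧ ∃ t, sapp f V t = res G h s := by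
  have h : Sheaf.IsLocallySurjective f :=
    (Sheaf.isLocallySurjective_iff_epi' (ModuleCat.{u} k) f).2 inferInstance
  obtain ⟨V, i, hi, hxV⟩ := Presheaf.imageSieve_mem (Opens.grothendieckTopology X) f.hom s x hx
  obtain ⟨t, ht⟩ := hi
  exact ⟨V, leOfHom i, hxV, t, ht⟩

lemma exists_sapp_eq_of_exact_of_mono {S : ShortComplex (Sh k X)} (hS : S.Exact) [Mono S.f]
    {U : Opens X} (s : sec S.X₂ U) (hs : sapp S.g U s = 0) : ∃ t, sapp S.f U t = s := by
  let Γ := sheafToPresheaf (Opens.grothendieckTopology X) (ModuleCat.{u} k) ⋙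
    (evaluation _ _).obj (op U)
  have := hS.map_of_mono_of_preservesKernel Γ inferInstance inferInstance
  exact (ShortComplex.moduleCat_exact_iff _).1 this s hs

lemma exists_sapp_eq_of_exact {S : ShortComplex (Sh k X)} (hS : S.Exact)
    {U : Opens X} (s : sec S.X₂ U) (hs : sapp S.g U s = 0) {x : X} (hx : x ∈ U) :
    ∃ V : Opens X, ∃ h : V ≤ U, x ∈ V ∧ ∃ t, sapp S.f V t = res S.X₂ h s := by
  obtain ⟨z, hz⟩ := exists_sapp_eq_of_exact_of_mono
    (S := ShortComplex.mk S.iCycles S.g S.iCycles_g)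
    (ShortComplex.exact_of_f_is_kernel _ S.cyclesIsKernel) s hs
  have : Epi S.toCycles := S.exact_iff_epi_toCycles.1 hS
  obtain ⟨V, h, hxV, t, ht⟩ := exists_sapp_eq_of_epi S.toCycles z hx
  refine ⟨V, h, hxV, t, ?_⟩
  have h1 : sapp S.f V t = sapp S.iCycles V (sapp S.toCycles V t) := by
    rw [← sapp_comp, S.toCycles_i]
  rw [h1, ht, sapp_res]
  exact congr(res S.X₂ h $hz)

end Exactness

end ConeIteration

end

/-! ### Constant sheaves and flabby resolutions read in a chart -/

noncomputable section

namespace ConeIteration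

open Opposite

section Constant

variable {k : Type u} [Field k] {X : TopCat.{u}}

/-- The constant sheaf with given stalk. -/
abbrev constSheafOf (X : TopCat.{u}) (V : ModuleCat.{u} k) : Sh k X :=
  (constantSheaf (Opens.grothendieckTopology X) (ModuleCat.{u} k)).obj V

/-- The constant sections of a constant sheaf. -/
def cst (X : TopCat.{u}) (V : ModuleCat.{u} k) (U : Opens X) :
    V →ₗ[k] sec (constSheafOf X V) U :=
  ((toSheafify (Opens.grothendieckTopology X) ((Functor.const _).obj V)).app (op U)).hom

lemma res_cst (V : ModuleCat.{u} k) {U W : Opens X} (h : W ≤ U) (v : V) :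
    res (constSheafOf X V) h (cst X V U v) = cst X V W v :=
  congr($((toSheafify (Opens.grothendieckTopology X)
    ((Functor.const _).obj V)).naturality (homOfLE h).op).hom v).symm

lemma exists_cst_eq (V : ModuleCat.{u} k) {U : Opens X}
    (s : sec (constSheafOf X V) U)
    {x : X} (hx : x ∈ U) :
    ∃ W : Opens X, ∃ h : W ≤ U, x ∈ W ∧ ∃ v, cst X V W v = res (constSheafOf X V) h s := by
  obtain ⟨W, i, ⟨v, hv⟩, hxW⟩ := Presheaf.imageSieve_mem (Opens.grothendieckTopology X)
    (toSheafify (Opens.grothendieckTopology X) ((Functor.const _).obj V)) s x hx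
  exact ⟨W, leOfHom i, hxW, v, hv⟩

lemma cst_injective (V : ModuleCat.{u} k) {U : Opens X} {x : X} (hx : x ∈ U) :
    Function.Injective (cst X V U) := by
  intro v v' h
  obtain ⟨W, i, hW, hxW⟩ := Presheaf.equalizerSieve_mem (Opens.grothendieckTopology X)
    (toSheafify (Opens.grothendieckTopology X) ((Functor.const _).obj V)) (X := op U) v v' h x hx
  exact hW

end Constant

section Chart

variable {k : Type u} [Field k] {X : TopCat.{u}} {Y : Type} [TopologicalSpace Y]

/-- The preimage of an open subset by a partial homeomorphism. -/
def chartPreimage (φ : OpenPartialHomeomorph X Y) (V : Opens Y) : Opens X :=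
  ⟨φ.source ∩ φ ⁻¹' V, φ.isOpen_inter_preimage V.isOpen⟩

lemma chartPreimage_mono (φ : OpenPartialHomeomorph X Y) {V W : Opens Y} (h : V ≤ W) :
    chartPreimage φ V ≤ chartPreimage φ W := fun _ hx => ⟨hx.1, h hx.2⟩

/-- The global sections of a complex of flabby sheaves, with the subcomplexes of sections vanishing
on the open subsets of a chart. -/
def supportedComplex (I : CochainComplex (Sh k X) ℤ) (hI : ∀ p, Flabby (I.X p))
    (φ : OpenPartialHomeomorph X Y) : SupportedComplex.{u} k Y where
  A p := sec (I.X p) ⊤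
  d p q := sapp (I.d p q) ⊤
  d_d p q r x := by rw [← sapp_comp, I.d_comp_d, sapp_zero]
  N p V := LinearMap.ker (res (I.X p) (le_top : chartPreimage φ V ≤ ⊤))
  d_mem {p U x} q hx := by
    rw [LinearMap.mem_ker] at hx ⊢
    rw [← sapp_res, hx, map_zero]
  anti {p U V} h x hx := by
    rw [LinearMap.mem_ker] at hx ⊢
    rw [← res_res _ le_top (chartPreimage_mono φ h), hx, map_zero]
  mem_sSup {p} 𝒰 x hx := by
    rw [LinearMap.mem_ker]
    refine sec_ext _ fun y hy => ?_
    obtain ⟨U, hU, hyU⟩ := Opens.mem_sSup.1 hy.2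
    have := hx U hU
    rw [LinearMap.mem_ker] at this
    exact ⟨chartPreimage φ U, chartPreimage_mono φ (le_sSup hU), ⟨hy.1, hyU⟩, by
      rw [res_res, this, map_zero]⟩
  -- The section equal to `0` over `U` and to `s` over `V` is well defined because `s` vanishes on
  -- the overlap. A global extension `t` gives the splitting `s = t + (s - t)`.
  inf_le {p U V} s hs := by
    rw [LinearMap.mem_ker] at hs
    obtain ⟨r, hr₁, hr₂⟩ := exists_glue₂ (I.X p) (0 : sec (I.X p) (chartPreimage φ U))
      (res (I.X p) (le_top : chartPreimage φ V ≤ ⊤) s) (by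
        rw [map_zero, res_res]
        have hle : chartPreimage φ U ⊓ chartPreimage φ V ≤ chartPreimage φ (U ⊓ V) :=
          fun x hx => ⟨hx.1.1, hx.1.2, hx.2.2⟩
        rw [← res_res _ le_top hle, hs, map_zero])
    obtain ⟨t, rfl⟩ := hI p _ r
    rw [res_res] at hr₁ hr₂
    refine Submodule.mem_sup.2 ⟨t, hr₁, s - t, ?_, by abel⟩
    rw [LinearMap.mem_ker, map_sub, hr₂, sub_self]
  glue {p} U hU s hs := by
    have hs' : ∀ i j, i ≤ j → res (I.X p) (le_top : chartPreimage φ (U i) ≤ ⊤) (s j) =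
        res (I.X p) le_top (s i) := by
      intro i j hij
      induction j, hij using Nat.le_induction with
      | base => rfl
      | succ j hij ih =>
        have := hs j
        rw [LinearMap.mem_ker, map_sub, sub_eq_zero] at this
        rw [← ih, ← res_res _ le_top (chartPreimage_mono φ (hU hij)), this, res_res]
    obtain ⟨r, hr⟩ := exists_glue (I.X p) (fun j => chartPreimage φ (U j)) _
      (fun j => le_iSup (fun j => chartPreimage φ (U j)) j) le_rfl
      (fun j => res (I.X p) le_top (s j)) (by
        intro i j
        rw [res_res, res_res]
        rcases le_total i j with h | h
        · rw [← res_res _ le_top inf_le_left, ← hs' i j h, res_res]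
        · rw [← res_res _ le_top (inf_le_right : chartPreimage φ (U i) ⊓ chartPreimage φ (U j) ≤ _)
            (s j), ← hs' j i h, res_res])
    obtain ⟨t, rfl⟩ := hI p _ r
    refine ⟨t, fun j => ?_⟩
    rw [LinearMap.mem_ker, map_sub, sub_eq_zero, ← hr j, res_res]

/-- At a point, vanishing in the chart is vanishing of the germ on `X`; this is how exactness of the
sheaf complex becomes the pointwise conditions of `IsConstResolution`. -/
lemma mem_supportedComplex_Ng {I : CochainComplex (Sh k X) ℤ} {hI : ∀ p, Flabby (I.X p)}
    {φ : OpenPartialHomeomorph X Y} {p : ℤ} {x : X} (hx : x ∈ φ.source) {s : sec (I.X p) ⊤} :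
    s ∈ (supportedComplex I hI φ).Ng p {φ x} ↔
      ∃ U : Opens X, x ∈ U ∧ res (I.X p) (le_top : U ≤ ⊤) s = 0 := by
  constructor
  · rintro ⟨V, hV, hs⟩
    exact ⟨chartPreimage φ V, ⟨hx, hV rfl⟩, hs⟩
  · rintro ⟨U, hxU, hs⟩
    refine ⟨⟨_, φ.symm.isOpen_inter_preimage U.isOpen⟩, ?_, ?_⟩
    · rw [Set.singleton_subset_iff]
      exact ⟨φ.map_source hx, by simpa [φ.left_inv hx] using hxU⟩
    · have hle : chartPreimage φ ⟨_, φ.symm.isOpen_inter_preimage U.isOpen⟩ ≤ U := by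
        rintro y ⟨hy, -, hyU⟩
        simpa [φ.left_inv hy] using hyU
      change res _ _ s = 0
      rw [← res_res _ le_top hle, hs, map_zero]

/-- A flabby resolution of the constant sheaf gives a resolution in each chart. -/
lemma isConstResolution_supportedComplex (I : CochainComplex (Sh k X) ℤ)
    (hI : ∀ p, Flabby (I.X p)) (φ : OpenPartialHomeomorph X Y) [I.IsStrictlyGE 0]
    (hex : ∀ p, p ≠ 0 → I.ExactAt p) (f : constSheafOf X (ModuleCat.of k k) ⟶ I.X 0) [Mono f]
    (w : f ≫ I.d 0 1 = 0) (hf : (ShortComplex.mk f (I.d 0 1) w).Exact) :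
    (supportedComplex I hI φ).IsConstResolution φ.target
      (sapp f ⊤ (cst X (ModuleCat.of k k) ⊤ (1 : k))) where
  d_e q := by
    by_cases hq : q = 1
    · subst hq
      exact (sapp_comp f (I.d 0 1) ⊤ _).symm.trans (by rw [w, sapp_zero]; rfl)
    · have : I.d 0 q = 0 := I.shape _ _ (by simpa using fun h => hq (by lia))
      change sapp (I.d 0 q) _ _ = 0
      rw [this, sapp_zero]
  exact {o p q} hop hpq hp y hy := by
    obtain ⟨x, hx, rfl⟩ : ∃ x ∈ φ.source, φ x = y := ⟨φ.symm y, φ.map_target hy, φ.right_inv hy⟩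
    intro s hs
    replace hs := (mem_supportedComplex_Ng hx).1 (SupportedComplex.mem_Zg.1 hs)
    obtain ⟨U, hxU, hs⟩ := hs
    have he : (ShortComplex.mk _ _ (I.d_comp_d o p q)).Exact :=
      (I.exactAt_iff' o p q (by simp; lia) (by simp; lia)).1 (hex p hp)
    obtain ⟨V, hVU, hxV, t, ht⟩ := exists_sapp_eq_of_exact he (res (I.X p) (le_top : U ≤ ⊤) s)
      (by exact (sapp_res _ _ _).trans hs) hxU
    obtain ⟨y, rfl⟩ := hI o V t
    rw [SupportedComplex.mem_Bg]
    refine ⟨y, (mem_supportedComplex_Ng hx).2 ⟨V, hxV, ?_⟩⟩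
    have h2 : res (I.X p) (le_top : V ≤ ⊤) s = res (I.X p) le_top (sapp (I.d o p) ⊤ y) :=
      (res_res (I.X p) le_top hVU s).symm.trans (ht.symm.trans (sapp_res _ _ _))
    exact (map_sub (res (I.X p) (le_top : V ≤ ⊤)) s _).trans (sub_eq_zero.2 h2)
  eq_zero p hp s := by
    have : IsZero (I.X p) := I.isZero_of_isStrictlyGE 0 p hp
    have h1 : 𝟙 (I.X p) = 0 := this.eq_of_src _ _
    exact congr(sapp $h1 ⊤ s)
  exact₀ y hy s hs := by
    obtain ⟨x, hx, rfl⟩ : ∃ x ∈ φ.source, φ x = y := ⟨φ.symm y, φ.map_target hy, φ.right_inv hy⟩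
    replace hs := (mem_supportedComplex_Ng hx).1 (SupportedComplex.mem_Zg.1 hs)
    obtain ⟨U, hxU, hs⟩ := hs
    obtain ⟨t, ht⟩ := exists_sapp_eq_of_exact_of_mono hf (res (I.X 0) (le_top : U ≤ ⊤) s)
      (by exact (sapp_res _ _ _).trans hs)
    obtain ⟨V, hVU, hxV, c, hc⟩ := exists_cst_eq (ModuleCat.of k k) t hxU
    refine ⟨c, (mem_supportedComplex_Ng hx).2 ⟨V, hxV, ?_⟩⟩
    have h1 : c • cst X (ModuleCat.of k k) V (1 : k) = cst X (ModuleCat.of k k) V c := by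
      rw [← map_smul]
      exact congr(cst X (ModuleCat.of k k) V $(mul_one c))
    have h2 : res (I.X 0) (le_top : V ≤ ⊤) s = c • res (I.X 0) (le_top : V ≤ ⊤)
        (sapp f ⊤ (cst X (ModuleCat.of k k) ⊤ (1 : k))) := by
      rw [← sapp_res, res_cst, ← map_smul, h1, hc, sapp_res]
      exact (res_res (I.X 0) le_top hVU s).symm.trans congr(res (I.X 0) hVU $(ht.symm))
    exact (map_sub (res (I.X 0) (le_top : V ≤ ⊤)) s _).trans
      (sub_eq_zero.2 (h2.trans (map_smul _ _ _).symm))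
  ne y hy h := by
    obtain ⟨x, hx, rfl⟩ : ∃ x ∈ φ.source, φ x = y := ⟨φ.symm y, φ.map_target hy, φ.right_inv hy⟩
    replace h := (mem_supportedComplex_Ng hx).1 h
    obtain ⟨U, hxU, hs⟩ := h
    rw [← sapp_res] at hs
    have h1 := sapp_injective f U (hs.trans (map_zero _).symm)
    rw [res_cst] at h1
    exact one_ne_zero (α := k) (cst_injective (X := X) (ModuleCat.of k k) hxU
      (h1.trans (map_zero _).symm))

end Chart

end ConeIteration

end

/-! ### The injective dimension of the constant sheaf -/

noncomputable section

namespace ConeIteration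

section Cycles

variable {k : Type u} [Field k] {X : TopCat.{u}}

lemma sapp_iCycles_d (I : CochainComplex (Sh k X) ℤ) (p q : ℤ) (U : Opens X)
    (s : sec (I.cycles p) U) : sapp (I.d p q) U (sapp (I.iCycles p) U s) = 0 := by
  rw [← sapp_comp, I.iCycles_d, sapp_zero]

lemma exists_sapp_iCycles_eq (I : CochainComplex (Sh k X) ℤ) {p q : ℤ} (hpq : p + 1 = q)
    {U : Opens X} (s : sec (I.X p) U) (hs : sapp (I.d p q) U s = 0) :
    ∃ t, sapp (I.iCycles p) U t = s :=
  exists_sapp_eq_of_exact_of_mono (S := ShortComplex.mk _ _ (I.iCycles_d p q))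
    (ShortComplex.exact_of_f_is_kernel _ (I.cyclesIsKernel p q (by simpa using hpq))) s hs

/-- In a flabby resolution of the constant sheaf on a manifold of dimension `n`, the sheaf of
`n`-cocycles is flabby. -/
theorem flabby_cycles (n : ℕ) [ChartedSpace (EuclideanSpace ℝ (Fin n)) X]
    (I : CochainComplex (Sh k X) ℤ) (hI : ∀ p, Flabby (I.X p)) [I.IsStrictlyGE 0]
    (hex : ∀ p, p ≠ 0 → I.ExactAt p) (f : constSheafOf X (ModuleCat.of k k) ⟶ I.X 0) [Mono f]
    (w : f ≫ I.d 0 1 = 0) (hf : (ShortComplex.mk f (I.d 0 1) w).Exact) :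
    Flabby (I.cycles n) := by
  refine Flabby.of_local fun x => ?_
  let φ : OpenPartialHomeomorph X (Fin n → ℝ) := (chartAt (EuclideanSpace ℝ (Fin n)) x)
    |>.transHomeomorph (EuclideanSpace.equiv (Fin n) ℝ).toHomeomorph
  refine ⟨⟨φ.source, φ.open_source⟩, mem_chart_source (EuclideanSpace ℝ (Fin n)) x,
    fun W hW s => ?_⟩
  -- For `n = 0` the cohomological vanishing is not available, but the chart domain has at most one
  -- point, so a nonempty `W` is all of it.
  rcases Nat.eq_zero_or_pos n with rfl | hn
  · by_cases hne : ∃ y, y ∈ W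
    · obtain ⟨y, hy⟩ := hne
      have hSW : (⟨φ.source, φ.open_source⟩ : Opens X) ≤ W := fun z hz => by
        rwa [φ.injOn hz (hW hy) (Subsingleton.elim _ _)]
      exact ⟨res _ hSW s, by rw [res_res, res_self]⟩
    · exact ⟨0, sec_ext _ fun y hy => (hne ⟨y, hy⟩).elim⟩
  · let V : Opens (Fin n → ℝ) := ⟨_, φ.symm.isOpen_inter_preimage W.isOpen⟩
    have hWV : W ≤ chartPreimage φ V := fun y hy =>
      ⟨hW hy, φ.map_source (hW hy), by
        change φ.symm (φ y) ∈ W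
        rwa [φ.left_inv (hW hy)]⟩
    have hVW : chartPreimage φ V ≤ W := fun y hy => by
      have h2 : φ.symm (φ y) ∈ W := hy.2.2
      rwa [φ.left_inv hy.1] at h2
    obtain ⟨s', hs'⟩ := hI n W (sapp (I.iCycles n) W s)
    have hS := isConstResolution_supportedComplex I hI φ hex f w hf
    obtain ⟨y, hy⟩ := hS.exists_d_eq (o := (n : ℤ) - 1) (p := n) (q := n + 1) (by lia) rfl (by lia)
      (by simp) (U := V) (fun z hz => hz.1) (s := s') (by
        change res _ _ (sapp _ _ _) = 0
        rw [← res_res _ le_top hVW, ← sapp_res, hs', sapp_iCycles_d, map_zero])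
    replace ⟨y, hy⟩ : ∃ y : sec (I.X (n - 1)) ⊤, s' - sapp (I.d (n - 1) n) ⊤ y ∈
      (supportedComplex I hI φ).N n V := ⟨y, hy⟩
    have hy' : res (I.X n) le_top s' = res (I.X n) (le_top : W ≤ ⊤) (sapp (I.d (n - 1) n) ⊤ y) := by
      have h1 : res (I.X n) (le_top : chartPreimage φ V ≤ ⊤) (s' - sapp (I.d (n - 1) n) ⊤ y) = 0 :=
        hy
      rw [map_sub, sub_eq_zero] at h1
      rw [← res_res _ le_top hWV, h1, res_res]
    -- The cocycle `s` equals `dy` on `W` with `y` global, so `dy` restricted to the chart domain is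
    -- a cocycle extending `s`.
    obtain ⟨t, ht⟩ := exists_sapp_iCycles_eq I (p := n) (q := n + 1) rfl
      (U := ⟨φ.source, φ.open_source⟩) (res (I.X n) le_top (sapp (I.d (n - 1) n) ⊤ y))
      (by rw [sapp_res, ← sapp_comp, I.d_comp_d, sapp_zero, map_zero])
    refine ⟨t, sapp_injective (I.iCycles n) W ?_⟩
    rw [sapp_res, ht, res_res, ← hy', hs']

end Cycles

section Vanishing

variable {C : Type*} [Category* C] [Abelian C] [HasDerivedCategory.{w} C]

omit [HasDerivedCategory.{w} C] in
lemma exists_mono_exact_cochainComplex {Z : C} (R : InjectiveResolution Z) :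
    ∃ (f : Z ⟶ R.cochainComplex.X 0) (w : f ≫ R.cochainComplex.d 0 1 = 0),
      Mono f ∧ (ShortComplex.mk f (R.cochainComplex.d 0 1) w).Exact := by
  let f : ((CochainComplex.single₀ C).obj Z).X 0 ⟶ R.cochainComplex.X 0 :=
    R.ι.f 0 ≫ (R.cochainComplexXIso 0 0 rfl).inv
  have hd := R.cochainComplex_d 0 1 0 1 rfl rfl
  have w : f ≫ R.cochainComplex.d 0 1 = 0 := by
    dsimp only [f]
    rw [hd, Category.assoc, Iso.inv_hom_id_assoc, R.ι_f_zero_comp_complex_d_assoc, zero_comp]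
  have : Mono (R.ι.f 0) := inferInstance
  refine ⟨f, w, mono_comp (R.ι.f 0) (R.cochainComplexXIso 0 0 rfl).inv, ?_⟩
  let e : ShortComplex.mk _ _ R.ι_f_zero_comp_complex_d ≅
      ShortComplex.mk f (R.cochainComplex.d 0 1) w :=
    ShortComplex.isoMk (Iso.refl _) (R.cochainComplexXIso 0 0 rfl).symm
      (R.cochainComplexXIso 1 1 rfl).symm (by simp [f]) (by simp [hd])
  exact ShortComplex.exact_of_iso e R.exact₀

/-- There are no morphisms in the derived category from an object in degrees `> n` to a bounded
complex of injective objects in degrees `≤ n`. -/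
lemma eq_zero_of_isKInjective {Y : DerivedCategory C} {n : ℤ} [Y.IsGE (n + 1)]
    (E : CochainComplex C ℤ) [E.IsKInjective] [E.IsStrictlyLE n]
    (f : Y ⟶ DerivedCategory.Q.obj E) : f = 0 := by
  obtain ⟨K, _, ⟨e⟩⟩ := DerivedCategory.exists_iso_Q_obj_of_isGE Y (n + 1)
  suffices ∀ g : DerivedCategory.Q.obj K ⟶ DerivedCategory.Q.obj E, g = 0 by
    rw [← cancel_epi e.inv, this (e.inv ≫ f), comp_zero]
  intro g
  let α := DerivedCategory.quotientCompQhIso C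
  -- K-injectivity of `E` represents the morphism by an actual map of complexes, which is zero since
  -- source and target have no common degree.
  obtain ⟨h, hh⟩ := (CochainComplex.IsKInjective.Qh_map_bijective
    ((HomotopyCategory.quotient _ _).obj K) E).surjective (α.hom.app K ≫ g ≫ α.inv.app E)
  obtain ⟨h, rfl⟩ := (HomotopyCategory.quotient _ _).map_surjective h
  have h0 : h = 0 := by
    ext i
    by_cases hi : n < i
    · exact (CochainComplex.isZero_of_isStrictlyLE E n i hi).eq_of_tgt _ _
    · exact (CochainComplex.isZero_of_isStrictlyGE K (n + 1) i (by lia)).eq_of_src _ _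
  rw [h0, Functor.map_zero, Functor.map_zero] at hh
  rw [← cancel_epi (α.hom.app K), ← cancel_mono (α.inv.app E), Category.assoc, ← hh]
  simp

end Vanishing

section Dimension

variable {k : Type u} [Field k] {X : TopCat.{u}} [HasDerivedCategory.{w} (Sh k X)]

/-- The constant sheaf on a manifold of dimension `n` has injective dimension at most `n`. -/
theorem hom_constObj_eq_zero (n : ℕ) [ChartedSpace (EuclideanSpace ℝ (Fin n)) X]
    {Y : DerivedCategory (Sh k X)} [Y.IsGE ((n : ℤ) + 1)] (g : Y ⟶ constObj k X) : g = 0 := by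
  let R : InjectiveResolution (constSheaf k X) := InjectiveResolution.of _
  let I := R.cochainComplex
  obtain ⟨f, w, _, hf⟩ : ∃ (f : constSheafOf X (ModuleCat.of k k) ⟶ I.X 0)
      (w : f ≫ I.d 0 1 = 0), Mono f ∧ (ShortComplex.mk f (I.d 0 1) w).Exact :=
    exists_mono_exact_cochainComplex R
  have hI : ∀ p, Flabby (I.X p) := fun p => Flabby.of_injective _
  have hex : ∀ p, p ≠ 0 → I.ExactAt p := fun p hp => by
    rcases lt_or_gt_of_ne hp with h | h
    · exact CochainComplex.exactAt_of_isGE I 0 p h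
    · exact CochainComplex.exactAt_of_isLE I 0 p h
  have hZ := (flabby_cycles n I hI hex f w hf).injective
  -- This is `I⁰ → ⋯ → Iⁿ⁻¹ → Zⁿ`, still a resolution, and injective in every degree because `Zⁿ`
  -- is.
  let E := I.truncLE n
  have hE : ∀ i, Injective (E.X i) := fun i => by
    rcases lt_trichotomy i n with h | rfl | h
    · exact Injective.of_iso (I.truncLEXIso n i h).symm inferInstance
    · exact Injective.of_iso (I.truncLEXIsoCycles n).symm hZ
    · exact IsZero.injective (CochainComplex.isZero_of_isStrictlyLE E n i h)
  have hE' : E.IsStrictlyGE 0 := by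
    dsimp only [E]
    rw [CochainComplex.isStrictlyGE_iff]
    intro i hi
    exact IsZero.of_iso (I.isZero_of_isStrictlyGE 0 i hi) (I.truncLEXIso n i (by lia))
  have : E.IsKInjective := CochainComplex.isKInjective_of_injective E 0
  have : I.IsLE n := I.isLE_of_le 0 n (by lia)
  let e : constObj k X ≅ DerivedCategory.Q.obj E :=
    (DerivedCategory.singleFunctorIsoCompQ _ 0).app _ ≪≫ asIso (DerivedCategory.Q.map R.ι') ≪≫
      (asIso (DerivedCategory.Q.map (I.ιTruncLE n))).symm
  rw [← cancel_mono e.hom, eq_zero_of_isKInjective (n := n) E (g ≫ e.hom), zero_comp]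

end Dimension

end ConeIteration

end

/-! ### Exactness of the tensor product of bounded below complexes -/

noncomputable section

namespace ConeIteration

open MonoidalCategory HomologicalComplex

section Retract

variable {C : Type*} [Category* C] [Abelian C]

/-- Maps that sum to the identity reduce a property of `f` to its components `f'`, without
identifying `A` or `B` with a direct sum. -/
lemma mono_of_sum_eq_id {ι : Type*} (s : Finset ι) {A B : C} (f : A ⟶ B) {A' B' : ι → C}
    (f' : ∀ i, A' i ⟶ B' i) [∀ i, Mono (f' i)] (a : ∀ i, A ⟶ A' i) (a' : ∀ i, A' i ⟶ A)
    (b : ∀ i, B ⟶ B' i) (h : ∀ i, a i ≫ f' i = f ≫ b i) (hs : ∑ i ∈ s, a i ≫ a' i = 𝟙 A) :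
    Mono f := by
  refine Preadditive.mono_of_cancel_zero _ fun {T} g hg => ?_
  have hi : ∀ i, g ≫ a i = 0 := fun i => by
    rw [← cancel_mono (f' i), Category.assoc, h, reassoc_of% hg, zero_comp, zero_comp]
  rw [← Category.comp_id g, ← hs, Preadditive.comp_sum]
  exact Finset.sum_eq_zero fun i _ => by rw [← Category.assoc, hi, zero_comp]

lemma epi_of_sum_eq_id {ι : Type*} (s : Finset ι) {A B : C} (f : A ⟶ B) {A' B' : ι → C}
    (f' : ∀ i, A' i ⟶ B' i) [∀ i, Epi (f' i)] (a' : ∀ i, A' i ⟶ A)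
    (b : ∀ i, B ⟶ B' i) (b' : ∀ i, B' i ⟶ B) (h : ∀ i, f' i ≫ b' i = a' i ≫ f)
    (hs : ∑ i ∈ s, b i ≫ b' i = 𝟙 B) :
    Epi f := by
  refine Preadditive.epi_of_cancel_zero _ fun {T} g hg => ?_
  have hi : ∀ i, b' i ≫ g = 0 := fun i => by
    rw [← cancel_epi (f' i), reassoc_of% h, hg, comp_zero, comp_zero]
  rw [← Category.id_comp g, ← hs, Preadditive.sum_comp]
  exact Finset.sum_eq_zero fun i _ => by rw [Category.assoc, hi, comp_zero]

instance : (ShortComplex.π₁ (C := C)).Additive where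

instance : (ShortComplex.π₂ (C := C)).Additive where

instance : (ShortComplex.π₃ (C := C)).Additive where

lemma shortComplex_exact_of_sum_eq_id {ι : Type*} (s : Finset ι) {S : ShortComplex C}
    {S' : ι → ShortComplex C} (hS' : ∀ i, (S' i).Exact) (a : ∀ i, S ⟶ S' i) (a' : ∀ i, S' i ⟶ S)
    (hs : ∑ i ∈ s, a i ≫ a' i = 𝟙 S) : S.Exact := by
  rw [ShortComplex.exact_iff_isZero_homology, IsZero.iff_id_eq_zero]
  have h := congr((ShortComplex.homologyFunctor C).map $hs)
  rw [Functor.map_sum] at h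
  refine Eq.trans (((ShortComplex.homologyFunctor C).map_id S).symm.trans h.symm)
    (Finset.sum_eq_zero fun i _ => ?_)
  rw [Functor.map_comp]
  have h0 : (ShortComplex.homologyFunctor C).map (a i) = 0 :=
    ((ShortComplex.exact_iff_isZero_homology _).1 (hS' i)).eq_of_tgt _ _
  rw [h0]
  exact zero_comp

end Retract

section Tensor

variable {C : Type*} [Category* C] [Abelian C] [MonoidalCategory C] [MonoidalPreadditive C]
  [∀ K₁ K₂ : CochainComplex C ℤ, HasTensor K₁ K₂]

/-- The projection on a summand of the tensor product of complexes. -/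
def tensorProj (K D : CochainComplex C ℤ) (p q m : ℤ) (h : p + q = m) :
    (tensorObj K D).X m ⟶ K.X p ⊗ D.X q :=
  mapBifunctorDesc fun i j hij => if hi : i = p then
    eqToHom (by
      subst hi
      obtain rfl : j = q := by
        have hij' : i + j = m := hij
        lia
      rfl) else 0

lemma ι_tensorProj_self (K D : CochainComplex C ℤ) (p q m : ℤ) (h : p + q = m) :
    ιTensorObj K D p q m h ≫ tensorProj K D p q m h = 𝟙 _ := by
  simp [tensorProj]

lemma ι_tensorProj_of_ne (K D : CochainComplex C ℤ) (p q p' q' m : ℤ) (h : p + q = m)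
    (h' : p' + q' = m) (hne : p' ≠ p) :
    ιTensorObj K D p' q' m h' ≫ tensorProj K D p q m h = 0 := by
  simp [tensorProj, hne]

omit [∀ K₁ K₂ : CochainComplex C ℤ, HasTensor K₁ K₂] in
lemma isZero_tensor_left {A : C} (hA : IsZero A) (B : C) : IsZero (A ⊗ B) := by
  rw [IsZero.iff_id_eq_zero, ← id_whiskerRight, hA.eq_of_src (𝟙 A) 0,
    MonoidalPreadditive.zero_whiskerRight]

omit [∀ K₁ K₂ : CochainComplex C ℤ, HasTensor K₁ K₂] in
lemma isZero_tensor_right (A : C) {B : C} (hB : IsZero B) : IsZero (A ⊗ B) := by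
  rw [IsZero.iff_id_eq_zero, ← whiskerLeft_id, hB.eq_of_src (𝟙 B) 0,
    MonoidalPreadditive.whiskerLeft_zero]

/-- The tensor product of bounded below complexes is a finite sum in each degree. -/
lemma sum_tensorProj_ι (K D : CochainComplex C ℤ) (a : ℤ) [K.IsStrictlyGE a] [D.IsStrictlyGE 0]
    (m n : ℤ) (hmn : m ≤ n) :
    ∑ p ∈ Finset.Icc a n, tensorProj K D p (m - p) m (by lia) ≫
      ιTensorObj K D p (m - p) m (by lia) = 𝟙 _ := by
  refine mapBifunctor.hom_ext fun i j hij => ?_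
  have hij' : i + j = m := hij
  by_cases hi : i ∈ Finset.Icc a n
  · rw [Preadditive.comp_sum, Finset.sum_eq_single i]
    · obtain rfl : j = m - i := by lia
      rw [Category.comp_id]
      exact (reassoc_of% (ι_tensorProj_self K D i (m - i) m hij)) _
    · intro p _ hp
      exact ((reassoc_of%
        (ι_tensorProj_of_ne K D p (m - p) i j m (by lia) hij (Ne.symm hp))) _).trans
        zero_comp
    · exact fun h => (h hi).elim
  · have : IsZero (K.X i ⊗ D.X j) := by
      rw [Finset.mem_Icc, not_and_or] at hi
      rcases hi with hi | hi
      · exact isZero_tensor_left (K.isZero_of_isStrictlyGE a i (by lia)) _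
      · exact isZero_tensor_right _ (D.isZero_of_isStrictlyGE 0 j (by lia))
    exact this.eq_of_src _ _

/-- The morphism induced on the tensor products of complexes by a morphism on the left. -/
def tensorRightMap {K K' : CochainComplex C ℤ} (f : K ⟶ K') (D : CochainComplex C ℤ) :
    tensorObj K D ⟶ tensorObj K' D := tensorHom f (𝟙 D)

lemma ι_tensorRightMap {K K' : CochainComplex C ℤ} (f : K ⟶ K') (D : CochainComplex C ℤ)
    (p q m : ℤ) (h : p + q = m) :
    ιTensorObj K D p q m h ≫ (tensorRightMap f D).f m =
      f.f p ▷ D.X q ≫ ιTensorObj K' D p q m h := by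
  have h1 := ι_mapBifunctorMap f (𝟙 D) (curriedTensor C) (ComplexShape.up ℤ) p q m h
  refine h1.trans ?_
  simp

lemma tensorRightMap_proj {K K' : CochainComplex C ℤ} (f : K ⟶ K') (D : CochainComplex C ℤ)
    (p q m : ℤ) (h : p + q = m) :
    (tensorRightMap f D).f m ≫ tensorProj K' D p q m h =
      tensorProj K D p q m h ≫ f.f p ▷ D.X q := by
  refine mapBifunctor.hom_ext fun i j hij => ?_
  have hij' : i + j = m := hij
  refine ((reassoc_of% (ι_tensorRightMap f D i j m hij)) _).trans ?_
  by_cases hi : i = p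
  · obtain rfl := hi
    obtain rfl : j = q := by lia
    refine Eq.trans ?_ ((reassoc_of% (ι_tensorProj_self K D i j m hij)) _).symm
    rw [ι_tensorProj_self, Category.comp_id]
  · refine Eq.trans ?_
      (((reassoc_of% (ι_tensorProj_of_ne K D p q i j m h hij hi)) _).trans zero_comp).symm
    rw [ι_tensorProj_of_ne _ _ _ _ _ _ _ _ _ hi, comp_zero]

lemma tensorRightMap_comp {K K' K'' : CochainComplex C ℤ} (f : K ⟶ K') (g : K' ⟶ K'')
    (D : CochainComplex C ℤ) :
    tensorRightMap (f ≫ g) D = tensorRightMap f D ≫ tensorRightMap g D := by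
  refine HomologicalComplex.hom_ext _ _ fun m => mapBifunctor.hom_ext fun i j hij => ?_
  rw [comp_f]
  refine (ι_tensorRightMap _ D i j m hij).trans ?_
  refine Eq.trans ?_ ((reassoc_of% (ι_tensorRightMap f D i j m hij)) _).symm
  rw [ι_tensorRightMap, comp_f, comp_whiskerRight, Category.assoc]

lemma tensorRightMap_zero (K K' D : CochainComplex C ℤ) :
    tensorRightMap (0 : K ⟶ K') D = 0 := by
  refine HomologicalComplex.hom_ext _ _ fun m => mapBifunctor.hom_ext fun i j hij => ?_
  refine (ι_tensorRightMap _ D i j m hij).trans ?_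
  simp

/-- The tensor product of an isomorphism of complexes with a complex. -/
def tensorRightIso {K K' : CochainComplex C ℤ} (e : K ≅ K') (D : CochainComplex C ℤ) :
    tensorObj K D ≅ tensorObj K' D where
  hom := tensorRightMap e.hom D
  inv := tensorRightMap e.inv D
  hom_inv_id := by
    rw [← tensorRightMap_comp, e.hom_inv_id]
    refine HomologicalComplex.hom_ext _ _ fun m => mapBifunctor.hom_ext fun i j hij =>
      (ι_tensorRightMap _ D i j m hij).trans ?_
    simp
  inv_hom_id := by
    rw [← tensorRightMap_comp, e.inv_hom_id]
    refine HomologicalComplex.hom_ext _ _ fun m => mapBifunctor.hom_ext fun i j hij =>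
      (ι_tensorRightMap _ D i j m hij).trans ?_
    simp

/-- The tensor product of a short complex of complexes with a complex. -/
def tensorShortComplex (S : ShortComplex (CochainComplex C ℤ)) (D : CochainComplex C ℤ) :
    ShortComplex (CochainComplex C ℤ) :=
  ShortComplex.mk (tensorRightMap S.f D) (tensorRightMap S.g D) (by
    rw [← tensorRightMap_comp, S.zero, tensorRightMap_zero])

lemma isStrictlyGE_tensorObj (K D : CochainComplex C ℤ) (a b : ℤ) [K.IsStrictlyGE a]
    [D.IsStrictlyGE b] (c : ℤ) (h : a + b = c) : CochainComplex.IsStrictlyGE (tensorObj K D) c := by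
  rw [CochainComplex.isStrictlyGE_iff]
  intro m hm
  rw [IsZero.iff_id_eq_zero]
  refine mapBifunctor.hom_ext fun i j hij => ?_
  have hij' : i + j = m := hij
  have : IsZero (K.X i ⊗ D.X j) := by
    by_cases hi : i < a
    · exact isZero_tensor_left (K.isZero_of_isStrictlyGE a i (by lia)) _
    · exact isZero_tensor_right _ (D.isZero_of_isStrictlyGE b j (by lia))
  exact this.eq_of_src _ _

variable [∀ X : C, PreservesFiniteLimits (tensorRight X)]
  [∀ X : C, PreservesFiniteColimits (tensorRight X)]

/-- In degree `m` the identity of the tensored sequence is a sum of maps factoring through the exact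
sequences `Sᵖ ⊗ D^{m-p}`. Boundedness below makes the sum finite. -/
lemma shortExact_tensorShortComplex {S : ShortComplex (CochainComplex C ℤ)} (hS : S.ShortExact)
    (D : CochainComplex C ℤ) (a : ℤ) [S.X₁.IsStrictlyGE a] [S.X₂.IsStrictlyGE a]
    [S.X₃.IsStrictlyGE a] [D.IsStrictlyGE 0] : (tensorShortComplex S D).ShortExact := by
  have hS' : ∀ p q, ((S.map (eval C _ p)).map (tensorRight (D.X q))).ShortExact := fun p q =>
    (hS.map_of_exact (eval C _ p)).map_of_exact (tensorRight (D.X q))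
  refine HomologicalComplex.shortExact_of_degreewise_shortExact _ fun m => ?_
  let a' : ∀ p, (tensorShortComplex S D).map (eval C (.up ℤ) m) ⟶
      (S.map (eval C _ p)).map (tensorRight (D.X (m - p))) := fun p =>
    { τ₁ := tensorProj _ _ p (m - p) m (by lia)
      τ₂ := tensorProj _ _ p (m - p) m (by lia)
      τ₃ := tensorProj _ _ p (m - p) m (by lia)
      comm₁₂ := (tensorRightMap_proj _ _ _ _ _ _).symm
      comm₂₃ := (tensorRightMap_proj _ _ _ _ _ _).symm }
  let b' : ∀ p, (S.map (eval C _ p)).map (tensorRight (D.X (m - p))) ⟶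
      (tensorShortComplex S D).map (eval C (.up ℤ) m) := fun p =>
    { τ₁ := ιTensorObj _ _ p (m - p) m (by lia)
      τ₂ := ιTensorObj _ _ p (m - p) m (by lia)
      τ₃ := ιTensorObj _ _ p (m - p) m (by lia)
      comm₁₂ := ι_tensorRightMap _ _ _ _ _ _
      comm₂₃ := ι_tensorRightMap _ _ _ _ _ _ }
  have hs : ∑ p ∈ Finset.Icc a m, a' p ≫ b' p = 𝟙 _ := by
    have h1 := sum_tensorProj_ι S.X₁ D a m m le_rfl
    have h2 := sum_tensorProj_ι S.X₂ D a m m le_rfl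
    have h3 := sum_tensorProj_ι S.X₃ D a m m le_rfl
    ext
    · exact (map_sum ((ShortComplex.π₁ (C := C)).mapAddHom) _ _).trans h1
    · exact (map_sum ((ShortComplex.π₂ (C := C)).mapAddHom) _ _).trans h2
    · exact (map_sum ((ShortComplex.π₃ (C := C)).mapAddHom) _ _).trans h3
  refine ShortComplex.ShortExact.mk' (shortComplex_exact_of_sum_eq_id (Finset.Icc a m)
    (fun p => (hS' p (m - p)).exact) a' b' hs) ?_ ?_
  · have : ∀ p, Mono ((S.map (eval C _ p)).map (tensorRight (D.X (m - p)))).f :=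
      fun p => (hS' p _).mono_f
    exact mono_of_sum_eq_id (Finset.Icc a m) _
      (fun p => ((S.map (eval C _ p)).map (tensorRight (D.X (m - p)))).f) (fun p => (a' p).τ₁)
      (fun p => (b' p).τ₁) (fun p => (a' p).τ₂) (fun p => (a' p).comm₁₂)
      (sum_tensorProj_ι S.X₁ D a m m le_rfl)
  · have : ∀ p, Epi ((S.map (eval C _ p)).map (tensorRight (D.X (m - p)))).g :=
      fun p => (hS' p _).epi_g
    exact epi_of_sum_eq_id (Finset.Icc a m) _
      (fun p => ((S.map (eval C _ p)).map (tensorRight (D.X (m - p)))).g) (fun p => (b' p).τ₂)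
      (fun p => (a' p).τ₃) (fun p => (b' p).τ₃) (fun p => (b' p).comm₂₃.symm)
      (sum_tensorProj_ι S.X₃ D a m m le_rfl)

end Tensor

end ConeIteration

end

/-! ### Tensoring with a complex with zero differentials -/

noncomputable section

namespace ConeIteration

open MonoidalCategory HomologicalComplex

section ZeroDifferential

variable {C : Type*} [Category* C] [Abelian C] [MonoidalCategory C] [MonoidalPreadditive C]
  [∀ K₁ K₂ : CochainComplex C ℤ, HasTensor K₁ K₂]

lemma ι_tensor_d (K D : CochainComplex C ℤ) (hK : ∀ p q, K.d p q = 0) (p q q' m m' : ℤ)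
    (h : p + q = m) (h' : p + q' = m') (hm : m + 1 = m') :
    ιTensorObj K D p q m h ≫ (tensorObj K D).d m m' =
      (K.X p ◁ (p.negOnePow • D.d q q')) ≫ ιTensorObj K D p q' m' h' := by
  obtain rfl : q' = q + 1 := by lia
  rw [mapBifunctor.d_eq, Preadditive.comp_add]
  erw [mapBifunctor.ι_D₁, mapBifunctor.ι_D₂]
  rw [mapBifunctor.d₁_eq' _ _ _ _ (show (ComplexShape.up ℤ).Rel p (p + 1) from rfl), hK,
    mapBifunctor.d₂_eq K D (curriedTensor C) (ComplexShape.up ℤ) p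
      (show (ComplexShape.up ℤ).Rel q (q + 1) from rfl) m' h']
  have h0 : K.X p ◁ (p.negOnePow • D.d q (q + 1)) = p.negOnePow • (K.X p ◁ D.d q (q + 1)) := by
    exact (tensorLeft (K.X p)).map_zsmul (f := D.d q (q + 1)) (r := (p.negOnePow : ℤ))
  rw [h0, Linear.units_smul_comp]
  simp

lemma tensor_d_proj (K D : CochainComplex C ℤ) (hK : ∀ p q, K.d p q = 0) (p q q' m m' : ℤ)
    (h : p + q = m) (h' : p + q' = m') (hm : m + 1 = m') :
    (tensorObj K D).d m m' ≫ tensorProj K D p q' m' h' =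
      tensorProj K D p q m h ≫ K.X p ◁ (p.negOnePow • D.d q q') := by
  refine mapBifunctor.hom_ext fun i j hij => ?_
  have hij' : i + j = m := hij
  refine ((reassoc_of% (ι_tensor_d K D hK i j (j + 1) m m' hij (by lia) hm)) _).trans ?_
  by_cases hi : i = p
  · obtain rfl := hi
    obtain rfl : j = q := by lia
    obtain rfl : q' = j + 1 := by lia
    refine Eq.trans ?_ ((reassoc_of% (ι_tensorProj_self K D i j m hij)) _).symm
    rw [ι_tensorProj_self, Category.comp_id]
  · refine Eq.trans ?_
      (((reassoc_of% (ι_tensorProj_of_ne K D p q i j m h hij hi)) _).trans zero_comp).symm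
    rw [ι_tensorProj_of_ne _ _ _ _ _ _ _ _ _ hi, comp_zero]

/-- The part of a complex around degree `m - p`, with the differentials multiplied by the sign
which appears in a tensor product. -/
def scaledSc (D : CochainComplex C ℤ) (m p : ℤ) : ShortComplex C :=
  ShortComplex.mk (p.negOnePow • D.d (m - 1 - p) (m - p)) (p.negOnePow • D.d (m - p) (m + 1 - p))
    (by simp [Units.smul_def])

omit [MonoidalCategory C] [MonoidalPreadditive C]
  [∀ K₁ K₂ : CochainComplex C ℤ, HasTensor K₁ K₂] in
/-- Multiplying the differentials by a sign does not change the homology. -/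
lemma nonempty_scaledSc_homology_iso (D : CochainComplex C ℤ) (m p : ℤ) :
    Nonempty ((scaledSc D m p).homology ≅ D.homology (m - p)) := by
  let ε : (D.X (m - p)) ≅ (D.X (m - p)) :=
    { hom := p.negOnePow • 𝟙 _
      inv := p.negOnePow • 𝟙 _
      hom_inv_id := by
        rw [Linear.units_smul_comp, Linear.comp_units_smul, smul_smul, Int.units_mul_self, one_smul,
          Category.id_comp]
      inv_hom_id := by
        rw [Linear.units_smul_comp, Linear.comp_units_smul, smul_smul, Int.units_mul_self, one_smul,
          Category.id_comp] }
  let e : scaledSc D m p ≅ D.sc' (m - 1 - p) (m - p) (m + 1 - p) :=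
    ShortComplex.isoMk (Iso.refl (D.X (m - 1 - p))) ε (Iso.refl (D.X (m + 1 - p)))
      (by
        change 𝟙 _ ≫ D.d _ _ = (p.negOnePow • D.d _ _) ≫ (p.negOnePow • 𝟙 _)
        rw [Linear.units_smul_comp, Linear.comp_units_smul, smul_smul, Int.units_mul_self, one_smul,
          Category.id_comp, Category.comp_id])
      (by
        change (p.negOnePow • 𝟙 _) ≫ D.d _ _ = (p.negOnePow • D.d _ _) ≫ 𝟙 _
        rw [Linear.units_smul_comp, Category.id_comp, Category.comp_id])
  exact ⟨ShortComplex.homologyMapIso e ≪≫ ShortComplex.homologyMapIso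
    (D.isoSc' (m - 1 - p) (m - p) (m + 1 - p) (by simp; lia) (by simp; lia)).symm⟩

/-- The inclusion of a summand in the tensor product with a complex with zero differentials. -/
def scInclusion (X D : CochainComplex C ℤ) (hX : ∀ p q, X.d p q = 0) (m p : ℤ) :
    (scaledSc D m p).map (tensorLeft (X.X p)) ⟶ (tensorObj X D).sc' (m - 1) m (m + 1) where
  τ₁ := ιTensorObj X D p (m - 1 - p) (m - 1) (by lia)
  τ₂ := ιTensorObj X D p (m - p) m (by lia)
  τ₃ := ιTensorObj X D p (m + 1 - p) (m + 1) (by lia)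
  comm₁₂ := ι_tensor_d X D hX p _ _ _ _ _ _ (by lia)
  comm₂₃ := ι_tensor_d X D hX p _ _ _ _ _ _ (by lia)

/-- The projection on a summand of the tensor product with a complex with zero differentials. -/
def scProjection (X D : CochainComplex C ℤ) (hX : ∀ p q, X.d p q = 0) (m p : ℤ) :
    (tensorObj X D).sc' (m - 1) m (m + 1) ⟶ (scaledSc D m p).map (tensorLeft (X.X p)) where
  τ₁ := tensorProj X D p (m - 1 - p) (m - 1) (by lia)
  τ₂ := tensorProj X D p (m - p) m (by lia)
  τ₃ := tensorProj X D p (m + 1 - p) (m + 1) (by lia)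
  comm₁₂ := (tensor_d_proj X D hX p _ _ _ _ _ _ (by lia)).symm
  comm₂₃ := (tensor_d_proj X D hX p _ _ _ _ _ _ (by lia)).symm

lemma sum_scProjection_scInclusion (X D : CochainComplex C ℤ) (hX : ∀ p q, X.d p q = 0) (a : ℤ)
    [X.IsStrictlyGE a] [D.IsStrictlyGE 0] (m : ℤ) :
    ∑ p ∈ Finset.Icc a (m + 1), scProjection X D hX m p ≫ scInclusion X D hX m p = 𝟙 _ := by
  -- Summing up to `m + 1` covers the degrees `m - 1`, `m` and `m + 1` with one index set; the
  -- superfluous summands are zero.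
  have h1 := sum_tensorProj_ι X D a (m - 1) (m + 1) (by lia)
  have h2 := sum_tensorProj_ι X D a m (m + 1) (by lia)
  have h3 := sum_tensorProj_ι X D a (m + 1) (m + 1) (by lia)
  apply ShortComplex.hom_ext
  · exact (map_sum ((ShortComplex.π₁ (C := C)).mapAddHom) _ _).trans h1
  · exact (map_sum ((ShortComplex.π₂ (C := C)).mapAddHom) _ _).trans h2
  · exact (map_sum ((ShortComplex.π₃ (C := C)).mapAddHom) _ _).trans h3

lemma sum_homologyMap_scProjection_scInclusion (X D : CochainComplex C ℤ)
    (hX : ∀ p q, X.d p q = 0) (a : ℤ) [X.IsStrictlyGE a] [D.IsStrictlyGE 0] (m : ℤ) :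
    ∑ p ∈ Finset.Icc a (m + 1), ShortComplex.homologyMap (scProjection X D hX m p) ≫
      ShortComplex.homologyMap (scInclusion X D hX m p) = 𝟙 _ := by
  have := congrArg (ShortComplex.homologyFunctor C).map (sum_scProjection_scInclusion X D hX a m)
  rw [Functor.map_sum] at this
  refine Eq.trans (Finset.sum_congr rfl fun p _ => ?_)
    (this.trans ((ShortComplex.homologyFunctor C).map_id _))
  exact (ShortComplex.homologyMap_comp _ _).symm

lemma scInclusion_scProjection_self (X D : CochainComplex C ℤ) (hX : ∀ p q, X.d p q = 0)
    (m p : ℤ) : scInclusion X D hX m p ≫ scProjection X D hX m p = 𝟙 _ := by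
  apply ShortComplex.hom_ext <;> exact ι_tensorProj_self _ _ _ _ _ _

lemma scInclusion_scProjection_of_ne (X D : CochainComplex C ℤ) (hX : ∀ p q, X.d p q = 0)
    (m : ℤ) {p q : ℤ} (h : p ≠ q) : scInclusion X D hX m p ≫ scProjection X D hX m q = 0 := by
  apply ShortComplex.hom_ext <;> exact ι_tensorProj_of_ne _ _ _ _ _ _ _ (by lia) (by lia) h

/-- The morphism induced on the summands. -/
def scSummandMap {X Y : CochainComplex C ℤ} (f : X ⟶ Y) (D : CochainComplex C ℤ) (m p : ℤ) :
    (scaledSc D m p).map (tensorLeft (X.X p)) ⟶ (scaledSc D m p).map (tensorLeft (Y.X p)) :=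
  (scaledSc D m p).mapNatTrans ((tensoringLeft C).map (f.f p))

lemma scInclusion_naturality {X Y : CochainComplex C ℤ} (f : X ⟶ Y) (D : CochainComplex C ℤ)
    (hX : ∀ p q, X.d p q = 0) (hY : ∀ p q, Y.d p q = 0) (m p : ℤ) :
    scSummandMap f D m p ≫ scInclusion Y D hY m p = scInclusion X D hX m p ≫
      (shortComplexFunctor' C (.up ℤ) (m - 1) m (m + 1)).map (tensorRightMap f D) := by
  apply ShortComplex.hom_ext <;> exact (ι_tensorRightMap _ _ _ _ _ _).symm

lemma scProjection_naturality {X Y : CochainComplex C ℤ} (f : X ⟶ Y) (D : CochainComplex C ℤ)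
    (hX : ∀ p q, X.d p q = 0) (hY : ∀ p q, Y.d p q = 0) (m p : ℤ) :
    scProjection X D hX m p ≫ scSummandMap f D m p =
      (shortComplexFunctor' C (.up ℤ) (m - 1) m (m + 1)).map (tensorRightMap f D) ≫
        scProjection Y D hY m p := by
  apply ShortComplex.hom_ext <;> exact (tensorRightMap_proj _ _ _ _ _ (by lia)).symm

omit [MonoidalCategory C] [MonoidalPreadditive C]
  [∀ K₁ K₂ : CochainComplex C ℤ, HasTensor K₁ K₂] in
lemma homologyMap_eq_sc' {K K' : CochainComplex C ℤ} (f : K ⟶ K') (m : ℤ) :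
    ∃ (e : K.homology m ≅ (K.sc' (m - 1) m (m + 1)).homology)
      (e' : K'.homology m ≅ (K'.sc' (m - 1) m (m + 1)).homology),
      homologyMap f m = e.hom ≫ ShortComplex.homologyMap
        ((shortComplexFunctor' C (.up ℤ) (m - 1) m (m + 1)).map f) ≫ e'.inv := by
  let α := homologyFunctorIso' C (.up ℤ) (m - 1) m (m + 1) (by simp) (by simp)
  refine ⟨α.app K, α.app K', ?_⟩
  have := α.hom.naturality f
  change (homologyFunctor C (.up ℤ) m).map f = α.hom.app K ≫
    (shortComplexFunctor' C _ (m - 1) m (m + 1) ⋙ ShortComplex.homologyFunctor C).map f ≫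
      α.inv.app K'
  rw [← Category.assoc, ← this, Category.assoc, Iso.hom_inv_id_app, Category.comp_id]

variable [∀ X : C, PreservesFiniteLimits (tensorRight X)]
  [∀ X : C, PreservesFiniteColimits (tensorRight X)]
  [∀ X : C, PreservesFiniteLimits (tensorLeft X)]
  [∀ X : C, PreservesFiniteColimits (tensorLeft X)]

omit [∀ K₁ K₂ : CochainComplex C ℤ, HasTensor K₁ K₂]
  [∀ X : C, PreservesFiniteLimits (tensorRight X)]
  [∀ X : C, PreservesFiniteColimits (tensorRight X)] in
lemma homologyMap_scSummandMap {X Y : CochainComplex C ℤ} (f : X ⟶ Y) (D : CochainComplex C ℤ)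
    (m p : ℤ) :
    ShortComplex.homologyMap (scSummandMap f D m p) =
      ((scaledSc D m p).mapHomologyIso (tensorLeft (X.X p))).hom ≫
        f.f p ▷ (scaledSc D m p).homology ≫
        ((scaledSc D m p).mapHomologyIso (tensorLeft (Y.X p))).inv := by
  have := NatTrans.app_homology ((tensoringLeft C).map (f.f p)) (scaledSc D m p)
  have h : f.f p ▷ (scaledSc D m p).homology =
    ((scaledSc D m p).mapHomologyIso (tensorLeft (X.X p))).inv ≫
      ShortComplex.homologyMap (scSummandMap f D m p) ≫
        ((scaledSc D m p).mapHomologyIso (tensorLeft (Y.X p))).hom := this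
  rw [h, Category.assoc, Category.assoc, Iso.hom_inv_id, Category.comp_id, Iso.hom_inv_id_assoc]

/-- On each summand the map is, up to isomorphism, `fᵖ ⊗ H^{m-p}(D)`, and tensoring preserves
monomorphisms. -/
lemma mono_homologyMap_tensorRightMap {X Y : CochainComplex C ℤ} (f : X ⟶ Y)
    (D : CochainComplex C ℤ) (hX : ∀ p q, X.d p q = 0) (hY : ∀ p q, Y.d p q = 0) (a : ℤ)
    [X.IsStrictlyGE a] [D.IsStrictlyGE 0] (hf : ∀ p, Mono (f.f p)) (m : ℤ) :
    Mono (homologyMap (tensorRightMap f D) m) := by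
  obtain ⟨e, e', h⟩ := homologyMap_eq_sc' (tensorRightMap f D) m
  rw [h]
  let H := ShortComplex.homologyFunctor C
  have : ∀ p, Mono (ShortComplex.homologyMap (scSummandMap f D m p)) := fun p => by
    rw [homologyMap_scSummandMap]
    have : Mono (f.f p ▷ (scaledSc D m p).homology) :=
      inferInstanceAs (Mono ((tensorRight _).map (f.f p)))
    infer_instance
  have : Mono (ShortComplex.homologyMap
      ((shortComplexFunctor' C (.up ℤ) (m - 1) m (m + 1)).map (tensorRightMap f D))) := by
    refine mono_of_sum_eq_id (Finset.Icc a (m + 1)) _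
      (fun p => ShortComplex.homologyMap (scSummandMap f D m p))
      (fun p => H.map (scProjection X D hX m p)) (fun p => H.map (scInclusion X D hX m p))
      (fun p => H.map (scProjection Y D hY m p)) (fun p => ?_) ?_
    · exact (H.map_comp _ _).symm.trans
        ((congrArg H.map (scProjection_naturality f D hX hY m p)).trans (H.map_comp _ _))
    · exact sum_homologyMap_scProjection_scInclusion X D hX a m
  infer_instance

lemma epi_homologyMap_tensorRightMap {X Y : CochainComplex C ℤ} (f : X ⟶ Y)
    (D : CochainComplex C ℤ) (hX : ∀ p q, X.d p q = 0) (hY : ∀ p q, Y.d p q = 0) (a : ℤ)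
    [Y.IsStrictlyGE a] [D.IsStrictlyGE 0] (hf : ∀ p, Epi (f.f p)) (m : ℤ) :
    Epi (homologyMap (tensorRightMap f D) m) := by
  obtain ⟨e, e', h⟩ := homologyMap_eq_sc' (tensorRightMap f D) m
  rw [h]
  let H := ShortComplex.homologyFunctor C
  have : ∀ p, Epi (ShortComplex.homologyMap (scSummandMap f D m p)) := fun p => by
    rw [homologyMap_scSummandMap]
    have : Epi (f.f p ▷ (scaledSc D m p).homology) :=
      inferInstanceAs (Epi ((tensorRight _).map (f.f p)))
    infer_instance
  have : Epi (ShortComplex.homologyMap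
      ((shortComplexFunctor' C (.up ℤ) (m - 1) m (m + 1)).map (tensorRightMap f D))) := by
    refine epi_of_sum_eq_id (Finset.Icc a (m + 1)) _
      (fun p => ShortComplex.homologyMap (scSummandMap f D m p))
      (fun p => H.map (scInclusion X D hX m p))
      (fun p => H.map (scProjection Y D hY m p)) (fun p => H.map (scInclusion Y D hY m p))
      (fun p => ?_) ?_
    · exact (H.map_comp _ _).symm.trans
        ((congrArg H.map (scInclusion_naturality f D hX hY m p)).trans (H.map_comp _ _))
    · exact sum_homologyMap_scProjection_scInclusion Y D hY a m
  infer_instance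

omit [∀ X : C, PreservesFiniteLimits (tensorRight X)]
  [∀ X : C, PreservesFiniteColimits (tensorRight X)] in
/-- The Künneth formula for a complex with zero differentials. -/
lemma exists_isBilimit_of_d_eq_zero (X D : CochainComplex C ℤ) (hX : ∀ p q, X.d p q = 0)
    (a : ℤ) [X.IsStrictlyGE a] [D.IsStrictlyGE 0] (m : ℤ) :
    ∃ B : Bicone (fun p : Finset.Icc a (m + 1) => X.X p ⊗ D.homology (m - p)),
      Nonempty B.IsBilimit ∧ Nonempty (B.pt ≅ (tensorObj X D).homology m) := by
  let e' : ∀ p, ((scaledSc D m p).map (tensorLeft (X.X p))).homology ≅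
      X.X p ⊗ D.homology (m - p) := fun p =>
    (scaledSc D m p).mapHomologyIso (tensorLeft (X.X p)) ≪≫
      (tensorLeft (X.X p)).mapIso (nonempty_scaledSc_homology_iso D m p).some
  let e : (tensorObj X D).homology m ≅ ((tensorObj X D).sc' (m - 1) m (m + 1)).homology :=
    (homologyFunctorIso' C (.up ℤ) (m - 1) m (m + 1) (by simp) (by simp)).app _
  let B : Bicone (fun p : Finset.Icc a (m + 1) => X.X p ⊗ D.homology (m - p)) :=
    { pt := ((tensorObj X D).sc' (m - 1) m (m + 1)).homology
      π := fun p => ShortComplex.homologyMap (scProjection X D hX m p) ≫ (e' p).hom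
      ι := fun p => (e' p).inv ≫ ShortComplex.homologyMap (scInclusion X D hX m p)
      ι_π := fun p q => by
        rw [Category.assoc, ← Category.assoc (ShortComplex.homologyMap _),
          ← ShortComplex.homologyMap_comp]
        split_ifs with h
        · subst h
          rw [scInclusion_scProjection_self, ShortComplex.homologyMap_id, Category.id_comp,
            Iso.inv_hom_id, eqToHom_refl]
        · rw [scInclusion_scProjection_of_ne X D hX m (fun h' => h (Subtype.ext h')),
            ShortComplex.homologyMap_zero, zero_comp, comp_zero] }
  refine ⟨B, ⟨isBilimitOfTotal B ?_⟩, ⟨e.symm⟩⟩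
  have := sum_homologyMap_scProjection_scInclusion X D hX a m
  rw [← Finset.sum_coe_sort] at this
  refine Eq.trans (Finset.sum_congr rfl fun p _ => ?_) this
  simp [B]

end ZeroDifferential

end ConeIteration

end

/-! ### The Künneth formula -/

noncomputable section

namespace ConeIteration

open MonoidalCategory HomologicalComplex

section ZeroComplex

variable {C : Type*} [Category* C] [Abelian C]

/-- The complex with given objects and zero differentials. -/
def zeroComplex (Y : ℤ → C) : CochainComplex C ℤ where
  X := Y
  d _ _ := 0

lemma zeroComplex_d (Y : ℤ → C) (p q : ℤ) : (zeroComplex Y).d p q = 0 := rfl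

lemma isStrictlyGE_zeroComplex {Y : ℤ → C} {a : ℤ} (h : ∀ p < a, IsZero (Y p)) :
    (zeroComplex Y).IsStrictlyGE a :=
  (CochainComplex.isStrictlyGE_iff _ _).2 h

/-- The morphism of complexes with zero differentials given by a family of morphisms. -/
def zeroComplexMap {Y Z : ℤ → C} (f : ∀ p, Y p ⟶ Z p) : zeroComplex Y ⟶ zeroComplex Z where
  f := f
  comm' _ _ _ := comp_zero.trans zero_comp.symm

/-- A morphism to a complex with zero differentials. -/
def toZeroComplex (K : CochainComplex C ℤ) {Y : ℤ → C} (f : ∀ p, K.X p ⟶ Y p)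
    (hf : ∀ p q, K.d p q ≫ f q = 0) : K ⟶ zeroComplex Y where
  f := f
  comm' p q _ := comp_zero.trans (hf p q).symm

/-- A morphism from a complex with zero differentials. -/
def ofZeroComplex (K : CochainComplex C ℤ) {Y : ℤ → C} (f : ∀ p, Y p ⟶ K.X p)
    (hf : ∀ p q, f p ≫ K.d p q = 0) : zeroComplex Y ⟶ K where
  f := f
  comm' p q _ := (hf p q).trans zero_comp.symm

/-- The differential, as a morphism to the shifted complex with zero differentials. -/
def dTo (K : CochainComplex C ℤ) : K ⟶ zeroComplex fun p => K.X (p + 1) :=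
  toZeroComplex K (fun p => K.d p (p + 1)) (fun _ _ => K.d_comp_d _ _ _)

/-- The differential, as a morphism from the shifted complex with zero differentials. -/
def dOf (K : CochainComplex C ℤ) : zeroComplex (fun p => K.X (p - 1)) ⟶ K :=
  ofZeroComplex K (fun p => K.d (p - 1) p) (fun _ _ => K.d_comp_d _ _ _)

/-- The differential is homotopic to zero, as a morphism to the shifted complex. -/
def dToHomotopy (K : CochainComplex C ℤ) : Homotopy (dTo K) 0 where
  hom i j := if h : i = j + 1 then eqToHom (congrArg K.X h) else 0
  zero i j h := dif_neg fun h' => h h'.symm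
  comm i := by
    rw [dNext_eq _ (show (ComplexShape.up ℤ).Rel i (i + 1) from rfl),
      prevD_eq _ (show (ComplexShape.up ℤ).Rel (i - 1) i by simp)]
    simp only [dif_pos, zeroComplex_d, comp_zero, add_zero, zero_f]
    exact (Category.comp_id _).symm

/-- The differential is homotopic to zero, as a morphism from the shifted complex. -/
def dOfHomotopy (K : CochainComplex C ℤ) : Homotopy (dOf K) 0 where
  hom i j := if h : i - 1 = j then eqToHom (congrArg K.X h) else 0
  zero i j h := dif_neg fun h' => h (by simpa using (by lia : j + 1 = i))
  comm i := by
    rw [dNext_eq _ (show (ComplexShape.up ℤ).Rel i (i + 1) from rfl),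
      prevD_eq _ (show (ComplexShape.up ℤ).Rel (i - 1) i by simp)]
    simp only [dif_pos, zeroComplex_d, zero_comp, add_zero, zero_add, zero_f]
    exact (Category.id_comp _).symm

/-- The inclusion of the cocycles. -/
def cyclesInclusion (K : CochainComplex C ℤ) : zeroComplex (fun p => K.cycles p) ⟶ K :=
  ofZeroComplex K (fun p => K.iCycles p) (fun _ _ => K.iCycles_d _ _)

/-- The projection on the cochains modulo coboundaries. -/
def opcyclesProjection (K : CochainComplex C ℤ) : K ⟶ zeroComplex (fun p => K.opcycles p) :=
  toZeroComplex K (fun p => K.pOpcycles p) (fun _ _ => K.d_pOpcycles _ _)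

/-- The differential, as a morphism to the coboundaries. -/
def toBoundaries (K : CochainComplex C ℤ) :
    K ⟶ zeroComplex (fun p => image (K.d p (p + 1))) :=
  toZeroComplex K (fun p => factorThruImage (K.d p (p + 1))) (fun p q => by
    rw [← cancel_mono (image.ι _), Category.assoc, image.fac, K.d_comp_d, zero_comp])

/-- The inclusion of the coboundaries. -/
def boundariesInclusion (K : CochainComplex C ℤ) :
    zeroComplex (fun p => image (K.d (p - 1) p)) ⟶ K :=
  ofZeroComplex K (fun p => image.ι (K.d (p - 1) p)) (fun p q => by
      rw [← cancel_epi (factorThruImage _), image.fac_assoc, K.d_comp_d, comp_zero])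

/-- The sequence of cocycles, cochains and coboundaries. -/
def cyclesSequence (K : CochainComplex C ℤ) : ShortComplex (CochainComplex C ℤ) :=
  ShortComplex.mk (cyclesInclusion K) (toBoundaries K) (by
    ext p
    refine (cancel_mono (image.ι (K.d p (p + 1)))).1 ?_
    exact (Category.assoc _ _ _).trans ((congrArg _ (image.fac _)).trans
      ((K.iCycles_d _ _).trans zero_comp.symm)))

lemma cyclesSequence_shortExact (K : CochainComplex C ℤ) : (cyclesSequence K).ShortExact := by
  refine shortExact_of_degreewise_shortExact _ fun p => ?_
  let T : ShortComplex C := ShortComplex.mk (K.iCycles p) (factorThruImage (K.d p (p + 1))) (by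
    rw [← cancel_mono (image.ι _), Category.assoc, image.fac, K.iCycles_d, zero_comp])
  let φ : T ⟶ ShortComplex.mk (K.iCycles p) (K.d p (p + 1)) (K.iCycles_d _ _) :=
    { τ₁ := 𝟙 _
      τ₂ := 𝟙 _
      τ₃ := image.ι _ }
  have hT : T.Exact := by
    have : Epi φ.τ₁ := inferInstanceAs (Epi (𝟙 _))
    have : IsIso φ.τ₂ := inferInstanceAs (IsIso (𝟙 _))
    have : Mono φ.τ₃ := inferInstanceAs (Mono (image.ι _))
    rw [ShortComplex.exact_iff_of_epi_of_isIso_of_mono φ]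
    exact ShortComplex.exact_of_f_is_kernel _ (K.cyclesIsKernel p (p + 1) (by simp))
  exact ShortComplex.ShortExact.mk' hT (inferInstanceAs (Mono (K.iCycles p)))
    (inferInstanceAs (Epi (factorThruImage (K.d p (p + 1)))))

/-- The sequence of coboundaries, cochains, and cochains modulo coboundaries. -/
def opcyclesSequence (K : CochainComplex C ℤ) : ShortComplex (CochainComplex C ℤ) :=
  ShortComplex.mk (boundariesInclusion K) (opcyclesProjection K) (by
    ext p
    refine (cancel_epi (factorThruImage (K.d (p - 1) p))).1 ?_
    exact (image.fac_assoc _ _).trans ((K.d_pOpcycles _ _).trans comp_zero.symm))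

lemma opcyclesSequence_shortExact (K : CochainComplex C ℤ) :
    (opcyclesSequence K).ShortExact := by
  refine shortExact_of_degreewise_shortExact _ fun p => ?_
  let T : ShortComplex C := ShortComplex.mk (image.ι (K.d (p - 1) p)) (K.pOpcycles p) (by
    rw [← cancel_epi (factorThruImage _), image.fac_assoc, K.d_pOpcycles, comp_zero])
  let φ : ShortComplex.mk (K.d (p - 1) p) (K.pOpcycles p) (K.d_pOpcycles _ _) ⟶ T :=
    { τ₁ := factorThruImage _
      τ₂ := 𝟙 _
      τ₃ := 𝟙 _ }
  have hT : T.Exact := by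
    have : Epi φ.τ₁ := inferInstanceAs (Epi (factorThruImage _))
    have : IsIso φ.τ₂ := inferInstanceAs (IsIso (𝟙 _))
    have : Mono φ.τ₃ := inferInstanceAs (Mono (𝟙 _))
    rw [← ShortComplex.exact_iff_of_epi_of_isIso_of_mono φ]
    exact ShortComplex.exact_of_g_is_cokernel _ (K.opcyclesIsCokernel (p - 1) p (by simp))
  exact ShortComplex.ShortExact.mk' hT (inferInstanceAs (Mono (image.ι (K.d (p - 1) p))))
    (inferInstanceAs (Epi (K.pOpcycles p)))

end ZeroComplex

section Kunneth

variable {C : Type*} [Category* C] [Abelian C] [MonoidalCategory C] [MonoidalPreadditive C]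
  [∀ K₁ K₂ : CochainComplex C ℤ, HasTensor K₁ K₂]

lemma homologyMap_tensorRightMap_eq_zero {K K' : CochainComplex C ℤ} {f : K ⟶ K'}
    (h : Homotopy f 0) (D : CochainComplex C ℤ) (m : ℤ) :
    homologyMap (tensorRightMap f D) m = 0 := by
  have h1 : Homotopy (tensorRightMap f D) (tensorRightMap 0 D) :=
    mapBifunctorMapHomotopy₁ h (𝟙 D) (curriedTensor C) (.up ℤ)
  rw [h1.homologyMap_eq, tensorRightMap_zero, homologyMap_zero]

variable [∀ X : C, PreservesFiniteLimits (tensorRight X)]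
  [∀ X : C, PreservesFiniteColimits (tensorRight X)]
  [∀ X : C, PreservesFiniteLimits (tensorLeft X)]
  [∀ X : C, PreservesFiniteColimits (tensorLeft X)]

variable (K D : CochainComplex C ℤ) (a : ℤ) [K.IsStrictlyGE a] [D.IsStrictlyGE 0] (m : ℤ)

-- In the long exact sequence of cocycles, cochains and coboundaries, the map to the coboundaries is
-- zero on homology after tensoring: followed by the injective map induced by the inclusion of
-- coboundaries in cochains, it becomes the map induced by `d`, which is null-homotopic.
include a in
lemma epi_homologyMap_cyclesSequence :
    Epi (homologyMap (tensorRightMap (cyclesInclusion K) D) m) := by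
  have hK : ∀ p < a, IsZero (K.X p) := fun p hp => K.isZero_of_isStrictlyGE a p hp
  have : (cyclesSequence K).X₁.IsStrictlyGE a := isStrictlyGE_zeroComplex fun p hp =>
    IsZero.of_mono (K.iCycles p) (hK p hp)
  have : (cyclesSequence K).X₂.IsStrictlyGE a := inferInstanceAs (K.IsStrictlyGE a)
  have : (cyclesSequence K).X₃.IsStrictlyGE a := isStrictlyGE_zeroComplex fun p hp =>
    IsZero.of_epi (factorThruImage (K.d p (p + 1))) (hK p hp)
  let ι : zeroComplex (fun p => image (K.d p (p + 1))) ⟶ zeroComplex fun p => K.X (p + 1) :=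
    zeroComplexMap fun p => image.ι (K.d p (p + 1))
  have hι : toBoundaries K ≫ ι = dTo K := by
    ext p
    exact image.fac (K.d p (p + 1))
  have : (zeroComplex fun p => image (K.d p (p + 1))).IsStrictlyGE a := this
  have : Mono (homologyMap (tensorRightMap ι D) m) :=
    mono_homologyMap_tensorRightMap ι D (fun _ _ => rfl) (fun _ _ => rfl) a
      (fun p : ℤ => inferInstanceAs (Mono (image.ι (K.d p (p + 1))))) m
  have h0 : homologyMap (tensorRightMap (toBoundaries K) D) m = 0 := by
    rw [← cancel_mono (homologyMap (tensorRightMap ι D) m), ← homologyMap_comp,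
      ← tensorRightMap_comp, hι, homologyMap_tensorRightMap_eq_zero (dToHomotopy K), zero_comp]
  exact ((shortExact_tensorShortComplex (cyclesSequence_shortExact K) D a).homology_exact₂ m).epi_f
    h0

include a in
lemma mono_homologyMap_opcyclesSequence :
    Mono (homologyMap (tensorRightMap (opcyclesProjection K) D) m) := by
  have hK : ∀ p < a, IsZero (K.X p) := fun p hp => K.isZero_of_isStrictlyGE a p hp
  have : (opcyclesSequence K).X₁.IsStrictlyGE a := isStrictlyGE_zeroComplex fun p hp =>
    IsZero.of_mono (image.ι (K.d (p - 1) p)) (hK p hp)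
  have : (opcyclesSequence K).X₂.IsStrictlyGE a := inferInstanceAs (K.IsStrictlyGE a)
  have : (opcyclesSequence K).X₃.IsStrictlyGE a := isStrictlyGE_zeroComplex fun p hp =>
    IsZero.of_epi (K.pOpcycles p) (hK p hp)
  let π : zeroComplex (fun p => K.X (p - 1)) ⟶ zeroComplex fun p => image (K.d (p - 1) p) :=
    zeroComplexMap fun p => factorThruImage (K.d (p - 1) p)
  have hπ : π ≫ boundariesInclusion K = dOf K := by
    ext p
    exact image.fac (K.d (p - 1) p)
  have : (zeroComplex fun p => image (K.d (p - 1) p)).IsStrictlyGE a :=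
    inferInstanceAs ((opcyclesSequence K).X₁.IsStrictlyGE a)
  have : Epi (homologyMap (tensorRightMap π D) m) :=
    epi_homologyMap_tensorRightMap π D (fun _ _ => rfl) (fun _ _ => rfl) a
      (fun p : ℤ => inferInstanceAs (Epi (factorThruImage (K.d (p - 1) p)))) m
  have h0 : homologyMap (tensorRightMap (boundariesInclusion K) D) m = 0 := by
    rw [← cancel_epi (homologyMap (tensorRightMap π D) m), ← homologyMap_comp,
      ← tensorRightMap_comp, hπ, homologyMap_tensorRightMap_eq_zero (dOfHomotopy K), comp_zero]
  exact ((shortExact_tensorShortComplex (opcyclesSequence_shortExact K) D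
    a).homology_exact₂ m).mono_g h0

/-- The Künneth formula, for bounded below complexes in an abelian category with an exact tensor
product. -/
theorem exists_isBilimit_kunneth :
    ∃ B : Bicone (fun p : Finset.Icc a (m + 1) => K.homology p ⊗ D.homology (m - p)),
      Nonempty B.IsBilimit ∧ Nonempty (B.pt ≅ (tensorObj K D).homology m) := by
  have hK : ∀ p < a, IsZero (K.X p) := fun p hp => K.isZero_of_isStrictlyGE a p hp
  have : Epi (homologyMap (tensorRightMap (cyclesInclusion K) D) m) :=
    epi_homologyMap_cyclesSequence K D a m
  have : Mono (homologyMap (tensorRightMap (opcyclesProjection K) D) m) :=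
    mono_homologyMap_opcyclesSequence K D a m
  let π : zeroComplex (fun p => K.cycles p) ⟶ zeroComplex fun p => K.homology p :=
    zeroComplexMap fun p => K.homologyπ p
  let ι : (zeroComplex fun p => K.homology p) ⟶ zeroComplex fun p => K.opcycles p :=
    zeroComplexMap fun p => K.homologyι p
  have hH : (zeroComplex fun p => K.homology p).IsStrictlyGE a :=
    isStrictlyGE_zeroComplex fun p hp =>
      IsZero.of_mono (K.homologyι p) (IsZero.of_epi (K.pOpcycles p) (hK p hp))
  have : Epi (homologyMap (tensorRightMap π D) m) :=
    epi_homologyMap_tensorRightMap π D (fun _ _ => rfl) (fun _ _ => rfl) a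
      (fun p => inferInstanceAs (Epi (K.homologyπ p))) m
  have : Mono (homologyMap (tensorRightMap ι D) m) :=
    mono_homologyMap_tensorRightMap ι D (fun _ _ => rfl) (fun _ _ => rfl) a
      (fun p => inferInstanceAs (Mono (K.homologyι p))) m
  have h : cyclesInclusion K ≫ opcyclesProjection K = π ≫ ι := by
    ext p
    exact (K.homology_π_ι p).symm
  -- The map from cocycles to cochains modulo coboundaries now has two epi-mono factorizations on
  -- homology, one through `H(K) ⊗ D` with zero differentials on `H(K)`, the other through `K ⊗ D`.
  -- Uniqueness of images identifies the two.
  have h' : homologyMap (tensorRightMap π D) m ≫ homologyMap (tensorRightMap ι D) m =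
      homologyMap (tensorRightMap (cyclesInclusion K) D) m ≫
        homologyMap (tensorRightMap (opcyclesProjection K) D) m := by
    rw [← homologyMap_comp, ← homologyMap_comp, ← tensorRightMap_comp, ← tensorRightMap_comp, h]
  have := strongEpi_of_epi (homologyMap (tensorRightMap π D) m)
  have := strongEpi_of_epi (homologyMap (tensorRightMap (cyclesInclusion K) D) m)
  obtain ⟨B, hB, ⟨e⟩⟩ := exists_isBilimit_of_d_eq_zero (zeroComplex fun p => K.homology p) D
    (fun _ _ => rfl) a m
  exact ⟨B, hB, ⟨e ≪≫ image.isoStrongEpiMono _ _ h' ≪≫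
    (image.isoStrongEpiMono _ _ rfl).symm⟩⟩

end Kunneth

end ConeIteration

end

/-! ### Exactness of the tensor product of sheaves -/

noncomputable section

namespace ConeIteration

open MonoidalCategory

section Reflective

/-- Every finite diagram in `D` is, up to isomorphism, the image under `L` of a diagram in `C`, and
its colimit is the image of the colimit there; so `G` need only be tested after composition with
`L`. -/
lemma preservesFiniteColimits_of_reflective {C D E : Type*} [Category* C] [Category* D]
    [Category* E] {L : C ⥤ D} {R : D ⥤ C} (e : R ⋙ L ≅ 𝟭 D) [HasFiniteColimits C]
    [PreservesFiniteColimits L] (G : D ⥤ E) [PreservesFiniteColimits (L ⋙ G)] :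
    PreservesFiniteColimits G where
  preservesFiniteColimits J _ _ := ⟨fun {K} => by
    let c := colimit.cocone (K ⋙ R)
    have : PreservesColimit ((K ⋙ R) ⋙ L) G :=
      preservesColimit_of_preserves_colimit_cocone
        (isColimitOfPreserves L (colimit.isColimit (K ⋙ R)))
        (isColimitOfPreserves (L ⋙ G) (colimit.isColimit (K ⋙ R)))
    exact preservesColimit_of_iso_diagram G
      (Functor.associator _ _ _ ≪≫ Functor.isoWhiskerLeft K e ≪≫ K.rightUnitor)⟩

end Reflective

section Presheaf

variable {k : Type u} [Field k] {X : TopCat.{u}} (P : (Opens X)ᵒᵖ ⥤ ModuleCat.{u} k)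

instance : PreservesFiniteLimits (tensorRight P) :=
  preservesFiniteLimits_of_evaluation _ fun U =>
    inferInstanceAs (PreservesFiniteLimits
      ((evaluation _ (ModuleCat.{u} k)).obj U ⋙ tensorRight (P.obj U)))

instance : PreservesFiniteLimits (tensorLeft P) :=
  preservesFiniteLimits_of_evaluation _ fun U =>
    inferInstanceAs (PreservesFiniteLimits
      ((evaluation _ (ModuleCat.{u} k)).obj U ⋙ tensorLeft (P.obj U)))

instance : PreservesFiniteColimits (tensorRight P) :=
  preservesFiniteColimits_of_evaluation _ fun U =>
    inferInstanceAs (PreservesFiniteColimits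
      ((evaluation _ (ModuleCat.{u} k)).obj U ⋙ tensorRight (P.obj U)))

instance : PreservesFiniteColimits (tensorLeft P) :=
  preservesFiniteColimits_of_evaluation _ fun U =>
    inferInstanceAs (PreservesFiniteColimits
      ((evaluation _ (ModuleCat.{u} k)).obj U ⋙ tensorLeft (P.obj U)))

end Presheaf

section Sheaf

variable {k : Type u} [Field k] {X : TopCat.{u}} (F : Sh k X)

/-- The tensor product of sheaves is the sheafification of the tensor product of presheaves. -/
def tensorRightIsoComp :
    sheafification k X ⋙ tensorRight F ≅ tensorRight F.obj ⋙ sheafification k X :=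
  Functor.isoWhiskerLeft _
      ((tensoringRight (Sh k X)).mapIso ((sheafificationIso k X).app F).symm) ≪≫
    Functor.Monoidal.commTensorRight (sheafification k X) F.obj

/-- The tensor product of sheaves is the sheafification of the tensor product of presheaves. -/
def tensorLeftIsoComp :
    sheafification k X ⋙ tensorLeft F ≅ tensorLeft F.obj ⋙ sheafification k X :=
  Functor.isoWhiskerLeft _ ((tensoringLeft (Sh k X)).mapIso ((sheafificationIso k X).app F).symm) ≪≫
    Functor.Monoidal.commTensorLeft (sheafification k X) F.obj

instance : PreservesFiniteColimits (tensorRight F) :=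
  have : PreservesFiniteColimits (sheafification k X ⋙ tensorRight F) :=
    preservesFiniteColimits_of_natIso (tensorRightIsoComp F).symm
  preservesFiniteColimits_of_reflective (sheafificationIso k X) _

instance : PreservesFiniteColimits (tensorLeft F) :=
  have : PreservesFiniteColimits (sheafification k X ⋙ tensorLeft F) :=
    preservesFiniteColimits_of_natIso (tensorLeftIsoComp F).symm
  preservesFiniteColimits_of_reflective (sheafificationIso k X) _

instance : PreservesFiniteLimits (tensorRight F) :=
  preservesFiniteLimits_of_natIso
    (F := sheafToPresheaf _ _ ⋙ tensorRight F.obj ⋙ sheafification k X)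
    (Functor.isoWhiskerLeft _ (tensorRightIsoComp F).symm ≪≫ (Functor.associator _ _ _).symm ≪≫
      Functor.isoWhiskerRight (sheafificationIso k X) _ ≪≫ Functor.leftUnitor _)

instance : PreservesFiniteLimits (tensorLeft F) :=
  preservesFiniteLimits_of_natIso (F := sheafToPresheaf _ _ ⋙ tensorLeft F.obj ⋙ sheafification k X)
    (Functor.isoWhiskerLeft _ (tensorLeftIsoComp F).symm ≪≫ (Functor.associator _ _ _).symm ≪≫
      Functor.isoWhiskerRight (sheafificationIso k X) _ ≪≫ Functor.leftUnitor _)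

end Sheaf

end ConeIteration

end

/-! ### Locally constant sheaves through local models -/

noncomputable section

namespace ConeIteration

open Opposite

section LocalModel

variable {k : Type u} [Field k] {X : TopCat.{u}}

/-- The linear map `α` identifies the restriction of `F` to `U` with a constant sheaf. -/
structure IsLocalModel (F : Sh k X) (U : Opens X) {V : Type*} [AddCommGroup V] [Module k V]
    (α : V →ₗ[k] sec F U) : Prop where
  injective : ∀ {W : Opens X} (h : W ≤ U) {x : X}, x ∈ W → ∀ v, res F h (α v) = 0 → v = 0
  surjective : ∀ {W : Opens X} (h : W ≤ U) {x : X}, x ∈ W → ∀ s : sec F W,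
    ∃ (W' : Opens X) (h' : W' ≤ W), x ∈ W' ∧ ∃ v, res F (h'.trans h) (α v) = res F h' s

lemma isLocalModel_cst (V : ModuleCat.{u} k) (U : Opens X) :
    IsLocalModel (constSheafOf X V) U (cst X V U) where
  injective {W} h x hx v hv := by
    rw [res_cst] at hv
    exact cst_injective V hx (hv.trans (map_zero _).symm)
  surjective {W} h x hx s := by
    obtain ⟨W', h', hxW', v, hv⟩ := exists_cst_eq V s hx
    exact ⟨W', h', hxW', v, by rw [res_cst, hv]⟩

lemma IsLocalModel.restrict {F : Sh k X} {U : Opens X} {V : Type*} [AddCommGroup V] [Module k V]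
    {α : V →ₗ[k] sec F U} (hα : IsLocalModel F U α) {U' : Opens X} (hU : U' ≤ U) :
    IsLocalModel F U' (res F hU ∘ₗ α) where
  injective {W} h x hx v hv := by
    rw [LinearMap.comp_apply, res_res] at hv
    exact hα.injective _ hx v hv
  surjective {W} h x hx s := by
    obtain ⟨W', h', hxW', v, hv⟩ := hα.surjective (h.trans hU) hx s
    exact ⟨W', h', hxW', v, by rw [LinearMap.comp_apply, res_res, hv]⟩

lemma IsLocalModel.map {F G : Sh k X} {U : Opens X} {V : Type*} [AddCommGroup V] [Module k V]
    {α : V →ₗ[k] sec F U} (hα : IsLocalModel F U α) (e : F ≅ G) :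
    IsLocalModel G U (sapp e.hom U ∘ₗ α) where
  injective {W} h x hx v hv := by
    rw [LinearMap.comp_apply, ← sapp_res] at hv
    exact hα.injective h hx v (sapp_injective e.hom W (hv.trans (map_zero _).symm))
  surjective {W} h x hx s := by
    obtain ⟨W', h', hxW', v, hv⟩ := hα.surjective h hx (sapp e.inv W s)
    refine ⟨W', h', hxW', v, ?_⟩
    rw [LinearMap.comp_apply, ← sapp_res, hv, sapp_res, ← sapp_comp, e.inv_hom_id, sapp_id]

lemma mono_of_sapp_injective {F G : Sh k X} (f : F ⟶ G)
    (h : ∀ U, Function.Injective (sapp f U)) : Mono f := by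
  refine ⟨fun g g' hg => sh_hom_ext fun U s => h U ?_⟩
  rw [← sapp_comp, ← sapp_comp, hg]

lemma epi_of_locally_surjective {F G : Sh k X} (f : F ⟶ G)
    (h : ∀ (U : Opens X) (s : sec G U), ∀ x ∈ U, ∃ (V : Opens X) (hV : V ≤ U), x ∈ V ∧
      ∃ t, sapp f V t = res G hV s) : Epi f := by
  refine ⟨fun g g' hg => sh_hom_ext fun U s => sec_ext _ fun x hx => ?_⟩
  obtain ⟨V, hV, hxV, t, ht⟩ := h U s x hx
  refine ⟨V, hV, hxV, ?_⟩
  rw [← sapp_res, ← sapp_res, ← ht, ← sapp_comp, ← sapp_comp, hg]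

/-- The morphism from a constant presheaf given by a linear map to the global sections. -/
def constPresheafDesc (F : Sh k X) (V : ModuleCat.{u} k) (α : V →ₗ[k] sec F ⊤) :
    (Functor.const (Opens X)ᵒᵖ).obj V ⟶ F.obj where
  app U := ModuleCat.ofHom (res F (le_top : U.unop ≤ ⊤) ∘ₗ α)
  naturality U W i := by
    ext v
    exact (res_res F le_top (leOfHom i.unop) (α v)).symm

/-- The morphism from a constant sheaf given by a linear map to the global sections. -/
def constDesc (F : Sh k X) (V : ModuleCat.{u} k) (α : V →ₗ[k] sec F ⊤) : constSheafOf X V ⟶ F :=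
  ⟨sheafifyLift (Opens.grothendieckTopology X) (constPresheafDesc F V α) F.property⟩

lemma sapp_constDesc (F : Sh k X) (V : ModuleCat.{u} k) (α : V →ₗ[k] sec F ⊤) (U : Opens X)
    (v : V) : sapp (constDesc F V α) U (cst X V U v) = res F le_top (α v) := by
  have h := congr($(toSheafify_sheafifyLift (Opens.grothendieckTopology X)
    (constPresheafDesc F V α) F.property).app (op U))
  exact congr($(h).hom v)

/-- The two conditions of a local model over `⊤` say that the induced morphism from the constant
sheaf is mono and epi, hence an isomorphism. -/
lemma isConstant_iff (F : Sh k X) :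
    Sheaf.IsConstant (Opens.grothendieckTopology X) F ↔
      ∃ (V : ModuleCat.{u} k) (α : V →ₗ[k] sec F ⊤), IsLocalModel F ⊤ α := by
  constructor
  · rintro ⟨V, ⟨e⟩⟩
    exact ⟨V, _, (isLocalModel_cst V ⊤).map e⟩
  · rintro ⟨V, α, hα⟩
    have h1 : Mono (constDesc F V α) := by
      refine mono_of_sapp_injective _ fun U => ?_
      rw [← LinearMap.ker_eq_bot, LinearMap.ker_eq_bot']
      intro s hs
      refine sec_ext _ fun x hx => ?_
      obtain ⟨W, hW, hxW, v, hv⟩ := exists_cst_eq V s hx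
      have h2 : v = 0 := by
        refine hα.injective (le_top : W ≤ ⊤) hxW v ?_
        rw [← sapp_constDesc, hv, sapp_res, hs, map_zero]
      exact ⟨W, hW, hxW, by rw [← hv, h2, map_zero, map_zero]⟩
    have h2 : Epi (constDesc F V α) := by
      refine epi_of_locally_surjective _ fun U s x hx => ?_
      obtain ⟨W, hW, hxW, v, hv⟩ := hα.surjective le_top hx s
      exact ⟨W, hW, hxW, cst X V W v, by rw [sapp_constDesc, hv]⟩
    have := isIso_of_mono_of_epi (constDesc F V α)
    exact Sheaf.isConstant_of_iso _ (asIso (constDesc F V α)).symm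

/-- The image of an open subset of an open subspace. -/
def imageOpens (U : Opens X) (W : Opens U) : Opens X :=
  ⟨Subtype.val '' (W : Set U), U.isOpen.isOpenMap_subtype_val _ W.isOpen⟩

lemma imageOpens_le (U : Opens X) (W : Opens U) : imageOpens U W ≤ U := by
  rintro _ ⟨x, -, rfl⟩
  exact x.2

lemma imageOpens_mono (U : Opens X) {W W' : Opens U} (h : W ≤ W') :
    imageOpens U W ≤ imageOpens U W' := Set.image_mono h

lemma le_imageOpens_top (U : Opens X) : U ≤ imageOpens U ⊤ := fun x hx => ⟨⟨x, hx⟩, trivial, rfl⟩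

/-- The preimage of an open subset in an open subspace. -/
def preimageOpens (U : Opens X) (W : Opens X) : Opens U :=
  ⟨Subtype.val ⁻¹' (W : Set X), W.isOpen.preimage continuous_subtype_val⟩

lemma imageOpens_preimageOpens_le (U W : Opens X) : imageOpens U (preimageOpens U W) ≤ W := by
  rintro _ ⟨x, hx, rfl⟩
  exact hx

/-- The restriction of a sheaf to an open subset. -/
abbrev restrictSh (F : Sh k X) (U : Opens X) : Sh k (TopCat.of U) := U.sheafRestrict.obj F

lemma isLocalModel_restrictSh_iff (F : Sh k X) (U : Opens X) (V : Type*) [AddCommGroup V]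
    [Module k V] (α : V →ₗ[k] sec F (imageOpens U ⊤)) :
    IsLocalModel (restrictSh F U) ⊤ α ↔ IsLocalModel F U (res F (le_imageOpens_top U) ∘ₗ α) := by
  constructor
  · intro hα
    constructor
    · intro W h x hx v hv
      refine hα.injective (le_top : preimageOpens U W ≤ ⊤) (x := ⟨x, h hx⟩) hx v ?_
      rw [LinearMap.comp_apply, res_res] at hv
      change res F (imageOpens_mono U le_top) (α v) = 0
      rw [← res_res F (h.trans (le_imageOpens_top U)) (imageOpens_preimageOpens_le U W), hv,
        map_zero]
    · intro W h x hx s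
      obtain ⟨W', h', hxW', v, hv⟩ := hα.surjective (le_top : preimageOpens U W ≤ ⊤)
        (x := ⟨x, h hx⟩) hx (res F (imageOpens_preimageOpens_le U W) s)
      refine ⟨imageOpens U W', (imageOpens_mono U h').trans (imageOpens_preimageOpens_le U W),
        ⟨_, hxW', rfl⟩, v, ?_⟩
      rw [LinearMap.comp_apply, res_res]
      refine Eq.trans hv ?_
      exact res_res F _ (imageOpens_mono U h') s
  · intro hα
    constructor
    · intro W h x hx v hv
      refine hα.injective (imageOpens_le U W) ⟨x, hx, rfl⟩ v ?_
      rw [LinearMap.comp_apply, res_res]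
      exact hv
    · intro W h x hx s
      obtain ⟨W', h', hxW', v, hv⟩ := hα.surjective (imageOpens_le U W) ⟨x, hx, rfl⟩ s
      have hle : preimageOpens U W' ≤ W := fun y hy => by
        obtain ⟨z, hz, hzy⟩ := h' hy
        rwa [← Subtype.ext hzy]
      refine ⟨preimageOpens U W', hle, hxW', v, ?_⟩
      rw [LinearMap.comp_apply, res_res] at hv
      have := congrArg (res F (imageOpens_preimageOpens_le U W')) hv
      rw [res_res] at this
      exact this.trans (res_res F h' (imageOpens_preimageOpens_le U W') s)

/-- A sheaf is locally constant if and only if it has a local model around each point. -/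
theorem isLocallyConstantSheaf_iff (F : Sh k X) :
    IsLocallyConstantSheaf F ↔ ∀ x : X, ∃ U : Opens X, x ∈ U ∧
      ∃ (V : ModuleCat.{u} k) (α : V →ₗ[k] sec F U), IsLocalModel F U α := by
  refine forall_congr' fun x => exists_congr fun U => and_congr_right fun _ => ?_
  refine (isConstant_iff (X := TopCat.of U) (restrictSh F U)).trans ⟨?_, ?_⟩
  · rintro ⟨V, α, hα⟩
    exact ⟨V, _, (isLocalModel_restrictSh_iff F U V α).1 hα⟩
  · rintro ⟨V, α, hα⟩
    refine ⟨V, res F (imageOpens_le U ⊤) ∘ₗ α,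
      (isLocalModel_restrictSh_iff F U V (res F (imageOpens_le U ⊤) ∘ₗ α)).2 ?_⟩
    convert hα using 1
    ext v
    simp only [LinearMap.comp_apply]
    rw [res_res, res_self]

lemma IsLocallyConstantSheaf.of_iso {F G : Sh k X} (hF : IsLocallyConstantSheaf F) (e : F ≅ G) :
    IsLocallyConstantSheaf G := by
  rw [isLocallyConstantSheaf_iff] at hF ⊢
  intro x
  obtain ⟨U, hx, V, α, hα⟩ := hF x
  exact ⟨U, hx, V, _, hα.map e⟩

lemma isLocallyConstantSheaf_constSheafOf (V : ModuleCat.{u} k) :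
    IsLocallyConstantSheaf (constSheafOf X V) :=
  (isLocallyConstantSheaf_iff _).2 fun _ => ⟨⊤, trivial, V, _, isLocalModel_cst V ⊤⟩

lemma isLocallyConstantSheaf_of_isZero {F : Sh k X} (hF : IsZero F) :
    IsLocallyConstantSheaf F := by
  have h0 : ∀ U (s : sec F U), s = 0 := fun U s => congr(sapp $(hF.eq_of_src (𝟙 F) 0) U s)
  exact (isLocallyConstantSheaf_iff _).2 fun x => ⟨⊤, trivial, ModuleCat.of k PUnit, 0,
    ⟨fun _ _ _ _ _ => rfl, fun {W} h x hx s => ⟨W, le_rfl, hx, 0, by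
      rw [h0 W (res F _ s), h0 W (res F _ _)]⟩⟩⟩

end LocalModel

end ConeIteration

end

/-! ### Stability of local constancy under finite sums and tensor products -/

noncomputable section

namespace ConeIteration

open Opposite MonoidalCategory

section Closure

variable {k : Type u} [Field k] {X : TopCat.{u}}

/-- The intersection of a finite family of open subsets. -/
def finiteInf {ι : Type*} [Finite ι] (U : ι → Opens X) : Opens X :=
  ⟨⋂ i, (U i : Set X), isOpen_iInter_of_finite fun i => (U i).isOpen⟩

lemma finiteInf_le {ι : Type*} [Finite ι] (U : ι → Opens X) (i : ι) : finiteInf U ≤ U i :=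
  fun _ hx => Set.mem_iInter.1 hx i

lemma mem_finiteInf {ι : Type*} [Finite ι] {U : ι → Opens X} {x : X} (h : ∀ i, x ∈ U i) :
    x ∈ finiteInf U := Set.mem_iInter.2 h

lemma sapp_sum {ι : Type*} (s : Finset ι) {F G : Sh k X} (f : ι → (F ⟶ G)) (U : Opens X)
    (t : sec F U) : sapp (∑ i ∈ s, f i) U t = ∑ i ∈ s, sapp (f i) U t := by
  classical
  induction s using Finset.induction_on with
  | empty => rfl
  | insert i s hi ih =>
    rw [Finset.sum_insert hi, Finset.sum_insert hi, ← ih]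
    rfl

lemma isLocallyConstantSheaf_of_isBilimit {ι : Type} [Fintype ι] {f : ι → Sh k X}
    {B : Bicone f} (hB : B.IsBilimit) (hf : ∀ i, IsLocallyConstantSheaf (f i)) :
    IsLocallyConstantSheaf B.pt := by
  classical
  simp only [isLocallyConstantSheaf_iff] at hf ⊢
  intro x
  choose U hxU V α hα using fun i => hf i x
  have hself : ∀ i (W : Opens X) (s : sec (f i) W),
      sapp (B.π i) W (sapp (B.ι i) W s) = s := fun i W s => by
    rw [← sapp_comp, bicone_ι_π_self, sapp_id]
  have hne : ∀ i j, i ≠ j → ∀ (W : Opens X) (s : sec (f i) W),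
      sapp (B.π j) W (sapp (B.ι i) W s) = 0 := fun i j hij W s => by
    rw [← sapp_comp, bicone_ι_π_ne _ hij, sapp_zero]
  have htot : ∀ (W : Opens X) (s : sec B.pt W),
      ∑ i, sapp (B.ι i) W (sapp (B.π i) W s) = s := fun W s => by
    have h := IsBilimit.total hB
    have h2 := sapp_sum Finset.univ (fun i => B.π i ≫ B.ι i) W s
    rw [h] at h2
    exact h2.symm
  let β : (∀ i, V i) →ₗ[k] sec B.pt (finiteInf U) :=
    ∑ i, sapp (B.ι i) (finiteInf U) ∘ₗ res (f i) (finiteInf_le U i) ∘ₗ α i ∘ₗ LinearMap.proj i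
  have hβ : ∀ (W : Opens X) (h : W ≤ finiteInf U) (v : ∀ i, V i), res B.pt h (β v) =
      ∑ i, sapp (B.ι i) W (res (f i) (h.trans (finiteInf_le U i)) (α i (v i))) := by
    intro W h v
    simp only [β, LinearMap.sum_apply, map_sum, LinearMap.comp_apply, LinearMap.proj_apply]
    exact Finset.sum_congr rfl fun i _ => by rw [← sapp_res, res_res]
  refine ⟨finiteInf U, mem_finiteInf hxU, ModuleCat.of k (∀ i, V i), β, ?_, ?_⟩
  · intro W h y hy v hv
    rw [hβ] at hv
    funext j
    refine (hα j).injective (h.trans (finiteInf_le U j)) hy (v j) ?_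
    have h1 := congrArg (sapp (B.π j) W) hv
    rw [map_sum, map_zero, Finset.sum_eq_single j (fun i _ hij => hne i j hij W _)
      (fun h => (h (Finset.mem_univ j)).elim), hself] at h1
    exact h1
  · intro W h y hy s
    choose W' h' hy' v hv using fun i =>
      (hα i).surjective (h.trans (finiteInf_le U i)) hy (sapp (B.π i) W s)
    have hle : finiteInf W' ⊓ W ≤ W := inf_le_right
    refine ⟨finiteInf W' ⊓ W, hle, ⟨mem_finiteInf hy', hy⟩, v, ?_⟩
    rw [hβ, ← htot _ (res B.pt hle s)]
    refine Finset.sum_congr rfl fun i _ => congrArg _ ?_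
    have h1 := congrArg (res (f i) (inf_le_left.trans (finiteInf_le W' i) :
      finiteInf W' ⊓ W ≤ W' i)) (hv i)
    rw [res_res, res_res] at h1
    rw [h1, sapp_res]

/-- A presheaf which is locally isomorphic to a constant presheaf, up to sheafification, has a
locally constant associated sheaf. -/
lemma isLocalModel_sheafification (P : (Opens X)ᵒᵖ ⥤ ModuleCat.{u} k) {U : Opens X} {V : Type*}
    [AddCommGroup V] [Module k V] (α : V →ₗ[k] P.obj (op U))
    (hinj : ∀ {W : Opens X} (h : W ≤ U) {x : X}, x ∈ W → ∀ v,
      (P.map (homOfLE h).op).hom (α v) = 0 → v = 0)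
    (hsurj : ∀ {W : Opens X} (h : W ≤ U) {x : X}, x ∈ W → ∀ s : P.obj (op W),
      ∃ (W' : Opens X) (h' : W' ≤ W), x ∈ W' ∧
        ∃ v, (P.map (homOfLE (h'.trans h)).op).hom (α v) = (P.map (homOfLE h').op).hom s) :
    IsLocalModel ((sheafification k X).obj P) U
      (((toSheafify (Opens.grothendieckTopology X) P).app (op U)).hom ∘ₗ α) := by
  let η := toSheafify (Opens.grothendieckTopology X) P
  have hη : ∀ {W W' : Opens X} (h : W' ≤ W) (s : P.obj (op W)),
      res ((sheafification k X).obj P) h ((η.app (op W)).hom s) =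
        (η.app (op W')).hom ((P.map (homOfLE h).op).hom s) := fun h s =>
    congr($(η.naturality (homOfLE h).op).hom s).symm
  have hmap : ∀ {W W' W'' : Opens X} (h : W' ≤ W) (h' : W'' ≤ W') (s : P.obj (op W)),
      (P.map (homOfLE h').op).hom ((P.map (homOfLE h).op).hom s) =
        (P.map (homOfLE (h'.trans h)).op).hom s := fun h h' s => by
    have : P.map (homOfLE h).op ≫ P.map (homOfLE h').op =
        P.map (homOfLE (h'.trans h)).op := by
      rw [← Functor.map_comp, ← op_comp, homOfLE_comp]
    exact congr($(this).hom s)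
  constructor
  · intro W h x hx v hv
    have h1 : (η.app (op W)).hom ((P.map (homOfLE h).op).hom (α v)) = (η.app (op W)).hom 0 :=
      (hη h (α v)).symm.trans (hv.trans (map_zero _).symm)
    obtain ⟨W', i, hW', hxW'⟩ := Presheaf.equalizerSieve_mem (Opens.grothendieckTopology X)
      η (X := op W) _ _ h1 x hx
    refine hinj ((leOfHom i).trans h) hxW' v ?_
    rw [← hmap h (leOfHom i)]
    exact Eq.trans hW' (map_zero (P.map i.op).hom)
  · intro W h x hx s
    obtain ⟨W', i, ⟨t, ht⟩, hxW'⟩ := Presheaf.imageSieve_mem (Opens.grothendieckTopology X)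
      η s x hx
    obtain ⟨W'', h'', hxW'', v, hv⟩ := hsurj ((leOfHom i).trans h) hxW' t
    refine ⟨W'', h''.trans (leOfHom i), hxW'', v, ?_⟩
    refine (hη _ (α v)).trans ?_
    refine (congrArg (η.app (op W'')).hom hv).trans ?_
    refine (hη h'' t).symm.trans ?_
    refine (congrArg (res ((sheafification k X).obj P) h'') ht).trans ?_
    exact res_res _ (leOfHom i) h'' s

/-- The tensor product of sheaves is the sheafification of the tensor product of presheaves. -/
def tensorIsoSheafification (F G : Sh k X) :
    F ⊗ G ≅ (sheafification k X).obj (F.obj ⊗ G.obj) :=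
  (((sheafificationIso k X).app F).symm ⊗ᵢ ((sheafificationIso k X).app G).symm) ≪≫
    Functor.Monoidal.μIso (sheafification k X) F.obj G.obj

/-- The tensor product of two local models is one for the tensor presheaf: injectivity is flatness
over a field, and a section, being a finite sum of pure tensors, becomes constant after finitely
many shrinkings. -/
lemma IsLocallyConstantSheaf.tensor {F G : Sh k X} (hF : IsLocallyConstantSheaf F)
    (hG : IsLocallyConstantSheaf G) : IsLocallyConstantSheaf (F ⊗ G) := by
  suffices IsLocallyConstantSheaf ((sheafification k X).obj (F.obj ⊗ G.obj)) from
    this.of_iso (tensorIsoSheafification F G).symm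
  rw [isLocallyConstantSheaf_iff] at hF hG ⊢
  intro x
  obtain ⟨U₁, hx₁, V₁, α₁, hα₁⟩ := hF x
  obtain ⟨U₂, hx₂, V₂, α₂, hα₂⟩ := hG x
  let U := U₁ ⊓ U₂
  replace hα₁ := hα₁.restrict (inf_le_left : U ≤ U₁)
  replace hα₂ := hα₂.restrict (inf_le_right : U ≤ U₂)
  set β₁ := res F (inf_le_left : U ≤ U₁) ∘ₗ α₁
  set β₂ := res G (inf_le_right : U ≤ U₂) ∘ₗ α₂
  let α : TensorProduct k V₁ V₂ →ₗ[k] (F.obj ⊗ G.obj).obj (op U) := TensorProduct.map β₁ β₂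
  refine ⟨U, ⟨hx₁, hx₂⟩, ModuleCat.of k (TensorProduct k V₁ V₂), _,
    isLocalModel_sheafification (F.obj ⊗ G.obj) α ?_ ?_⟩
  · intro W h y hy v hv
    have h1 : Function.Injective (res F h ∘ₗ β₁) :=
      LinearMap.ker_eq_bot.1 (LinearMap.ker_eq_bot'.2 fun v hv => hα₁.injective h hy v hv)
    have h2 : Function.Injective (res G h ∘ₗ β₂) :=
      LinearMap.ker_eq_bot.1 (LinearMap.ker_eq_bot'.2 fun v hv => hα₂.injective h hy v hv)
    have h3 := TensorProduct.map_injective_of_flat_flat _ _ h1 h2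
    refine h3 (Eq.trans ?_ (map_zero _).symm)
    rw [TensorProduct.map_comp]
    exact hv
  · intro W h y hy s
    change TensorProduct k (sec F W) (sec G W) at s
    suffices ∃ (W' : Opens X) (h' : W' ≤ W), y ∈ W' ∧ ∃ v,
        TensorProduct.map (res F (h'.trans h) ∘ₗ β₁) (res G (h'.trans h) ∘ₗ β₂) v =
          TensorProduct.map (res F h') (res G h') s by
      obtain ⟨W', h', hy', v, hv⟩ := this
      rw [TensorProduct.map_comp] at hv
      exact ⟨W', h', hy', v, hv⟩
    have hres : ∀ {W' W'' : Opens X} (h' : W' ≤ W) (h'' : W'' ≤ W') (v s),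
        TensorProduct.map (res F (h'.trans h) ∘ₗ β₁) (res G (h'.trans h) ∘ₗ β₂) v =
          TensorProduct.map (res F h') (res G h') s →
        TensorProduct.map (res F ((h''.trans h').trans h) ∘ₗ β₁)
          (res G ((h''.trans h').trans h) ∘ₗ β₂) v =
            TensorProduct.map (res F (h''.trans h')) (res G (h''.trans h')) s := by
      intro W' W'' h' h'' v s hv
      have h1 := congrArg (TensorProduct.map (res F h'') (res G h'')) hv
      rw [← LinearMap.comp_apply, ← LinearMap.comp_apply, ← TensorProduct.map_comp,
        ← TensorProduct.map_comp] at h1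
      convert h1 using 3 <;> ext <;> simp only [LinearMap.comp_apply, res_res]
    induction s using TensorProduct.induction_on with
    | zero => exact ⟨W, le_rfl, hy, 0, by rw [map_zero, map_zero]⟩
    | tmul s t =>
      obtain ⟨W₁, h₁, hy₁, v₁, hv₁⟩ := hα₁.surjective h hy s
      obtain ⟨W₂, h₂, hy₂, v₂, hv₂⟩ := hα₂.surjective h hy t
      refine ⟨W₁ ⊓ W₂, inf_le_left.trans h₁, ⟨hy₁, hy₂⟩, TensorProduct.tmul k v₁ v₂, ?_⟩
      rw [TensorProduct.map_tmul, TensorProduct.map_tmul]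
      have e1 := congrArg (res F (inf_le_left : W₁ ⊓ W₂ ≤ W₁)) hv₁
      have e2 := congrArg (res G (inf_le_right : W₁ ⊓ W₂ ≤ W₂)) hv₂
      rw [res_res, res_res] at e1 e2
      exact congrArg₂ (TensorProduct.tmul k) e1 e2
    | add s t hs ht =>
      obtain ⟨W₁, h₁, hy₁, v₁, hv₁⟩ := hs
      obtain ⟨W₂, h₂, hy₂, v₂, hv₂⟩ := ht
      refine ⟨W₁ ⊓ W₂, inf_le_left.trans h₁, ⟨hy₁, hy₂⟩, v₁ + v₂, ?_⟩
      rw [map_add, map_add, hres h₁ inf_le_left v₁ s hv₁]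
      rw [hres h₂ (inf_le_right : W₁ ⊓ W₂ ≤ W₂) v₂ t hv₂]

end Closure

end ConeIteration

end

/-! ### Iterated cones from a chain of triangles -/

noncomputable section

namespace ConeIteration

section Triangulated

variable {T : Type*} [Category* T] [HasZeroObject T] [HasShift T ℤ] [Preadditive T]
  [∀ n : ℤ, (shiftFunctor T n).Additive] [Pretriangulated T] {𝓕 : ObjectProperty T}

lemma FiniteSumsOfShifts.shift {F : T} (hF : FiniteSumsOfShifts 𝓕 F) (a : ℤ) :
    FiniteSumsOfShifts 𝓕 (F⟦a⟧) := by
  obtain ⟨m, E, d, hE, ⟨i⟩⟩ := hF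
  exact ⟨m, E, fun j => d j + a, hE, ⟨(shiftFunctor T a).mapIso i ≪≫
    (shiftFunctor T a).mapBiproduct _ ≪≫
      biproduct.mapIso fun j => ((shiftFunctorAdd T (d j) a).app (E j)).symm⟩⟩

lemma FiniteSumsOfShifts.of_mem {F : T} (hF : 𝓕 F) : FiniteSumsOfShifts 𝓕 F :=
  ⟨1, fun _ => F, fun _ => 0, fun _ => hF,
    ⟨((shiftFunctorZero T ℤ).app F).symm ≪≫ (biproductUniqueIso fun _ : Fin 1 => F⟦(0 : ℤ)⟧).symm⟩⟩

lemma IteratedCones.shift (a : ℤ) : ∀ (j : ℕ) {F : T}, IteratedCones 𝓕 j F →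
    IteratedCones 𝓕 j (F⟦a⟧)
  | 0, _, hF => FiniteSumsOfShifts.shift hF a
  | j + 1, _, ⟨_, _, _, _, _, h₁, h₀, hT⟩ =>
    ⟨_, _, _, _, _, IteratedCones.shift a j h₁, h₀.shift a, Triangle.shift_distinguished _ hT a⟩

/-- Replace the first two objects of a distinguished triangle by isomorphic ones. -/
lemma distinguished_of_iso₁₂ {A A' B B' C : T} {f : A ⟶ B} {g : B ⟶ C} {h : C ⟶ A⟦(1 : ℤ)⟧}
    (hT : Triangle.mk f g h ∈ distTriang T) (e : A' ≅ A) (e' : B' ≅ B) :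
    Triangle.mk (e.hom ≫ f ≫ e'.inv) (e'.hom ≫ g) (h ≫ e.inv⟦(1 : ℤ)⟧') ∈ distTriang T := by
  refine isomorphic_distinguished _ hT _ (Triangle.isoMk _ _ e e' (Iso.refl _) ?_ ?_ ?_)
  · change (e.hom ≫ f ≫ e'.inv) ≫ e'.hom = e.hom ≫ f
    simp
  · exact Category.comp_id _
  · change (h ≫ e.inv⟦(1 : ℤ)⟧') ≫ e.hom⟦(1 : ℤ)⟧' = 𝟙 C ≫ h
    rw [Category.assoc, ← Functor.map_comp, e.inv_hom_id, CategoryTheory.Functor.map_id,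
      Category.comp_id, Category.id_comp]

/-- A sequence of distinguished triangles `P j → E j → P (j + 1) → P j[1]` exhibits the cone of
the composite `P (j + 1)[-j-1] → P 0` as an iterated cone on the `E i`. -/
lemma exists_iteratedCone [IsTriangulated T] (P E : ℕ → T) (hE : ∀ j, 𝓕 (E j))
    (f : ∀ j, P j ⟶ E j) (g : ∀ j, E j ⟶ P (j + 1)) (h : ∀ j, P (j + 1) ⟶ (P j)⟦(1 : ℤ)⟧)
    (hT : ∀ j, Triangle.mk (f j) (g j) (h j) ∈ distTriang T) (j : ℕ) :
    ∃ (C : T) (u : (P (j + 1))⟦-((j + 1 : ℕ) : ℤ)⟧ ⟶ P 0) (v : P 0 ⟶ C)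
      (w : C ⟶ ((P (j + 1))⟦-((j + 1 : ℕ) : ℤ)⟧)⟦(1 : ℤ)⟧),
      Triangle.mk u v w ∈ distTriang T ∧ IteratedCones 𝓕 j C := by
  have key : ∀ i : ℕ, ∃ (Z : T) (u : (P (i + 1))⟦-((i + 1 : ℕ) : ℤ)⟧ ⟶ (P i)⟦-(i : ℤ)⟧)
      (v : (P i)⟦-(i : ℤ)⟧ ⟶ Z) (w : Z ⟶ ((P (i + 1))⟦-((i + 1 : ℕ) : ℤ)⟧)⟦(1 : ℤ)⟧),
      Triangle.mk u v w ∈ distTriang T ∧ FiniteSumsOfShifts 𝓕 Z := by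
    intro i
    have h1 := inv_rot_of_distTriang _ (Triangle.shift_distinguished _ (hT i) (-(i : ℤ)))
    let e : (P (i + 1))⟦-((i + 1 : ℕ) : ℤ)⟧ ≅ ((P (i + 1))⟦-(i : ℤ)⟧)⟦(-1 : ℤ)⟧ :=
      (shiftFunctorAdd' T (-(i : ℤ)) (-1) (-((i + 1 : ℕ) : ℤ)) (by push_cast; ring)).app _
    exact ⟨_, _, _, _, distinguished_of_iso₁₂ h1 e (Iso.refl _),
      (FiniteSumsOfShifts.of_mem (hE i)).shift _⟩
  induction j with
  | zero =>
    obtain ⟨Z, u, v, w, hZ, hm⟩ := key 0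
    let e : (P 0)⟦-((0 : ℕ) : ℤ)⟧ ≅ P 0 :=
      (shiftFunctorZero' T _ (by simp)).app _
    exact ⟨Z, _, _, _, distinguished_of_iso₁₂ hZ (Iso.refl _) e.symm, hm⟩
  | succ j ih =>
    obtain ⟨C, u, v, w, hC, hm⟩ := ih
    obtain ⟨Z, u', v', w', hZ, hm'⟩ := key (j + 1)
    obtain ⟨C', v'', w'', hC'⟩ := distinguished_cocone_triangle (u' ≫ u)
    -- The octahedron gives a triangle `Z → C' → C → Z[1]`; rotated back to `C[-1] → Z → C'`, it
    -- exhibits `C'` as one more cone step.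
    have o := Triangulated.someOctahedron rfl hZ hC hC'
    exact ⟨C', _, _, _, hC', _, _, _, _, _, IteratedCones.shift (-1) j hm, hm',
      inv_rot_of_distTriang _ o.mem⟩

end Triangulated

end ConeIteration

end

/-! ### Truncation and tensor powers -/

noncomputable section

namespace ConeIteration

open Opposite MonoidalCategory HomologicalComplex

section Kunneth

variable {C : Type*} [Category* C] [Abelian C] [MonoidalCategory C] [MonoidalPreadditive C]
  [∀ K₁ K₂ : CochainComplex C ℤ, HasTensor K₁ K₂]
  [∀ X : C, PreservesFiniteLimits (tensorRight X)]
  [∀ X : C, PreservesFiniteColimits (tensorRight X)]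
  [∀ X : C, PreservesFiniteLimits (tensorLeft X)]
  [∀ X : C, PreservesFiniteColimits (tensorLeft X)]

lemma isZero_homology_tensorObj (K D : CochainComplex C ℤ) [K.IsStrictlyGE 0] [D.IsStrictlyGE 0]
    {a b : ℤ} (hK : ∀ p < a, IsZero (K.homology p)) (hD : ∀ q < b, IsZero (D.homology q))
    (m : ℤ) (hm : m < a + b) :
    IsZero ((tensorObj K D).homology m) := by
  obtain ⟨B, ⟨hB⟩, ⟨e⟩⟩ := exists_isBilimit_kunneth K D 0 m
  refine IsZero.of_iso ?_ e.symm
  rw [IsZero.iff_id_eq_zero, ← IsBilimit.total hB]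
  refine Finset.sum_eq_zero fun p _ => ?_
  have : IsZero (K.homology p ⊗ D.homology (m - p)) := by
    by_cases hp : (p : ℤ) < a
    · exact isZero_tensor_left (hK _ hp) _
    · exact isZero_tensor_right _ (hD _ (by lia))
  rw [this.eq_zero_of_tgt (B.π p), zero_comp]

end Kunneth

section Truncation

variable {C : Type*} [Category* C] [Abelian C]

lemma isStrictlyGE_of_shortExact {S : ShortComplex (CochainComplex C ℤ)} (hS : S.ShortExact)
    (a : ℤ) [S.X₂.IsStrictlyGE a] : S.X₁.IsStrictlyGE a ∧ S.X₃.IsStrictlyGE a := by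
  simp only [CochainComplex.isStrictlyGE_iff]
  refine ⟨fun i hi => ?_, fun i hi => ?_⟩
  · have := (hS.map_of_exact (eval C _ i)).mono_f
    exact @IsZero.of_mono _ _ _ _ _ (S.map (eval C _ i)).f this (S.X₂.isZero_of_isStrictlyGE a i hi)
  · have := (hS.map_of_exact (eval C _ i)).epi_g
    exact @IsZero.of_epi _ _ _ _ _ (S.map (eval C _ i)).g this (S.X₂.isZero_of_isStrictlyGE a i hi)

/-- The lowest cohomology of a complex in nonnegative degrees is, up to isomorphism, a
subcomplex. -/
lemma nonempty_truncLE_iso_single (K : CochainComplex C ℤ) [K.IsStrictlyGE 0] :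
    Nonempty (K.truncLE 0 ≅ (single C (.up ℤ) 0).obj (K.homology 0)) := by
  have : (K.shortComplexTruncLE 0).X₂.IsStrictlyGE 0 := inferInstanceAs (K.IsStrictlyGE 0)
  have : (K.truncLE 0).IsStrictlyGE 0 :=
    (isStrictlyGE_of_shortExact (K.shortComplexTruncLE_shortExact 0) 0).1
  obtain ⟨M, ⟨e⟩⟩ := (K.truncLE 0).exists_iso_single 0
  let i : M ≅ K.homology 0 := (singleObjHomologySelfIso (.up ℤ) 0 M).symm ≪≫
    ((homologyFunctor C (.up ℤ) 0).mapIso e).symm ≪≫ isoOfQuasiIsoAt (K.ιTruncLE 0) 0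
  exact ⟨e ≪≫ (single C _ 0).mapIso i⟩

lemma isZero_homology_shortComplexTruncLE_X₃ (K : CochainComplex C ℤ) (i : ℤ) (hi : i < 1) :
    IsZero ((K.shortComplexTruncLE 0).X₃.homology i) :=
  IsZero.of_iso ((K.truncGE 1).isZero_of_isGE 1 i hi)
    (isoOfQuasiIsoAt (K.shortComplexTruncLEX₃ToTruncGE 0 1) i)

lemma nonempty_homology_shortComplexTruncLE_X₃_iso (K : CochainComplex C ℤ) (i : ℤ) (hi : 1 ≤ i) :
    Nonempty ((K.shortComplexTruncLE 0).X₃.homology i ≅ K.homology i) :=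
  have := K.quasiIsoAt_πTruncGE 1 i hi
  ⟨isoOfQuasiIsoAt (K.shortComplexTruncLEX₃ToTruncGE 0 1) i ≪≫
    (isoOfQuasiIsoAt (K.πTruncGE 1) i).symm⟩

end Truncation

section Unit

variable {k : Type u} [Field k] {X : TopCat.{u}}

variable (k X) in
/-- The unit for the tensor product of sheaves is the constant sheaf. -/
def tensorUnitIsoConstSheaf : 𝟙_ (Sh k X) ≅ constSheaf k X :=
  Functor.Monoidal.εIso (sheafification k X)

lemma nonempty_tensorObj_constSheaf_iso {A : CochainComplex (Sh k X) ℤ}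
    (e : A ≅ (single (Sh k X) (.up ℤ) 0).obj (constSheaf k X)) (D : CochainComplex (Sh k X) ℤ) :
    Nonempty (tensorObj A D ≅ D) := by
  have : ∀ F : Sh k X, PreservesColimit (Functor.empty.{0} (Sh k X))
      ((curriedTensor (Sh k X)).flip.obj F) := fun F =>
    inferInstanceAs (PreservesColimit (Functor.empty.{0} (Sh k X)) (tensorRight F))
  exact ⟨tensorRightIso (e ≪≫ (single _ _ 0).mapIso (tensorUnitIsoConstSheaf k X).symm) D ≪≫
    leftUnitor D⟩

lemma isLocallyConstantSheaf_homology_tensorObj (K D : CochainComplex (Sh k X) ℤ)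
    [K.IsStrictlyGE 0] [D.IsStrictlyGE 0] (hK : ∀ p, IsLocallyConstantSheaf (K.homology p))
    (hD : ∀ q, IsLocallyConstantSheaf (D.homology q)) (m : ℤ) :
    IsLocallyConstantSheaf ((tensorObj K D).homology m) := by
  obtain ⟨B, ⟨hB⟩, ⟨e⟩⟩ := exists_isBilimit_kunneth K D 0 m
  exact (isLocallyConstantSheaf_of_isBilimit hB fun p => (hK p).tensor (hD _)).of_iso e

end Unit

section Power

variable {k : Type u} [Field k] {X : TopCat.{u}}

/-- The iterated tensor product `C ⊗ (C ⊗ ⋯ (C ⊗ k_X))`. -/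
def tensorPower (C : CochainComplex (Sh k X) ℤ) : ℕ → CochainComplex (Sh k X) ℤ
  | 0 => (single (Sh k X) (.up ℤ) 0).obj (constSheaf k X)
  | j + 1 => tensorObj C (tensorPower C j)

variable (C : CochainComplex (Sh k X) ℤ) [C.IsStrictlyGE 0]

instance isStrictlyGE_tensorPower : ∀ j, (tensorPower C j).IsStrictlyGE 0
  | 0 => inferInstanceAs (CochainComplex.IsStrictlyGE
      ((single (Sh k X) (.up ℤ) 0).obj (constSheaf k X)) 0)
  | j + 1 =>
    have := isStrictlyGE_tensorPower j
    isStrictlyGE_tensorObj C (tensorPower C j) 0 0 0 rfl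

lemma isLocallyConstantSheaf_homology_tensorPower
    (hC : ∀ p, IsLocallyConstantSheaf (C.homology p)) :
    ∀ (j : ℕ) (m : ℤ), IsLocallyConstantSheaf ((tensorPower C j).homology m)
  | 0, m => by
    by_cases hm : m = 0
    · subst hm
      exact (isLocallyConstantSheaf_constSheafOf (ModuleCat.of k k)).of_iso
        (singleObjHomologySelfIso (.up ℤ) 0 (constSheaf k X)).symm
    · exact isLocallyConstantSheaf_of_isZero (isZero_single_obj_homology _ _ _ _ hm)
  | j + 1, m => isLocallyConstantSheaf_homology_tensorObj C _ hC
      (isLocallyConstantSheaf_homology_tensorPower hC j) m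

/-- Lower bounds on cohomological degrees add under tensor product by Künneth, so each factor `C`
contributes one. -/
lemma isZero_homology_tensorPower (hC : ∀ p < 1, IsZero (C.homology p)) :
    ∀ (j : ℕ) (m : ℤ), m < j → IsZero ((tensorPower C j).homology m)
  | 0, m, hm => isZero_single_obj_homology _ _ _ _ (by simpa using hm.ne)
  | j + 1, m, hm => isZero_homology_tensorObj C _ hC
      (isZero_homology_tensorPower hC j) m (by push_cast at hm; lia)

end Power

end ConeIteration

end

/-! ### Splitting off the constant sheaf -/

noncomputable section

namespace ConeIteration

open HomologicalComplex

section Derived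

variable {k : Type u} [Field k] {X : TopCat.{u}} [HasDerivedCategory.{w} (Sh k X)]

/-- The triangle obtained by tensoring `H⁰(K) → K → C` with a complex, when `H⁰(K)` is the
constant sheaf. -/
lemma exists_distinguished_tensorPower (K : CochainComplex (Sh k X) ℤ) [K.IsStrictlyGE 0]
    (e : K.homology 0 ≅ constSheaf k X) (D : CochainComplex (Sh k X) ℤ) [D.IsStrictlyGE 0] :
    ∃ (f : DerivedCategory.Q.obj D ⟶ DerivedCategory.Q.obj (tensorObj K D))
      (g : DerivedCategory.Q.obj (tensorObj K D) ⟶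
        DerivedCategory.Q.obj (tensorObj (K.shortComplexTruncLE 0).X₃ D))
      (h : DerivedCategory.Q.obj (tensorObj (K.shortComplexTruncLE 0).X₃ D) ⟶
        (DerivedCategory.Q.obj D)⟦(1 : ℤ)⟧),
      Triangle.mk f g h ∈ distTriang (DerivedCategory (Sh k X)) := by
  have hS := K.shortComplexTruncLE_shortExact 0
  have h₂ : (K.shortComplexTruncLE 0).X₂.IsStrictlyGE 0 := inferInstanceAs (K.IsStrictlyGE 0)
  obtain ⟨h₁, h₃⟩ := isStrictlyGE_of_shortExact hS 0
  obtain ⟨i⟩ := nonempty_truncLE_iso_single K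
  obtain ⟨i'⟩ := nonempty_tensorObj_constSheaf_iso (i ≪≫ (single _ _ 0).mapIso e) D
  exact ⟨_, _, _, distinguished_of_iso₁₂ (DerivedCategory.triangleOfSES_distinguished
    (shortExact_tensorShortComplex hS D 0)) (DerivedCategory.Q.mapIso i'.symm) (Iso.refl _)⟩

/-- The homology of an object of the derived category, computed on a representing complex. -/
def homologyIsoOfIsoQ {L : DerivedCategory (Sh k X)} {K : CochainComplex (Sh k X) ℤ}
    (e : L ≅ DerivedCategory.Q.obj K) (i : ℤ) :
    (DerivedCategory.homologyFunctor (Sh k X) i).obj L ≅ K.homology i :=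
  (DerivedCategory.homologyFunctor (Sh k X) i).mapIso e ≪≫
    (DerivedCategory.homologyFunctorFactors (Sh k X) i).app K

lemma isDirectSummand_of_distinguished_zero {T : Type*} [Category* T] [HasZeroObject T]
    [HasShift T ℤ] [Preadditive T] [∀ n : ℤ, (shiftFunctor T n).Additive] [Pretriangulated T]
    {A B C : T} {f : A ⟶ B} {g : B ⟶ C} {h : C ⟶ A⟦(1 : ℤ)⟧}
    (hT : Triangle.mk f g h ∈ distTriang T) (hf : f = 0) : IsDirectSummand B C := by
  obtain ⟨e, -⟩ := exists_iso_binaryBiproduct_of_distTriang _ (rot_of_distTriang _ hT) (by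
    change -f⟦(1 : ℤ)⟧' = 0
    rw [hf, Functor.map_zero, neg_zero])
  exact ⟨_, ⟨e⟩⟩

theorem exists_iteratedCones_isDirectSummand (n : ℕ)  [ChartedSpace (EuclideanSpace ℝ (Fin n)) X]
    (L : DerivedCategory (Sh k X)) (hL : Dlc L)
    (hneg : ∀ i : ℤ, i < 0 → IsZero ((DerivedCategory.homologyFunctor _ i).obj L))
    (hzero : Nonempty ((DerivedCategory.homologyFunctor _ 0).obj L ≅ constSheaf k X))
    (j : ℕ) (hj : n ≤ 2 * j + 1) :
    ∃ F, IteratedCones (tensorFamily L) j F ∧ IsDirectSummand (constObj k X) F := by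
  have hLge : L.IsGE 0 := (DerivedCategory.isGE_iff L 0).2 hneg
  obtain ⟨K, hK, ⟨eL⟩⟩ := DerivedCategory.exists_iso_Q_obj_of_isGE L 0
  obtain ⟨e₀⟩ := hzero
  let C := (K.shortComplexTruncLE 0).X₃
  have h₂ : (K.shortComplexTruncLE 0).X₂.IsStrictlyGE 0 := hK
  have hC : C.IsStrictlyGE 0 :=
    (isStrictlyGE_of_shortExact (K.shortComplexTruncLE_shortExact 0) 0).2
  have hC₀ : ∀ p < 1, IsZero (C.homology p) := isZero_homology_shortComplexTruncLE_X₃ K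
  have hClc : ∀ p, IsLocallyConstantSheaf (C.homology p) := fun p => by
    by_cases hp : p < 1
    · exact isLocallyConstantSheaf_of_isZero (hC₀ p hp)
    · obtain ⟨i⟩ := nonempty_homology_shortComplexTruncLE_X₃_iso K p (by lia)
      exact (hL p).of_iso (homologyIsoOfIsoQ eL p ≪≫ i.symm)
  let P : ℕ → DerivedCategory (Sh k X) := fun i => DerivedCategory.Q.obj (tensorPower C i)
  choose f g h hT using fun i : ℕ => exists_distinguished_tensorPower K
    ((homologyIsoOfIsoQ eL 0).symm ≪≫ e₀) (tensorPower C i)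
  have hmem : ∀ i, tensorFamily L (DerivedCategory.Q.obj (tensorObj K (tensorPower C i))) :=
    fun i => ⟨P i, fun p =>
      (isLocallyConstantSheaf_homology_tensorPower C hClc i p).of_iso
        (homologyIsoOfIsoQ (Iso.refl _) p).symm,
      K, tensorPower C i, ⟨eL.symm⟩, ⟨Iso.refl _⟩, ⟨Iso.refl _⟩⟩
  obtain ⟨F, u, v, w, hF, hm⟩ := exists_iteratedCone
    P (fun i => DerivedCategory.Q.obj (tensorObj K (tensorPower C i))) hmem f g h hT j
  have hge : (P (j + 1)).IsGE ((j + 1 : ℕ) : ℤ) :=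
    (DerivedCategory.isGE_iff _ _).2 fun p hp =>
      (isZero_homology_tensorPower C hC₀ (j + 1) p hp).of_iso (homologyIsoOfIsoQ (Iso.refl _) p)
  -- The degree is gained twice: `j + 1` from the tensor power and `j + 1` from the shift. This is
  -- why about `n / 2` cones suffice.
  have hge' : ((P (j + 1))⟦-((j + 1 : ℕ) : ℤ)⟧).IsGE ((j + 1 : ℕ) + (j + 1 : ℕ) : ℤ) :=
    DerivedCategory.TStructure.t.isGE_shift _ ((j + 1 : ℕ) : ℤ) _ _ (by lia)
  have hge'' : ((P (j + 1))⟦-((j + 1 : ℕ) : ℤ)⟧).IsGE ((n : ℤ) + 1) :=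
    DerivedCategory.TStructure.t.isGE_of_ge _ _ ((j + 1 : ℕ) + (j + 1 : ℕ) : ℤ) (by lia)
  exact ⟨F, hm, isDirectSummand_of_distinguished_zero hF (hom_constObj_eq_zero n u)⟩

end Derived

end ConeIteration

end

theorem lemma5p2 {k : Type u} [Field k] {M : Type u} [TopologicalSpace M] [T2Space M]
    [SecondCountableTopology M] (n : ℕ) [ChartedSpace (EuclideanSpace ℝ (Fin n)) M]
    [HasDerivedCategory.{w} (ConeIteration.Sh k (TopCat.of M))]
    (L : DerivedCategory (ConeIteration.Sh k (TopCat.of M)))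
    (hL : ConeIteration.Dlc L)
    (hneg : ∀ i : ℤ, i < 0 → IsZero ((DerivedCategory.homologyFunctor _ i).obj L))
    (hzero : Nonempty ((DerivedCategory.homologyFunctor _ 0).obj L ≅
      ConeIteration.constSheaf k (TopCat.of M))) :
    ∃ F : DerivedCategory (ConeIteration.Sh k (TopCat.of M)),
      ConeIteration.IteratedCones (ConeIteration.tensorFamily L) ⌈((n : ℚ) - 1) / 2⌉₊ F ∧
        ConeIteration.IsDirectSummand (ConeIteration.constObj k (TopCat.of M)) F := by
  have : ChartedSpace (EuclideanSpace ℝ (Fin n)) (TopCat.of M) :=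
    inferInstanceAs (ChartedSpace (EuclideanSpace ℝ (Fin n)) M)
  refine ConeIteration.exists_iteratedCones_isDirectSummand n L hL hneg hzero _ ?_
  have h := Nat.le_ceil (((n : ℚ) - 1) / 2)
  have h' : (n : ℚ) ≤ 2 * (⌈((n : ℚ) - 1) / 2⌉₊ : ℚ) + 1 := by linarith
  exact_mod_cast h'
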